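/- Let $n\ge 2$, let $d\sigma$ be the normalized Lebesgue measure on the unit sphere $S^{n-1}\subset\mathbb R^n$, and let $0<\beta\le 1$, $0\le\alpha<n-\beta$, $\frac{n}{n+\beta}<p<1$, $\frac1q=\frac1p-\frac{\alpha+\beta}{n}$. Suppose that $$r>\max\Big\{\frac{n}{\beta+n-n/p},\ \frac{n}{n-\alpha-\beta}\Big\}$$ and that $\Omega:\mathbb R^n\times\mathbb R^n\to\mathbb C$ is a measurable function such that $\Omega(x,\lambda z)=\Omega(x,z)$ for all $x,z\in\mathbb R^n$, $\lambda>0$, and $\sup_{x}\big(\int_{S^{n-1}}|\Omega(x,z')|^r\,d\sigma(z')\big)^{1/r}<\infty$. Suppose moreover that $$\int_0^1\frac{\omega_r(\delta)}{\delta^{1+\beta}}\,d\delta<\infty,\qquad \omega_r(\delta)=\sup_{x\in\mathbb R^n,\ |\rho|<\delta}\Big(\int_{S^{n-1}}|\Omega(x,\rho z')-\Omega(x,z')|^r\,d\sigma(z')\Big)^{1/r},$$ where $\rho$ ranges over the rotations of $\mathbb R^n$ and $|\rho|=\sup_{z'\in S^{n-1}}|\rho z'-z'|$. (No cancellation of $\Omega$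 is assumed.) For a function $b:\mathbb R^n\to\mathbb C$ put $\|b\|_{\mathrm{Lip}_\beta}=\sup_{x\ne y}|b(x)-b(y)|/|x-y|^\beta$, and for a function $f$ put $$[b,T_{\Omega,\alpha}]f(x)=\int_{\mathbb R^n}\frac{\Omega(x,x-y)}{|x-y|^{n-\alpha}}\,(b(x)-b(y))f(y)\,dy .$$ The Hardy space $H^p=H^p(\mathbb R^n)$ consists of the tempered distributions $F=\sum_j\lambda_ja_j$ (convergence in the sense of distributions) with $\lambda_j\in\mathbb C$, $\sum_j|\lambda_j|^p<\infty$ and $(p,2)$-atoms $a_j$, with $\|F\|_{H^p}=\inf\big(\sum_j|\lambda_j|^p\big)^{1/p}$ over all such decompositions; a $(p,2)$-atom is a function $a\in L^2$ supported in a closed ball $B$ with $\|a\|_{L^2}\le|B|^{1/2-1/p}$ and $\int a(x)x^\gamma\,dx=0$ for all multi-indices with $|\gamma|\le\lfloor n(1/p-1)\rfloor$. Then there is a constant $C>0$ such that for every $b$ with $\|b\|_{\mathrm{Lip}_\beta}<\infty$ the commutator is bounded from $H^p$ into $L^q$ with norm at most $C\|b\|_{\mathrm{Lip}_\beta}$.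 That is: there is exactly one bounded linear operator $[b,T_{\Omega,\alpha}]:H^p\to L^q(\mathbb R^n)$ such that, whenever $F\in H^p$ is given by a function $f\in L^\ell(\mathbb R^n)$ with $\frac{r}{r-1}<\ell<\frac{n}{\alpha+\beta}$, the integral above converges absolutely and equals $[b,T_{\Omega,\alpha}]F(x)$ for almost every $x$; and this operator satisfies $$\|[b,T_{\Omega,\alpha}]F\|_{L^q}\le C\,\|b\|_{\mathrm{Lip}_\beta}\,\|F\|_{H^p}\qquad\text{for all }F\in H^p,$$ with $C$ independent of $F$ and $b$. -/

import Mathlib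

open MeasureTheory Metric Set
open scoped ENNReal NNReal SchwartzMap

noncomputable section

namespace VariableKernel

/-- Euclidean space `ℝⁿ`. -/
abbrev Rn (n : ℕ) : Type := EuclideanSpace ℝ (Fin n)

/-- The unit sphere `Sⁿ⁻¹`. -/
abbrev Sph (n : ℕ) : Type := sphere (0 : Rn n) 1

/-- Normalized Lebesgue (surface) measure on the unit sphere. -/
def sphereMeasure (n : ℕ) : Measure (Sph n) :=
  ((volume : Measure (Rn n)).toSphere univ)⁻¹ • (volume : Measure (Rn n)).toSphere

/-- `‖Ω‖ = sup_x (∫_{S^{n-1}} |Ω(x,z')|^r dσ(z'))^{1/r}`. -/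
def kernelNorm {n : ℕ} (r : ℝ) (Ω : Rn n → Rn n → ℂ) : ℝ≥0∞ :=
  ⨆ x : Rn n, (∫⁻ z : Sph n, ‖Ω x z‖ₑ ^ r ∂sphereMeasure n) ^ (1 / r)

/-- `Ω ∈ L^∞(ℝⁿ) × L^r(S^{n-1})`: a (jointly Borel) function on `ℝⁿ × ℝⁿ`, homogeneous of degree
zero in the second variable, with finite mixed norm. -/
structure IsKernel {n : ℕ} (r : ℝ) (Ω : Rn n → Rn n → ℂ) : Prop where
  measurable : Measurable (Function.uncurry Ω)
  homogeneous : ∀ (x z : Rn n) (t : ℝ), 0 < t → Ω x (t • z) = Ω x z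
  norm_lt_top : kernelNorm r Ω < ∞

/-- A rotation of `ℝⁿ`: a linear isometry of determinant one. -/
def IsRotation {n : ℕ} (ρ : Rn n ≃ₗᵢ[ℝ] Rn n) : Prop :=
  LinearMap.det (ρ.toLinearEquiv : Rn n →ₗ[ℝ] Rn n) = 1

/-- `|ρ| = sup_{z' ∈ S^{n-1}} |ρ z' - z'|`. -/
def rotationSize {n : ℕ} (ρ : Rn n ≃ₗᵢ[ℝ] Rn n) : ℝ≥0∞ :=
  ⨆ z : Sph n, ‖ρ z - (z : Rn n)‖ₑ

/-- The integral modulus of continuity of order `r` of `Ω` in its second variable. -/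
def modulus {n : ℕ} (r : ℝ) (Ω : Rn n → Rn n → ℂ) (δ : ℝ) : ℝ≥0∞ :=
  ⨆ (x : Rn n) (ρ : Rn n ≃ₗᵢ[ℝ] Rn n) (_ : IsRotation ρ)
    (_ : rotationSize ρ < ENNReal.ofReal δ),
      (∫⁻ z : Sph n, ‖Ω x (ρ z) - Ω x z‖ₑ ^ r ∂sphereMeasure n) ^ (1 / r)

/-- `∫₀¹ ω_r(δ) δ^{-1-β} dδ < ∞`. -/
def DiniCondition {n : ℕ} (r β : ℝ) (Ω : Rn n → Rn n → ℂ) : Prop :=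
  ∫⁻ δ in Ioo (0 : ℝ) 1, modulus r Ω δ / ENNReal.ofReal (δ ^ (1 + β)) < ∞

/-- The homogeneous Lipschitz (Hölder) seminorm `sup_{x ≠ y} |b(x) - b(y)| / |x - y|^β`. -/
def lipNorm {n : ℕ} (β : ℝ) (b : Rn n → ℂ) : ℝ≥0∞ :=
  ⨆ (x : Rn n) (y : Rn n) (_ : x ≠ y), ‖b x - b y‖ₑ / ENNReal.ofReal (‖x - y‖ ^ β)

/-- The integrand of the commutator `[b, T_{Ω,α}] f (x)`. -/
def commutatorIntegrand {n : ℕ} (Ω : Rn n → Rn n → ℂ) (α : ℝ) (b f : Rn n → ℂ) (x y : Rn n) : ℂ :=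
  Ω x (x - y) / ((‖x - y‖ ^ ((n : ℝ) - α) : ℝ) : ℂ) * (b x - b y) * f y

/-- The commutator `[b, T_{Ω,α}] f (x)` of a function `f`, as a Lebesgue integral. -/
def commutator {n : ℕ} (Ω : Rn n → Rn n → ℂ) (α : ℝ) (b f : Rn n → ℂ) (x : Rn n) : ℂ :=
  ∫ y, commutatorIntegrand Ω α b f x y

/-- `(p,s)`-atoms, with vanishing moments up to order `⌊n(1/p - 1)⌋`. -/
def IsAtom {n : ℕ} (p s : ℝ) (a : Rn n → ℂ) : Prop :=
  MemLp a (ENNReal.ofReal s) volume ∧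
  ∃ (x₀ : Rn n) (d : ℝ), 0 < d ∧
    Function.support a ⊆ closedBall x₀ d ∧
    eLpNorm a (ENNReal.ofReal s) volume ≤ volume (closedBall x₀ d) ^ (1 / s - 1 / p) ∧
    ∀ γ : Fin n → ℕ, ((∑ i, γ i : ℕ) : ℤ) ≤ ⌊(n : ℝ) * (1 / p - 1)⌋ →
      ∫ x, a x * ((∏ i, x i ^ γ i : ℝ) : ℂ) = 0

/-- `f = ∑ j, c j • a j` in the sense of distributions, where the `a j` are `(p,2)`-atoms and
`∑ j, |c j| ^ p < ∞`. -/
structure IsAtomicDecomposition {n : ℕ} (p : ℝ) (f : 𝓢'(Rn n, ℂ)) (c : ℕ → ℂ)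
    (a : ℕ → Rn n → ℂ) : Prop where
  isAtom : ∀ j, IsAtom p 2 (a j)
  cost_lt_top : ∑' j, ‖c j‖ₑ ^ p < ∞
  hasSum : ∀ φ : 𝓢(Rn n, ℂ), HasSum (fun j => c j * ∫ x, a j x * φ x) (f φ)

/-- The (atomic) `H^p` quasi-norm. -/
def hardyNorm {n : ℕ} (p : ℝ) (f : 𝓢'(Rn n, ℂ)) : ℝ≥0∞ :=
  ⨅ (c : ℕ → ℂ) (a : ℕ → Rn n → ℂ) (_ : IsAtomicDecomposition p f c a),
    (∑' j, ‖c j‖ₑ ^ p) ^ (1 / p)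

theorem isAtom_zero {n : ℕ} (p s : ℝ) : IsAtom p s (0 : Rn n → ℂ) := by
  refine ⟨MemLp.zero, 0, 1, one_pos, by simp, by simp, by simp⟩

/-- The (real-variable) Hardy space `H^p(ℝⁿ)`, `0 < p ≤ 1`: the tempered distributions that have an
atomic decomposition. -/
def Hardy (n : ℕ) (p : ℝ) (hp : 0 < p) : Submodule ℂ 𝓢'(Rn n, ℂ) where
  carrier := {f | ∃ c a, IsAtomicDecomposition p f c a}
  zero_mem' := ⟨0, 0, fun _ => isAtom_zero p 2, by simp [hp], fun φ => by simp⟩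
  add_mem' := by
    rintro f g ⟨c, a, h⟩ ⟨c', a', h'⟩
    let e := Equiv.natSumNatEquivNat
    refine ⟨Sum.elim c c' ∘ e.symm, Sum.elim a a' ∘ e.symm, ?_, ?_, ?_⟩
    · intro j
      rcases hj : e.symm j with k | k
      · simpa [hj] using h.isAtom k
      · simpa [hj] using h'.isAtom k
    · have : ∑' j, ‖(Sum.elim c c' ∘ e.symm) j‖ₑ ^ p = ∑' i, ‖Sum.elim c c' i‖ₑ ^ p :=
        e.symm.tsum_eq (fun i => ‖Sum.elim c c' i‖ₑ ^ p)
      rw [this, Summable.tsum_sum ENNReal.summable ENNReal.summable]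
      simpa using ⟨h.cost_lt_top, h'.cost_lt_top⟩
    · intro φ
      refine (e.symm.hasSum_iff
        (f := fun i => Sum.elim c c' i * ∫ x, Sum.elim a a' i x * φ x)).2 ?_
      exact HasSum.sum (h.hasSum φ) (h'.hasSum φ)
  smul_mem' := by
    rintro t f ⟨c, a, h⟩
    refine ⟨fun j => t * c j, a, h.isAtom, ?_, fun φ => ?_⟩
    · simp only [enorm_mul, ENNReal.mul_rpow_of_nonneg _ _ hp.le, ENNReal.tsum_mul_left]
      exact ENNReal.mul_lt_top (ENNReal.rpow_lt_top_of_nonneg hp.le enorm_ne_top) h.cost_lt_top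
    · simpa [mul_assoc] using (h.hasSum φ).mul_left t

/-- `S : H^p → L^q` is a bounded extension of the commutator: it is a bounded linear operator, and
whenever `F ∈ H^p` is (given by) a function `f ∈ L^ℓ` with `r' < ℓ < n / (α + β)`, the integral that
defines `[b, T_{Ω,α}] f (x)` converges absolutely for almost every `x` and is equal to `S F (x)`. -/
structure IsCommutatorExtension {n : ℕ} {p : ℝ} (hp : 0 < p) (q r α β : ℝ)
    (Ω : Rn n → Rn n → ℂ) (b : Rn n → ℂ)
    (S : Hardy n p hp →ₗ[ℂ] Lp ℂ (ENNReal.ofReal q) (volume : Measure (Rn n))) : Prop where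
  bounded : ∃ M : ℝ≥0, ∀ F : Hardy n p hp,
    eLpNorm (S F) (ENNReal.ofReal q) volume ≤ M * hardyNorm p (F : 𝓢'(Rn n, ℂ))
  agrees : ∀ (F : Hardy n p hp) (ℓ : ℝ) (f : Rn n → ℂ),
    r / (r - 1) < ℓ → ℓ < n / (α + β) → MemLp f (ENNReal.ofReal ℓ) volume →
    (∀ φ : 𝓢(Rn n, ℂ), (F : 𝓢'(Rn n, ℂ)) φ = ∫ x, f x * φ x) →
    (∀ᵐ x, Integrable (commutatorIntegrand Ω α b f x) volume) ∧
      S F =ᵐ[volume] commutator Ω α b f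

end VariableKernel

end

open VariableKernel

/-!
Let `a` be an atom supported in a ball of radius `d`. Near that ball, Hölder's inequality in polar
coordinates controls the fractional integral `[b, T] a`. Far from it, the mean value of `a`
vanishes, so that `[b, T] a` only sees the oscillation of `b` and of the kernel over the support of
`a`; by the Dini condition, the modulus of continuity of the kernel gains a factor `(d / R) ^ β` at
distance `R`. Hence the commutators of atoms are uniformly bounded in `L^q`, and by the inequality
`(∑ s j) ^ p ≤ ∑ s j ^ p` the series `∑ c j • [b, T] (a j)` converges almost everywhere, to an
`L^q` function, for every atomic decomposition.

The value of this sum must not depend on the decomposition. Suppose that the distribution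
`∑ c j • a j` is a function `f`, possibly `0`. Mollifying turns convergence of distributions into
pointwise convergence, and the mollified atoms satisfy the estimates for atoms uniformly; letting
the mollification tend to the identity gives `∑ c j • [b, T] (a j) = [b, T] f` almost everywhere.
Uniqueness holds because a bounded operator that vanishes on atoms vanishes on `H^p`.
-/

namespace VariableKernel

open Filter Topology

/-! ### Integrals in polar coordinates -/

section Polar

variable {E : Type*} [NormedAddCommGroup E] [NormedSpace ℝ E] [FiniteDimensional ℝ E]
  [Nontrivial E] [MeasurableSpace E] [BorelSpace E] (μ : Measure E) [μ.IsAddHaarMeasure]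

theorem lintegral_polar {k : ℝ → ℝ≥0∞} (hk : Measurable k) {h : E → ℝ≥0∞} (hh : Measurable h)
    (hom : ∀ (z : E) (t : ℝ), 0 < t → h (t • z) = h z) :
    ∫⁻ z, k ‖z‖ * h z ∂μ =
      (∫⁻ z : sphere (0 : E) 1, h z ∂μ.toSphere) *
        ∫⁻ t in Ioi (0 : ℝ), k t * ENNReal.ofReal (t ^ (Module.finrank ℝ E - 1)) := by
  let f : sphere (0 : E) 1 × Ioi (0 : ℝ) → ℝ≥0∞ := fun w => h w.1 * k w.2
  have hf (z : ({0}ᶜ : Set E)) : k ‖(z : E)‖ * h z = f (homeomorphUnitSphereProd E z) := by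
    have hz : 0 < ‖(z : E)‖ := norm_pos_iff.2 z.2
    simp only [f, homeomorphUnitSphereProd_apply_fst_coe, homeomorphUnitSphereProd_apply_snd_coe]
    rw [hom _ _ (inv_pos.2 hz), mul_comm]
  calc ∫⁻ z, k ‖z‖ * h z ∂μ
      = ∫⁻ z in ({0}ᶜ : Set E), k ‖z‖ * h z ∂μ := by rw [restrict_compl_singleton]
    _ = ∫⁻ z : ({0}ᶜ : Set E), f (homeomorphUnitSphereProd E z) ∂(μ.comap (↑)) := by
        rw [← lintegral_subtype_comap (measurableSet_singleton _).compl]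
        exact lintegral_congr hf
    _ = ∫⁻ w, f w ∂(μ.toSphere.prod (Measure.volumeIoiPow (Module.finrank ℝ E - 1))) :=
        μ.measurePreserving_homeomorphUnitSphereProd.lintegral_comp_emb
          (Homeomorph.measurableEmbedding _) f
    _ = (∫⁻ z : sphere (0 : E) 1, h z ∂μ.toSphere) *
          ∫⁻ t : Ioi (0 : ℝ), k t ∂Measure.volumeIoiPow (Module.finrank ℝ E - 1) :=
        lintegral_prod_mul (f := fun z : sphere (0 : E) 1 => h z)
          (g := fun t : Ioi (0 : ℝ) => k t) (by fun_prop) (by fun_prop)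
    _ = _ := by
        rw [Measure.volumeIoiPow, lintegral_withDensity_eq_lintegral_mul _ (by fun_prop)
          (by fun_prop), ← lintegral_subtype_comap measurableSet_Ioi]
        simp only [Pi.mul_apply, mul_comm]

theorem setLIntegral_norm_preimage_rpow_mul {I : Set ℝ} (hI : MeasurableSet I) (s : ℝ)
    {h : E → ℝ≥0∞} (hh : Measurable h) (hom : ∀ (z : E) (t : ℝ), 0 < t → h (t • z) = h z) :
    ∫⁻ z in norm ⁻¹' I, ‖z‖ₑ ^ (-s) * h z ∂μ =
      (∫⁻ z : sphere (0 : E) 1, h z ∂μ.toSphere) *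
        ∫⁻ t in I ∩ Ioi 0, ENNReal.ofReal (t ^ ((Module.finrank ℝ E : ℝ) - s - 1)) := by
  have hdim : 1 ≤ Module.finrank ℝ E := Module.finrank_pos
  have key := lintegral_polar μ (k := I.indicator fun t => ENNReal.ofReal t ^ (-s))
    (Measurable.indicator (by fun_prop) hI) hh hom
  rw [← lintegral_indicator (measurable_norm hI), ← Measure.restrict_restrict hI,
    ← lintegral_indicator hI]
  refine Eq.trans (lintegral_congr fun z => ?_) (key.trans ?_)
  · by_cases hz : ‖z‖ ∈ I <;> simp [indicator, hz]
  · congr 1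
    refine setLIntegral_congr_fun measurableSet_Ioi fun t (ht : 0 < t) => ?_
    by_cases htI : t ∈ I
    · simp only [indicator_of_mem htI]
      rw [ENNReal.ofReal_rpow_of_pos ht, ← ENNReal.ofReal_mul (by positivity),
        ← Real.rpow_natCast, ← Real.rpow_add ht, Nat.cast_sub hdim]
      congr 2
      push_cast
      ring
    · simp only [indicator_of_notMem htI, zero_mul]

end Polar

theorem setLIntegral_Ioo_ofReal_rpow {e ρ : ℝ} (he : -1 < e) (hρ : 0 < ρ) :
    ∫⁻ t in Ioo 0 ρ, ENNReal.ofReal (t ^ e) = ENNReal.ofReal (ρ ^ (e + 1) / (e + 1)) := by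
  rw [Measure.restrict_congr_set Ioo_ae_eq_Ioc, ← ofReal_integral_eq_lintegral_ofReal,
    ← intervalIntegral.integral_of_le hρ.le, integral_rpow (Or.inl he),
    Real.zero_rpow (by linarith), sub_zero]
  · exact (intervalIntegral.intervalIntegrable_rpow' he).1
  · filter_upwards [ae_restrict_mem measurableSet_Ioc] with t ht
    exact Real.rpow_nonneg ht.1.le _

theorem setLIntegral_Ioi_ofReal_rpow {e ρ : ℝ} (he : e < -1) (hρ : 0 < ρ) :
    ∫⁻ t in Ioi ρ, ENNReal.ofReal (t ^ e) = ENNReal.ofReal (-ρ ^ (e + 1) / (e + 1)) := by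
  rw [← ofReal_integral_eq_lintegral_ofReal, integral_Ioi_rpow_of_lt he hρ]
  · exact integrableOn_Ioi_rpow_of_lt he hρ
  · filter_upwards [ae_restrict_mem measurableSet_Ioi] with t ht
    exact Real.rpow_nonneg (hρ.trans ht).le _

section Weight

variable {n : ℕ}

theorem toSphere_univ_ne_zero [NeZero n] : (volume : Measure (Rn n)).toSphere univ ≠ 0 :=
  fun h => Measure.toSphere_ne_zero (volume : Measure (Rn n)) (Measure.measure_univ_eq_zero.1 h)

instance isProbabilityMeasure_sphereMeasure [NeZero n] : IsProbabilityMeasure (sphereMeasure n) :=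
  ⟨by
    rw [sphereMeasure, Measure.smul_apply, smul_eq_mul]
    exact ENNReal.inv_mul_cancel toSphere_univ_ne_zero (measure_ne_top _ _)⟩

theorem lintegral_toSphere [NeZero n] (h : Sph n → ℝ≥0∞) :
    ∫⁻ z, h z ∂(volume : Measure (Rn n)).toSphere =
      (volume : Measure (Rn n)).toSphere univ * ∫⁻ z, h z ∂sphereMeasure n := by
  rw [sphereMeasure, lintegral_smul_measure, smul_eq_mul, ← mul_assoc,
    ENNReal.mul_inv_cancel toSphere_univ_ne_zero (measure_ne_top _ _), one_mul]

theorem exists_setLIntegral_ball_norm_rpow_mul_le [NeZero n] {s : ℝ} (hs : s < n) :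
    ∃ C : ℝ≥0∞, C ≠ ∞ ∧ ∀ ρ : ℝ, 0 < ρ → ∀ h : Rn n → ℝ≥0∞, Measurable h →
      (∀ (z : Rn n) (t : ℝ), 0 < t → h (t • z) = h z) →
      ∫⁻ z in ball (0 : Rn n) ρ, ‖z‖ₑ ^ (-s) * h z
        ≤ C * ENNReal.ofReal ρ ^ (n - s) * ∫⁻ z : Sph n, h z ∂sphereMeasure n := by
  refine ⟨(volume : Measure (Rn n)).toSphere univ * ENNReal.ofReal (1 / (n - s)), by finiteness,
    fun ρ hρ h hh hom => le_of_eq ?_⟩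
  have hball : ball (0 : Rn n) ρ = norm ⁻¹' Iio ρ := by ext; simp
  rw [hball, setLIntegral_norm_preimage_rpow_mul _ measurableSet_Iio s hh hom, inter_comm,
    Ioi_inter_Iio, finrank_euclideanSpace_fin, setLIntegral_Ioo_ofReal_rpow (by linarith) hρ,
    lintegral_toSphere, sub_add_cancel, div_eq_mul_one_div, ENNReal.ofReal_mul (by positivity),
    ENNReal.ofReal_rpow_of_pos hρ]
  ring

theorem exists_setLIntegral_compl_norm_rpow_mul_le [NeZero n] {s : ℝ} (hs : n < s) :
    ∃ C : ℝ≥0∞, C ≠ ∞ ∧ ∀ ρ : ℝ, 0 < ρ → ∀ h : Rn n → ℝ≥0∞, Measurable h →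
      (∀ (z : Rn n) (t : ℝ), 0 < t → h (t • z) = h z) →
      ∫⁻ z in (closedBall (0 : Rn n) ρ)ᶜ, ‖z‖ₑ ^ (-s) * h z
        ≤ C * ENNReal.ofReal ρ ^ (n - s) * ∫⁻ z : Sph n, h z ∂sphereMeasure n := by
  refine ⟨(volume : Measure (Rn n)).toSphere univ * ENNReal.ofReal (1 / (s - n)), by finiteness,
    fun ρ hρ h hh hom => le_of_eq ?_⟩
  have hcompl : (closedBall (0 : Rn n) ρ)ᶜ = norm ⁻¹' Ioi ρ := by ext; simp
  rw [hcompl, setLIntegral_norm_preimage_rpow_mul _ measurableSet_Ioi s hh hom, Ioi_inter_Ioi,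
    sup_of_le_left hρ.le, finrank_euclideanSpace_fin,
    setLIntegral_Ioi_ofReal_rpow (by linarith) hρ, lintegral_toSphere, sub_add_cancel,
    neg_div, ← div_neg, neg_sub, div_eq_mul_one_div, ENNReal.ofReal_mul (by positivity),
    ENNReal.ofReal_rpow_of_pos hρ]
  ring

theorem exists_setLIntegral_compl_norm_rpow_le [NeZero n] {s : ℝ} (hs : n < s) :
    ∃ C : ℝ≥0∞, C ≠ ∞ ∧ ∀ ρ : ℝ, 0 < ρ →
      ∫⁻ z in (closedBall (0 : Rn n) ρ)ᶜ, ‖z‖ₑ ^ (-s) ≤ C * ENNReal.ofReal ρ ^ (n - s) := by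
  obtain ⟨C, hC, h⟩ := exists_setLIntegral_compl_norm_rpow_mul_le hs
  refine ⟨C, hC, fun ρ hρ => ?_⟩
  simpa using h ρ hρ (fun _ => 1) measurable_const (fun _ _ _ => rfl)

theorem setLIntegral_ball_comp_sub_le {c x : Rn n} {ρ : ℝ} (hx : x ∈ ball c ρ)
    (g : Rn n → ℝ≥0∞) :
    ∫⁻ y in ball c ρ, g (x - y) ≤ ∫⁻ z in ball (0 : Rn n) (2 * ρ), g z := by
  rw [← lintegral_indicator measurableSet_ball, ← lintegral_indicator measurableSet_ball,
    ← lintegral_sub_left_eq_self ((ball (0 : Rn n) (2 * ρ)).indicator g) x]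
  refine lintegral_mono fun y => ?_
  by_cases hy : y ∈ ball c ρ
  · rw [indicator_of_mem hy, indicator_of_mem]
    rw [mem_ball_zero_iff, ← dist_eq_norm]
    rw [mem_ball] at hx hy
    linarith [dist_triangle_right x y c]
  · rw [indicator_of_notMem hy]
    exact zero_le

end Weight

section Integral

variable {X Y : Type*} [MeasurableSpace X] [MeasurableSpace Y] {μ : Measure X} {ν : Measure Y}

theorem eLpNorm_ofReal_rpow {ε : Type*} [ENorm ε] {q : ℝ} (hq : 0 < q) (f : X → ε) :
    eLpNorm f (ENNReal.ofReal q) μ ^ q = ∫⁻ x, ‖f x‖ₑ ^ q ∂μ := by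
  rw [eLpNorm_eq_lintegral_rpow_enorm_toReal (by simpa using hq) ENNReal.ofReal_ne_top,
    ENNReal.toReal_ofReal hq.le, ← ENNReal.rpow_mul, one_div_mul_cancel hq.ne', ENNReal.rpow_one]

theorem eLpNorm_ofReal_le_iff {ε : Type*} [ENorm ε] {q : ℝ} (hq : 0 < q) {f : X → ε}
    {A : ℝ≥0∞} :
    eLpNorm f (ENNReal.ofReal q) μ ≤ A ↔ ∫⁻ x, ‖f x‖ₑ ^ q ∂μ ≤ A ^ q := by
  rw [← eLpNorm_ofReal_rpow hq, ENNReal.rpow_le_rpow_iff hq]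

theorem lintegral_mul_le_eLpNorm_mul_eLpNorm {r t : ℝ} (hrt : r.HolderConjugate t)
    {f g : X → ℝ≥0∞} (hf : AEMeasurable f μ) (hg : AEMeasurable g μ) :
    ∫⁻ x, f x * g x ∂μ ≤
      eLpNorm f (ENNReal.ofReal r) μ * eLpNorm g (ENNReal.ofReal t) μ := by
  rw [← ENNReal.rpow_rpow_inv hrt.ne_zero (eLpNorm f _ μ),
    ← ENNReal.rpow_rpow_inv hrt.symm.ne_zero (eLpNorm g _ μ), eLpNorm_ofReal_rpow hrt.pos,
    eLpNorm_ofReal_rpow hrt.symm.pos]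
  simpa only [enorm_eq_self, one_div, Pi.mul_apply]
    using ENNReal.lintegral_mul_le_Lp_mul_Lq μ hrt hf hg

theorem rpow_lintegral_mul_le {k G : X → ℝ≥0∞} (hk : AEMeasurable k μ) (hG : AEMeasurable G μ)
    {m : ℝ} (hm : 1 ≤ m) :
    (∫⁻ y, k y * G y ∂μ) ^ m ≤ (∫⁻ y, k y ^ m * G y ∂μ) * (∫⁻ y, G y ∂μ) ^ (m - 1) := by
  have hm0 : 0 < m := by linarith
  have hinv : 0 ≤ 1 - m⁻¹ := sub_nonneg.2 (inv_le_one_of_one_le₀ hm)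
  have split (y : X) : (k y ^ m * G y) ^ m⁻¹ * G y ^ (1 - m⁻¹) = k y * G y := by
    rw [ENNReal.mul_rpow_of_nonneg _ _ (by positivity), ENNReal.rpow_rpow_inv hm0.ne', mul_assoc,
      ← ENNReal.rpow_add_of_nonneg _ _ (by positivity) hinv, add_sub_cancel, ENNReal.rpow_one]
  calc (∫⁻ y, k y * G y ∂μ) ^ m
      ≤ ((∫⁻ y, k y ^ m * G y ∂μ) ^ m⁻¹ * (∫⁻ y, G y ∂μ) ^ (1 - m⁻¹)) ^ m := by
        gcongr
        simpa only [split] using ENNReal.lintegral_mul_norm_pow_le (μ := μ)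
          (f := fun y => k y ^ m * G y) (by fun_prop) hG (by positivity) hinv (add_sub_cancel _ _)
    _ = (∫⁻ y, k y ^ m * G y ∂μ) * (∫⁻ y, G y ∂μ) ^ (m - 1) := by
        rw [ENNReal.mul_rpow_of_nonneg _ _ hm0.le, ENNReal.rpow_inv_rpow hm0.ne',
          ← ENNReal.rpow_mul, sub_mul, inv_mul_cancel₀ hm0.ne', one_mul]

theorem lintegral_rpow_lintegral_mul_le [SFinite μ] [SFinite ν] {k : X → Y → ℝ≥0∞}
    (hk : AEMeasurable (Function.uncurry k) (μ.prod ν)) {G : Y → ℝ≥0∞} (hG : AEMeasurable G ν)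
    {m : ℝ} (hm : 1 ≤ m) {A : ℝ≥0∞} (hA : ∀ᵐ y ∂ν, ∫⁻ x, k x y ^ m ∂μ ≤ A) :
    ∫⁻ x, (∫⁻ y, k x y * G y ∂ν) ^ m ∂μ ≤ A * (∫⁻ y, G y ∂ν) ^ m := by
  have hkG : AEMeasurable (Function.uncurry fun x y => k x y ^ m * G y) (μ.prod ν) :=
    (hk.pow_const m).mul hG.comp_snd
  have hk_left := hk.aestronglyMeasurable.prodMk_left
  have hk_right := (hk.pow_const m).aestronglyMeasurable.prodMk_right
  calc ∫⁻ x, (∫⁻ y, k x y * G y ∂ν) ^ m ∂μ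
      ≤ ∫⁻ x, (∫⁻ y, k x y ^ m * G y ∂ν) * (∫⁻ y, G y ∂ν) ^ (m - 1) ∂μ :=
        lintegral_mono_ae (hk_left.mono fun x hx => rpow_lintegral_mul_le hx.aemeasurable hG hm)
    _ = (∫⁻ y, (∫⁻ x, k x y ^ m ∂μ) * G y ∂ν) * (∫⁻ y, G y ∂ν) ^ (m - 1) := by
        refine (lintegral_mul_const'' _ hkG.lintegral_prod_right').trans ?_
        simp only [Function.uncurry_apply_pair]
        rw [lintegral_lintegral_swap hkG]
        congr 1
        exact lintegral_congr_ae (hk_right.mono fun y hy => lintegral_mul_const'' _ hy.aemeasurable)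
    _ ≤ (∫⁻ y, A * G y ∂ν) * (∫⁻ y, G y ∂ν) ^ (m - 1) := by
        gcongr ?_ * _
        refine lintegral_mono_ae (hA.mono fun y hy => ?_)
        gcongr
    _ = A * (∫⁻ y, G y ∂ν) ^ m := by
        rw [lintegral_const_mul'' _ hG, mul_assoc]
        congr 1
        nth_rewrite 1 [← ENNReal.rpow_one (∫⁻ y, G y ∂ν)]
        rw [← ENNReal.rpow_add_of_nonneg _ _ zero_le_one (sub_nonneg.2 hm), add_sub_cancel]

theorem eLpNorm_lintegral_mul_mul_le [SFinite μ] [SFinite ν] {k₁ k₂ : X → Y → ℝ≥0∞}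
    (hk₁ : Measurable (Function.uncurry k₁)) (hk₂ : Measurable (Function.uncurry k₂))
    {F : Y → ℝ≥0∞} (hF : AEMeasurable F ν) {r t Q : ℝ} (hrt : r.HolderConjugate t) (htQ : t ≤ Q)
    {A₁ A₂ : ℝ≥0∞} (hA₁ : ∀ᵐ x ∂μ, ∫⁻ y, k₁ x y ^ r ∂ν ≤ A₁)
    (hA₂ : ∀ᵐ y ∂ν, ∫⁻ x, k₂ x y ^ Q ∂μ ≤ A₂) :
    eLpNorm (fun x => ∫⁻ y, k₁ x y * (k₂ x y * F y) ∂ν) (ENNReal.ofReal Q) μ ≤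
      A₁ ^ r⁻¹ * A₂ ^ Q⁻¹ * eLpNorm F (ENNReal.ofReal t) ν := by
  have ht := hrt.symm.pos
  have hQ : 0 < Q := ht.trans_le htQ
  rw [eLpNorm_ofReal_le_iff hQ]
  calc ∫⁻ x, (∫⁻ y, k₁ x y * (k₂ x y * F y) ∂ν) ^ Q ∂μ
      ≤ ∫⁻ x, (A₁ ^ r⁻¹) ^ Q * (∫⁻ y, k₂ x y ^ t * F y ^ t ∂ν) ^ (Q / t) ∂μ := by
        refine lintegral_mono_ae (hA₁.mono fun x hx => ?_)
        have holder := lintegral_mul_le_eLpNorm_mul_eLpNorm hrt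
          (hk₁.of_uncurry_left (x := x)).aemeasurable
          ((hk₂.of_uncurry_left (x := x)).aemeasurable.mul hF)
        rw [div_eq_inv_mul, ENNReal.rpow_mul, ← ENNReal.mul_rpow_of_nonneg _ _ hQ.le]
        gcongr
        refine holder.trans (mul_le_mul' ?_ (le_of_eq ?_))
        · rw [eLpNorm_ofReal_le_iff hrt.pos, ENNReal.rpow_inv_rpow hrt.ne_zero]
          exact hx
        · rw [← ENNReal.rpow_rpow_inv ht.ne' (eLpNorm _ _ ν), eLpNorm_ofReal_rpow ht]
          simp only [Pi.mul_apply, enorm_eq_self, ENNReal.mul_rpow_of_nonneg _ _ ht.le]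
    _ ≤ (A₁ ^ r⁻¹) ^ Q * (A₂ * (∫⁻ y, F y ^ t ∂ν) ^ (Q / t)) := by
        have hk₂t : AEMeasurable (Function.uncurry fun x y => k₂ x y ^ t) (μ.prod ν) :=
          (hk₂.pow_const t).aemeasurable
        rw [lintegral_const_mul'']
        · gcongr
          refine lintegral_rpow_lintegral_mul_le hk₂t (hF.pow_const t) ((one_le_div ht).2 htQ)
            (hA₂.mono fun y hy => ?_)
          simpa only [← ENNReal.rpow_mul, mul_div_cancel₀ _ ht.ne'] using hy
        · exact (hk₂t.mul (hF.pow_const t).comp_snd).lintegral_prod_right'.pow_const _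
    _ = (A₁ ^ r⁻¹ * A₂ ^ Q⁻¹ * eLpNorm F (ENNReal.ofReal t) ν) ^ Q := by
        rw [mul_assoc, ENNReal.mul_rpow_of_nonneg _ _ hQ.le, ENNReal.mul_rpow_of_nonneg _ _ hQ.le,
          ENNReal.rpow_inv_rpow hQ.ne', div_eq_mul_inv, mul_comm Q, ENNReal.rpow_mul,
          ← ENNReal.rpow_rpow_inv ht.ne' (eLpNorm F _ ν), eLpNorm_ofReal_rpow ht]
        simp only [enorm_eq_self]

end Integral

/-! ### Local estimates for the fractional integral -/

section LocalEstimate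

variable {n : ℕ} {r : ℝ} {Ω : Rn n → Rn n → ℂ}

theorem IsKernel.measurable_sub (hΩ : IsKernel r Ω) :
    Measurable fun w : Rn n × Rn n => Ω w.1 (w.1 - w.2) :=
  hΩ.measurable.comp (measurable_fst.prodMk (measurable_fst.sub measurable_snd))

theorem IsKernel.measurable_right (hΩ : IsKernel r Ω) (x : Rn n) : Measurable (Ω x) :=
  hΩ.measurable.of_uncurry_left

theorem IsKernel.lintegral_sphere_le [NeZero n] (hΩ : IsKernel r Ω) {t : ℝ} (ht : 0 < t)
    (htr : t ≤ r) (x : Rn n) :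
    ∫⁻ z : Sph n, ‖Ω x z‖ₑ ^ t ∂sphereMeasure n ≤ kernelNorm r Ω ^ t := by
  have hr : 0 < r := ht.trans_le htr
  have hm : AEStronglyMeasurable (fun z : Sph n => Ω x z) (sphereMeasure n) :=
    ((hΩ.measurable_right x).comp measurable_subtype_coe).aestronglyMeasurable
  have hnorm : eLpNorm (fun z : Sph n => Ω x z) (ENNReal.ofReal r) (sphereMeasure n) ≤
      kernelNorm r Ω := by
    rw [eLpNorm_eq_lintegral_rpow_enorm_toReal (by simpa using hr) ENNReal.ofReal_ne_top,
      ENNReal.toReal_ofReal hr.le]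
    exact le_iSup (fun x => (∫⁻ z : Sph n, ‖Ω x z‖ₑ ^ r ∂sphereMeasure n) ^ (1 / r)) x
  rw [← eLpNorm_ofReal_le_iff ht]
  exact (eLpNorm_le_eLpNorm_of_exponent_le (ENNReal.ofReal_le_ofReal htr) hm).trans hnorm

theorem IsKernel.exists_setLIntegral_ball_le [NeZero n] (hΩ : IsKernel r Ω) {s t : ℝ} (hs : s < n)
    (ht : 0 < t) (htr : t ≤ r) :
    ∃ C : ℝ≥0∞, C ≠ ∞ ∧ ∀ ρ : ℝ, 0 < ρ → ∀ x : Rn n,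
      ∫⁻ z in ball (0 : Rn n) ρ, ‖z‖ₑ ^ (-s) * ‖Ω x z‖ₑ ^ t ≤
        C * ENNReal.ofReal ρ ^ (n - s) := by
  obtain ⟨C, hC, h⟩ := exists_setLIntegral_ball_norm_rpow_mul_le hs
  refine ⟨C * kernelNorm r Ω ^ t, by have := hΩ.norm_lt_top; finiteness, fun ρ hρ x => ?_⟩
  have hm := hΩ.measurable_right x
  refine (h ρ hρ (fun z => ‖Ω x z‖ₑ ^ t) (by fun_prop) fun z τ hτ => ?_).trans ?_
  · rw [hΩ.homogeneous x z τ hτ]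
  · rw [mul_right_comm]
    gcongr
    exact hΩ.lintegral_sphere_le ht htr x

theorem IsKernel.exists_setLIntegral_compl_le [NeZero n] (hΩ : IsKernel r Ω) {s t : ℝ} (hs : n < s)
    (ht : 0 < t) (htr : t ≤ r) :
    ∃ C : ℝ≥0∞, C ≠ ∞ ∧ ∀ ρ : ℝ, 0 < ρ → ∀ x : Rn n,
      ∫⁻ z in (closedBall (0 : Rn n) ρ)ᶜ, ‖z‖ₑ ^ (-s) * ‖Ω x z‖ₑ ^ t ≤
        C * ENNReal.ofReal ρ ^ (n - s) := by
  obtain ⟨C, hC, h⟩ := exists_setLIntegral_compl_norm_rpow_mul_le hs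
  refine ⟨C * kernelNorm r Ω ^ t, by have := hΩ.norm_lt_top; finiteness, fun ρ hρ x => ?_⟩
  have hm := hΩ.measurable_right x
  refine (h ρ hρ (fun z => ‖Ω x z‖ₑ ^ t) (by fun_prop) fun z τ hτ => ?_).trans ?_
  · rw [hΩ.homogeneous x z τ hτ]
  · rw [mul_right_comm]
    gcongr
    exact hΩ.lintegral_sphere_le ht htr x

/-- The positive operator `f ↦ ∫ |Ω(x, x - y)| |x - y|^{-s} |f(y)| dy`, which dominates the
commutator for `s = n - α - β`. -/
noncomputable def absOp (Ω : Rn n → Rn n → ℂ) (s : ℝ) (f : Rn n → ℂ) (x : Rn n) : ℝ≥0∞ :=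
  ∫⁻ y, ‖x - y‖ₑ ^ (-s) * ‖Ω x (x - y)‖ₑ * ‖f y‖ₑ

theorem absOp_eq_setLIntegral (Ω : Rn n → Rn n → ℂ) (s : ℝ) {f : Rn n → ℂ} {B : Set (Rn n)}
    (hf : Function.support f ⊆ B) (x : Rn n) :
    absOp Ω s f x = ∫⁻ y in B, ‖x - y‖ₑ ^ (-s) * ‖Ω x (x - y)‖ₑ * ‖f y‖ₑ :=
  (setLIntegral_eq_of_support_subset fun y hy => hf fun h0 => hy (by simp [h0])).symm

theorem aemeasurable_absOp (hΩ : IsKernel r Ω) (s : ℝ) {f : Rn n → ℂ}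
    (hf : AEStronglyMeasurable f volume) : AEMeasurable (absOp Ω s f) volume := by
  have hm := hΩ.measurable_sub
  have hk : Measurable fun w : Rn n × Rn n => ‖w.1 - w.2‖ₑ ^ (-s) * ‖Ω w.1 (w.1 - w.2)‖ₑ :=
    Measurable.mul (by fun_prop) hm.enorm
  exact (hk.aemeasurable.mul hf.enorm.comp_snd).lintegral_prod_right'

theorem IsKernel.eLpNorm_absOp_le_of_support_subset [NeZero n] (hΩ : IsKernel r Ω) {t u v Q : ℝ}
    (hrt : r.HolderConjugate t) (htQ : t ≤ Q) {B : Set (Rn n)} (hB : MeasurableSet B)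
    {f : Rn n → ℂ} (hf : AEStronglyMeasurable f volume) (hsupp : Function.support f ⊆ B)
    {A₁ A₂ : ℝ≥0∞}
    (hA₁ : ∀ x ∈ B, ∫⁻ y in B, ‖x - y‖ₑ ^ (-(u * r)) * ‖Ω x (x - y)‖ₑ ^ r ≤ A₁)
    (hA₂ : ∀ y ∈ B, ∫⁻ x in B, ‖x - y‖ₑ ^ (-(v * Q)) ≤ A₂) :
    eLpNorm (absOp Ω (u + v) f) (ENNReal.ofReal Q) (volume.restrict B) ≤
      A₁ ^ r⁻¹ * A₂ ^ Q⁻¹ * eLpNorm f (ENNReal.ofReal t) volume := by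
  let k₁ : Rn n → Rn n → ℝ≥0∞ := fun x y => ‖x - y‖ₑ ^ (-u) * ‖Ω x (x - y)‖ₑ
  let k₂ : Rn n → Rn n → ℝ≥0∞ := fun x y => ‖x - y‖ₑ ^ (-v)
  have split (x : Rn n) : absOp Ω (u + v) f x = ∫⁻ y in B, k₁ x y * (k₂ x y * ‖f y‖ₑ) := by
    rw [absOp_eq_setLIntegral Ω _ hsupp]
    refine lintegral_congr_ae (ae_restrict_of_ae ?_)
    filter_upwards [compl_mem_ae_iff.2 (measure_singleton x)] with y (hy : y ≠ x)
    simp only [k₁, k₂]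
    rw [neg_add, ENNReal.rpow_add _ _ (by simpa [sub_eq_zero] using hy.symm) enorm_ne_top]
    ring
  have hk₁ : Measurable (Function.uncurry k₁) :=
    Measurable.mul (by fun_prop) hΩ.measurable_sub.enorm
  have hk₂ : Measurable (Function.uncurry k₂) := by fun_prop
  rw [funext split]
  refine (eLpNorm_lintegral_mul_mul_le (A₁ := A₁) (A₂ := A₂) hk₁ hk₂ hf.enorm.restrict hrt htQ
    ?_ ?_).trans ?_
  · filter_upwards [ae_restrict_mem hB] with x hx
    simpa only [k₁, ENNReal.mul_rpow_of_nonneg _ _ hrt.nonneg, ← ENNReal.rpow_mul, neg_mul]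
      using hA₁ x hx
  · filter_upwards [ae_restrict_mem hB] with y hy
    simpa only [k₂, ← ENNReal.rpow_mul, neg_mul] using hA₂ y hy
  · rw [eLpNorm_enorm]
    gcongr
    exact Measure.restrict_le_self

theorem mul_ofReal_two_mul_rpow_rpow_inv {e q : ℝ} (hq : 0 < q) (he : e * q ≤ n) (A : ℝ≥0∞)
    (ρ : ℝ) :
    (A * ENNReal.ofReal (2 * ρ) ^ (n - e * q)) ^ q⁻¹ =
      (A * 2 ^ (n - e * q)) ^ q⁻¹ * ENNReal.ofReal ρ ^ (n / q - e) := by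
  rw [ENNReal.ofReal_mul zero_le_two, ENNReal.ofReal_ofNat,
    ENNReal.mul_rpow_of_nonneg 2 (ENNReal.ofReal ρ) (sub_nonneg.2 he), ← mul_assoc,
    ENNReal.mul_rpow_of_nonneg _ _ (by positivity),
    ← ENNReal.rpow_mul]
  congr 2
  field_simp

theorem IsKernel.exists_eLpNorm_absOp_ball_le [NeZero n] (hΩ : IsKernel r Ω) {t s Q : ℝ}
    (hrt : r.HolderConjugate t) (htQ : t ≤ Q) (hs : s < n / r + n / Q) :
    ∃ C : ℝ≥0∞, C ≠ ∞ ∧ ∀ (c : Rn n) (ρ : ℝ), 0 < ρ → ∀ f : Rn n → ℂ,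
      AEStronglyMeasurable f volume → Function.support f ⊆ ball c ρ →
      eLpNorm (absOp Ω s f) (ENNReal.ofReal Q) (volume.restrict (ball c ρ)) ≤
        C * ENNReal.ofReal ρ ^ (n / r - s + n / Q) * eLpNorm f (ENNReal.ofReal t) volume := by
  have hr := hrt.pos
  have hQ : 0 < Q := hrt.symm.pos.trans_le htQ
  -- The singularity is shared between the two factors of Hölder's inequality.
  obtain ⟨u, v, rfl, hu, hv⟩ : ∃ u v : ℝ, s = u + v ∧ u * r < n ∧ v * Q < n := by
    refine ⟨n / r - (n / r + n / Q - s) / 2, n / Q - (n / r + n / Q - s) / 2, by ring, ?_, ?_⟩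
    · rw [← lt_div_iff₀ hr]; linarith
    · rw [← lt_div_iff₀ hQ]; linarith
  obtain ⟨C₁, hC₁, H₁⟩ := hΩ.exists_setLIntegral_ball_le hu hr le_rfl
  obtain ⟨C₂, hC₂, H₂⟩ := exists_setLIntegral_ball_norm_rpow_mul_le hv
  refine ⟨(C₁ * 2 ^ (n - u * r)) ^ r⁻¹ * (C₂ * 2 ^ (n - v * Q)) ^ Q⁻¹, by finiteness, ?_⟩
  intro c ρ hρ f hf hsupp
  refine (hΩ.eLpNorm_absOp_le_of_support_subset (u := u) (v := v) hrt htQ measurableSet_ball hf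
    hsupp (A₁ := C₁ * ENNReal.ofReal (2 * ρ) ^ (n - u * r))
    (A₂ := C₂ * ENNReal.ofReal (2 * ρ) ^ (n - v * Q)) (fun x hx => ?_) (fun y hy => ?_)).trans_eq ?_
  · exact (setLIntegral_ball_comp_sub_le hx fun z => ‖z‖ₑ ^ (-(u * r)) * ‖Ω x z‖ₑ ^ r).trans
      (H₁ (2 * ρ) (by positivity) x)
  · simp only [enorm_sub_rev _ y]
    refine (setLIntegral_ball_comp_sub_le hy fun z => ‖z‖ₑ ^ (-(v * Q))).trans ?_
    simpa using H₂ (2 * ρ) (by positivity) (fun _ => 1) measurable_const fun _ _ _ => rfl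
  · rw [mul_ofReal_two_mul_rpow_rpow_inv hr hu.le, mul_ofReal_two_mul_rpow_rpow_inv hQ hv.le,
      mul_mul_mul_comm, ← ENNReal.rpow_add _ _ (by simpa using hρ) ENNReal.ofReal_ne_top]
    ring_nf

theorem eLpNorm_restrict_ball_le_mul {ε : Type*} [TopologicalSpace ε] [ContinuousENorm ε]
    {q Q : ℝ} (hq : 0 < q) (hqQ : q ≤ Q) {ρ : ℝ} (hρ : 0 < ρ) (c : Rn n) {f : Rn n → ε}
    (hf : AEStronglyMeasurable f (volume.restrict (ball c ρ))) :
    eLpNorm f (ENNReal.ofReal q) (volume.restrict (ball c ρ)) ≤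
      eLpNorm f (ENNReal.ofReal Q) (volume.restrict (ball c ρ)) *
        (ENNReal.ofReal ρ ^ (n / q - n / Q) * volume (ball (0 : Rn n) 1) ^ (1 / q - 1 / Q)) := by
  have hexp : 0 ≤ 1 / q - 1 / Q := sub_nonneg.2 (one_div_le_one_div_of_le hq hqQ)
  refine (eLpNorm_le_eLpNorm_mul_rpow_measure_univ (ENNReal.ofReal_le_ofReal hqQ) hf).trans_eq ?_
  rw [ENNReal.toReal_ofReal hq.le, ENNReal.toReal_ofReal (hq.trans_le hqQ).le,
    Measure.restrict_apply_univ, Measure.addHaar_ball_of_pos _ _ hρ, finrank_euclideanSpace_fin,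
    ENNReal.ofReal_pow hρ.le, ← ENNReal.rpow_natCast, ENNReal.mul_rpow_of_nonneg _ _ hexp,
    ← ENNReal.rpow_mul, mul_sub, mul_one_div, mul_one_div]

theorem IsKernel.exists_eLpNorm_absOp_ball_le_of_le [NeZero n] (hΩ : IsKernel r Ω) {t s q Q : ℝ}
    (hrt : r.HolderConjugate t) (hq : 0 < q) (hqQ : q ≤ Q) (htQ : t ≤ Q)
    (hs : s < n / r + n / Q) :
    ∃ C : ℝ≥0∞, C ≠ ∞ ∧ ∀ (c : Rn n) (ρ : ℝ), 0 < ρ → ∀ f : Rn n → ℂ,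
      AEStronglyMeasurable f volume → Function.support f ⊆ ball c ρ →
      eLpNorm (absOp Ω s f) (ENNReal.ofReal q) (volume.restrict (ball c ρ)) ≤
        C * ENNReal.ofReal ρ ^ (n / r - s + n / q) * eLpNorm f (ENNReal.ofReal t) volume := by
  have hexp : 0 ≤ 1 / q - 1 / Q := sub_nonneg.2 (one_div_le_one_div_of_le hq hqQ)
  obtain ⟨C, hC, H⟩ := hΩ.exists_eLpNorm_absOp_ball_le hrt htQ hs
  refine ⟨C * volume (ball (0 : Rn n) 1) ^ (1 / q - 1 / Q), by finiteness, ?_⟩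
  intro c ρ hρ f hf hsupp
  refine (eLpNorm_restrict_ball_le_mul hq hqQ hρ c
    (aemeasurable_absOp hΩ s hf).aestronglyMeasurable.restrict).trans ?_
  have hscale : ENNReal.ofReal ρ ^ (n / r - s + n / q) =
      ENNReal.ofReal ρ ^ (n / r - s + n / Q) * ENNReal.ofReal ρ ^ (n / q - n / Q) := by
    rw [← ENNReal.rpow_add _ _ (by simpa using hρ) ENNReal.ofReal_ne_top]
    ring_nf
  calc _ ≤ C * ENNReal.ofReal ρ ^ (n / r - s + n / Q) * eLpNorm f (ENNReal.ofReal t) volume *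
        (ENNReal.ofReal ρ ^ (n / q - n / Q) * volume (ball (0 : Rn n) 1) ^ (1 / q - 1 / Q)) := by
        gcongr
        exact H c ρ hρ f hf hsupp
    _ = _ := by
        rw [hscale]
        ring

theorem IsKernel.exists_absOp_le_of_disjoint_ball [NeZero n] (hΩ : IsKernel r Ω) {s ℓ ℓ' : ℝ}
    (hℓ : ℓ'.HolderConjugate ℓ) (hℓ'r : ℓ' ≤ r) (hsℓ : n < s * ℓ') {R : ℝ} (hR : 0 < R) :
    ∃ C : ℝ≥0∞, C ≠ ∞ ∧ ∀ f : Rn n → ℂ, AEStronglyMeasurable f volume →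
      Function.support f ⊆ (ball 0 (2 * R))ᶜ → ∀ x ∈ ball (0 : Rn n) R,
      absOp Ω s f x ≤ C * eLpNorm f (ENNReal.ofReal ℓ) volume := by
  obtain ⟨C, hC, H⟩ := hΩ.exists_setLIntegral_compl_le hsℓ hℓ.pos hℓ'r
  refine ⟨(C * ENNReal.ofReal R ^ (n - s * ℓ')) ^ ℓ'⁻¹, ?_, fun f hf hsupp x hx => ?_⟩
  · have : ENNReal.ofReal R ^ (n - s * ℓ') ≠ ∞ :=
      ENNReal.rpow_ne_top_of_ne_zero (by simpa using hR) ENNReal.ofReal_ne_top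
    have := hℓ.pos
    finiteness
  have hm : Measurable fun y => ‖x - y‖ₑ ^ (-s) * ‖Ω x (x - y)‖ₑ :=
    Measurable.mul (by fun_prop)
      ((hΩ.measurable_right x).comp (measurable_const.sub measurable_id)).enorm
  rw [absOp_eq_setLIntegral Ω s hsupp]
  refine (lintegral_mul_le_eLpNorm_mul_eLpNorm hℓ hm.aemeasurable hf.enorm.restrict).trans ?_
  rw [eLpNorm_enorm]
  gcongr
  · rw [eLpNorm_ofReal_le_iff hℓ.pos, ENNReal.rpow_inv_rpow hℓ.ne_zero]
    refine le_trans ?_ (H R hR x)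
    simp only [enorm_eq_self, ENNReal.mul_rpow_of_nonneg _ _ hℓ.nonneg, ← ENNReal.rpow_mul, neg_mul]
    rw [← lintegral_indicator measurableSet_closedBall.compl,
      ← lintegral_sub_left_eq_self ((closedBall (0 : Rn n) R)ᶜ.indicator _) x,
      ← lintegral_indicator measurableSet_ball.compl]
    refine lintegral_mono fun y => ?_
    by_cases hy : y ∈ (ball (0 : Rn n) (2 * R))ᶜ
    · have hxy : x - y ∈ (closedBall (0 : Rn n) R)ᶜ := by
        have := norm_sub_norm_le y x
        rw [mem_compl_iff, mem_ball_zero_iff, not_lt] at hy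
        rw [mem_ball_zero_iff] at hx
        rw [mem_compl_iff, mem_closedBall_zero_iff, not_le, norm_sub_rev]
        linarith
      rw [indicator_of_mem hy, indicator_of_mem hxy]
    · rw [indicator_of_notMem hy]
      exact zero_le
  · exact Measure.restrict_le_self

theorem IsKernel.absOp_add_le (hΩ : IsKernel r Ω) (s : ℝ) {f g : Rn n → ℂ}
    (hf : AEStronglyMeasurable f volume) : absOp Ω s (f + g) ≤ absOp Ω s f + absOp Ω s g := by
  intro x
  have hm : Measurable fun y => ‖x - y‖ₑ ^ (-s) * ‖Ω x (x - y)‖ₑ :=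
    Measurable.mul (by fun_prop)
      ((hΩ.measurable_right x).comp (measurable_const.sub measurable_id)).enorm
  calc absOp Ω s (f + g) x
      ≤ ∫⁻ y, ‖x - y‖ₑ ^ (-s) * ‖Ω x (x - y)‖ₑ * ‖f y‖ₑ +
          ‖x - y‖ₑ ^ (-s) * ‖Ω x (x - y)‖ₑ * ‖g y‖ₑ := by
        refine lintegral_mono fun y => ?_
        rw [← mul_add]
        gcongr
        exact enorm_add_le _ _
    _ = absOp Ω s f x + absOp Ω s g x := lintegral_add_left' (hm.aemeasurable.mul hf.enorm) _

theorem IsKernel.exists_eLpNorm_absOp_ball_le_of_exponent_le [NeZero n] (hΩ : IsKernel r Ω)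
    {t s q Q ℓ : ℝ} (hrt : r.HolderConjugate t) (hq : 0 < q) (hqQ : q ≤ Q) (htQ : t ≤ Q)
    (hs : s < n / r + n / Q) (htℓ : t ≤ ℓ) {R : ℝ} (hR : 0 < R) :
    ∃ C : ℝ≥0∞, C ≠ ∞ ∧ ∀ f : Rn n → ℂ, AEStronglyMeasurable f volume →
      Function.support f ⊆ ball 0 R →
      eLpNorm (absOp Ω s f) (ENNReal.ofReal q) (volume.restrict (ball 0 R)) ≤
        C * eLpNorm f (ENNReal.ofReal ℓ) volume := by
  have ht := hrt.symm.pos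
  have htop (e : ℝ) : ENNReal.ofReal R ^ e ≠ ∞ :=
    ENNReal.rpow_ne_top_of_ne_zero (by simpa using hR) ENNReal.ofReal_ne_top
  have hexp : 0 ≤ 1 / t - 1 / ℓ := sub_nonneg.2 (one_div_le_one_div_of_le ht htℓ)
  obtain ⟨C, hC, H⟩ := hΩ.exists_eLpNorm_absOp_ball_le_of_le hrt hq hqQ htQ hs
  refine ⟨C * ENNReal.ofReal R ^ (n / r - s + n / q) *
    (ENNReal.ofReal R ^ (n / t - n / ℓ) * volume (ball (0 : Rn n) 1) ^ (1 / t - 1 / ℓ)), ?_, ?_⟩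
  · have h₁ := htop (n / r - s + n / q)
    have h₂ := htop (n / t - n / ℓ)
    finiteness
  intro f hf hsupp
  refine (H 0 R hR f hf hsupp).trans ?_
  rw [← eLpNorm_restrict_eq_of_support_subset hsupp,
    mul_assoc _ _ (eLpNorm f (ENNReal.ofReal ℓ) volume),
    mul_comm _ (eLpNorm f (ENNReal.ofReal ℓ) volume)]
  gcongr _ * ?_
  refine (eLpNorm_restrict_ball_le_mul ht htℓ hR 0 hf.restrict).trans ?_
  gcongr
  exact Measure.restrict_le_self

theorem IsKernel.eLpNorm_absOp_le_add_compl (hΩ : IsKernel r Ω) (s : ℝ) (μ : Measure (Rn n))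
    (hμ : μ ≪ volume) (q : ℝ≥0∞) {f : Rn n → ℂ} (hf : AEStronglyMeasurable f volume)
    {B : Set (Rn n)} (hB : MeasurableSet B) :
    eLpNorm (absOp Ω s f) q μ ≤ ENNReal.LpAddConst q *
      (eLpNorm (absOp Ω s (B.indicator f)) q μ + eLpNorm (absOp Ω s (Bᶜ.indicator f)) q μ) := by
  have hind {A : Set (Rn n)} (hA : MeasurableSet A) :
      AEStronglyMeasurable (absOp Ω s (A.indicator f)) μ :=
    ((aemeasurable_absOp hΩ s (hf.indicator hA)).mono_ac hμ).aestronglyMeasurable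
  refine le_trans (eLpNorm_mono_enorm fun x => ?_) (eLpNorm_add_le' (hind hB) (hind hB.compl) q)
  have := hΩ.absOp_add_le s (g := Bᶜ.indicator f) (hf.indicator hB) x
  rwa [B.indicator_self_add_compl] at this

theorem IsKernel.exists_eLpNorm_absOp_ball_zero_le [NeZero n] (hΩ : IsKernel r Ω)
    {t s q Q ℓ ℓ' : ℝ} (hrt : r.HolderConjugate t) (hq : 0 < q) (hqQ : q ≤ Q) (htQ : t ≤ Q)
    (hs : s < n / r + n / Q) (hℓ : ℓ'.HolderConjugate ℓ) (htℓ : t ≤ ℓ) (hsℓ : n < s * ℓ')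
    {R : ℝ} (hR : 0 < R) :
    ∃ C : ℝ≥0∞, C ≠ ∞ ∧ ∀ f : Rn n → ℂ, AEStronglyMeasurable f volume →
      eLpNorm (absOp Ω s f) (ENNReal.ofReal q) (volume.restrict (ball 0 R)) ≤
        C * eLpNorm f (ENNReal.ofReal ℓ) volume := by
  have hℓ'r : ℓ' ≤ r := by
    have := inv_anti₀ hrt.symm.pos htℓ
    rw [← inv_le_inv₀ hrt.pos hℓ.pos]
    linarith [hrt.inv_add_inv_eq_one, hℓ.inv_add_inv_eq_one]
  obtain ⟨C₁, hC₁, near⟩ := hΩ.exists_eLpNorm_absOp_ball_le_of_exponent_le hrt hq hqQ htQ hs htℓ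
    (R := 2 * R) (by positivity)
  obtain ⟨C₂, hC₂, far⟩ := hΩ.exists_absOp_le_of_disjoint_ball hℓ hℓ'r hsℓ hR
  set μ : Measure (Rn n) := volume.restrict (ball 0 R)
  have hμ : μ univ < ∞ := by simpa [μ] using measure_ball_lt_top
  let K : ℝ≥0∞ := μ univ ^ (ENNReal.ofReal q).toReal⁻¹
  have hK : K ≠ ∞ := by finiteness
  refine ⟨ENNReal.LpAddConst (ENNReal.ofReal q) * (C₁ + C₂ * K),
    ENNReal.mul_ne_top (ENNReal.LpAddConst_lt_top _).ne (by finiteness), fun f hf => ?_⟩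
  let B : Set (Rn n) := ball 0 (2 * R)
  have hB : MeasurableSet B := measurableSet_ball
  calc eLpNorm (absOp Ω s f) (ENNReal.ofReal q) μ
      ≤ ENNReal.LpAddConst (ENNReal.ofReal q) * (eLpNorm (absOp Ω s (B.indicator f)) _ μ +
          eLpNorm (absOp Ω s (Bᶜ.indicator f)) _ μ) :=
        hΩ.eLpNorm_absOp_le_add_compl s μ Measure.absolutelyContinuous_restrict _ hf hB
    _ ≤ ENNReal.LpAddConst (ENNReal.ofReal q) * (C₁ * eLpNorm f (ENNReal.ofReal ℓ) volume +
          C₂ * eLpNorm f (ENNReal.ofReal ℓ) volume * K) := by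
        gcongr
        · refine (eLpNorm_mono_measure _ (Measure.restrict_mono_set _
            (ball_subset_ball (by linarith)))).trans
            ((near _ (hf.indicator hB) support_indicator_subset).trans ?_)
          gcongr
          exact eLpNorm_indicator_le f
        · refine eLpNorm_le_of_ae_enorm_bound ?_
          filter_upwards [ae_restrict_mem measurableSet_ball] with x hx
          refine (far _ (hf.indicator hB.compl) support_indicator_subset x hx).trans ?_
          gcongr
          exact eLpNorm_indicator_le f
    _ = _ := by ring

end LocalEstimate

/-! ### Oscillation of homogeneous functions -/

section Reflection

open NormedSpace (normalize)
open scoped RealInnerProductSpace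

theorem norm_normalize_le_one {E : Type*} [NormedAddCommGroup E] [NormedSpace ℝ E] (a : E) :
    ‖normalize a‖ ≤ 1 := by
  rw [NormedSpace.normalize, norm_smul, norm_inv, norm_norm]
  exact inv_mul_le_one_of_le₀ le_rfl (norm_nonneg _)

theorem norm_mul_norm_normalize_sub_le {E : Type*} [NormedAddCommGroup E] [NormedSpace ℝ E]
    (a c : E) : ‖c‖ * ‖normalize a - normalize c‖ ≤ 2 * ‖a - c‖ := by
  have key : ‖c‖ • (normalize a - normalize c) = (‖c‖ - ‖a‖) • normalize a + (a - c) := by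
    rw [smul_sub, sub_smul, NormedSpace.norm_smul_normalize, NormedSpace.norm_smul_normalize]
    abel
  calc ‖c‖ * ‖normalize a - normalize c‖
      = ‖(‖c‖ - ‖a‖) • normalize a + (a - c)‖ := by rw [← key, norm_smul, norm_norm]
    _ ≤ |‖c‖ - ‖a‖| * ‖normalize a‖ + ‖a - c‖ := by
        refine (norm_add_le _ _).trans_eq ?_
        rw [norm_smul, Real.norm_eq_abs]
    _ ≤ ‖a - c‖ * 1 + ‖a - c‖ := by
        gcongr
        · exact norm_sub_rev a c ▸ abs_norm_sub_norm_le c a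
        · exact norm_normalize_le_one a
    _ = 2 * ‖a - c‖ := by ring

theorem norm_mul_norm_normalize_add_sub_le {E : Type*} [NormedAddCommGroup E] [NormedSpace ℝ E]
    (w z c : E) :
    ‖c‖ * ‖normalize (normalize w + normalize z) - normalize c‖ ≤
      2 * (‖w - c‖ + ‖z - c‖) := by
  rcases eq_or_ne c 0 with rfl | hc
  · simp only [norm_zero, zero_mul]
    positivity
  have h2 : ‖(2 : ℝ) • normalize c‖ = 2 := by
    rw [norm_smul, NormedSpace.norm_normalize_eq_one_iff.2 hc]
    simp
  have hm := norm_mul_norm_normalize_sub_le (normalize w + normalize z) ((2 : ℝ) • normalize c)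
  rw [h2, NormedSpace.normalize_smul_of_pos two_pos, NormedSpace.normalize_normalize] at hm
  calc ‖c‖ * ‖normalize (normalize w + normalize z) - normalize c‖
      ≤ ‖c‖ * ‖normalize w + normalize z - (2 : ℝ) • normalize c‖ := by
        gcongr
        linarith
    _ ≤ ‖c‖ * (‖normalize w - normalize c‖ + ‖normalize z - normalize c‖) := by
        gcongr
        rw [two_smul, add_sub_add_comm]
        exact norm_add_le _ _
    _ ≤ 2 * (‖w - c‖ + ‖z - c‖) := by
        linarith [norm_mul_norm_normalize_sub_le w c, norm_mul_norm_normalize_sub_le z c]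

variable {E : Type*} [NormedAddCommGroup E] [InnerProductSpace ℝ E]

theorem reflection_span_singleton_eq (v u : E) :
    (ℝ ∙ v).reflection u = (2 * ⟪normalize v, u⟫) • normalize v - u := by
  rw [Submodule.reflection_singleton_apply, NormedSpace.normalize, inner_smul_left]
  simp only [smul_smul, RCLike.ofReal_real_eq_id, id, conj_trivial]
  rw [← Nat.cast_smul_eq_nsmul ℝ, smul_smul]
  congr 2
  rw [div_eq_mul_inv, sq, mul_inv]
  push_cast
  ring

theorem norm_reflection_sub_reflection_le (v c u : E) :
    ‖(ℝ ∙ v).reflection u - (ℝ ∙ c).reflection u‖ ≤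
      4 * ‖normalize v - normalize c‖ * ‖u‖ := by
  rw [reflection_span_singleton_eq, reflection_span_singleton_eq]
  have hv := norm_normalize_le_one v
  have hc := norm_normalize_le_one c
  set v' := normalize v
  set c' := normalize c
  have split : (2 * ⟪v', u⟫) • v' - u - ((2 * ⟪c', u⟫) • c' - u) =
      (2 * ⟪v' - c', u⟫) • v' + (2 * ⟪c', u⟫) • (v' - c') := by
    rw [inner_sub_left, mul_sub, sub_smul, smul_sub]
    abel
  calc _ ≤ ‖(2 * ⟪v' - c', u⟫) • v'‖ + ‖(2 * ⟪c', u⟫) • (v' - c')‖ := split ▸ norm_add_le _ _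
    _ = 2 * |⟪v' - c', u⟫| * ‖v'‖ + 2 * |⟪c', u⟫| * ‖v' - c'‖ := by simp [norm_smul]
    _ ≤ 2 * (‖v' - c'‖ * ‖u‖) * 1 + 2 * (1 * ‖u‖) * ‖v' - c'‖ := by
        gcongr
        · exact abs_real_inner_le_norm _ _
        · exact (abs_real_inner_le_norm _ _).trans (by gcongr)
    _ = _ := by ring

theorem reflection_span_add {w z : E} (h : ‖w‖ = ‖z‖) : (ℝ ∙ (w + z)).reflection w = z := by
  have h₁ : (ℝ ∙ (w + z)).reflection (w + z) = w + z :=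
    Submodule.reflection_mem_subspace_eq_self (Submodule.mem_span_singleton_self _)
  have h₂ : (ℝ ∙ (w + z)).reflection (w - z) = -(w - z) := by
    refine Submodule.reflection_mem_subspace_orthogonalComplement_eq_neg ?_
    rw [Submodule.mem_orthogonal_singleton_iff_inner_right]
    exact (real_inner_add_sub_eq_zero_iff w z).2 h
  calc (ℝ ∙ (w + z)).reflection w
      = (ℝ ∙ (w + z)).reflection ((2⁻¹ : ℝ) • ((w + z) + (w - z))) := by
        congr 1
        module
    _ = z := by
        rw [map_smul, map_add, h₁, h₂]
        module

/-- The direction of `w` reflected about the line spanned by `v` and scaled to the norm of `v`. As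
a function of `v` it is Lipschitz and covers a neighbourhood of `w`, so it trades an average over
points for an average over rotations. -/
noncomputable def reflectDir (w v : E) : E := ‖v‖ • (ℝ ∙ v).reflection (normalize w)

theorem reflectDir_eq (w v : E) :
    reflectDir w v = (2 * ⟪normalize w, v⟫) • normalize v - ‖v‖ • normalize w := by
  rw [reflectDir, reflection_span_singleton_eq, smul_sub, smul_smul]
  congr 2
  rw [mul_left_comm, ← real_inner_smul_left, NormedSpace.norm_smul_normalize, real_inner_comm]

theorem lipschitzWith_reflectDir (w : E) : LipschitzWith 7 (reflectDir w) := by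
  refine LipschitzWith.of_dist_le_mul fun v v' => ?_
  rw [dist_eq_norm, dist_eq_norm, reflectDir_eq, reflectDir_eq]
  have hw := norm_normalize_le_one w
  have hv := norm_normalize_le_one v
  have hvv' := norm_mul_norm_normalize_sub_le v v'
  set w' := normalize w
  set a := normalize v
  set a' := normalize v'
  have split : (2 * ⟪w', v⟫) • a - ‖v‖ • w' - ((2 * ⟪w', v'⟫) • a' - ‖v'‖ • w') =
      (2 * ⟪w', v - v'⟫) • a + (2 * ⟪w', v'⟫) • (a - a') + (‖v'‖ - ‖v‖) • w' := by
    rw [inner_sub_right, mul_sub, sub_smul, smul_sub, sub_smul]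
    abel
  calc _ ≤ ‖(2 * ⟪w', v - v'⟫) • a‖ + ‖(2 * ⟪w', v'⟫) • (a - a')‖ + ‖(‖v'‖ - ‖v‖) • w'‖ :=
        split ▸ norm_add₃_le
    _ = 2 * |⟪w', v - v'⟫| * ‖a‖ + 2 * |⟪w', v'⟫| * ‖a - a'‖ + |‖v'‖ - ‖v‖| * ‖w'‖ := by
        simp [norm_smul]
    _ ≤ 2 * (1 * ‖v - v'‖) * 1 + 2 * (1 * ‖v'‖) * ‖a - a'‖ + ‖v - v'‖ * 1 := by
        gcongr
        · exact (abs_real_inner_le_norm _ _).trans (by gcongr)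
        · exact (abs_real_inner_le_norm _ _).trans (by gcongr)
        · exact norm_sub_rev v v' ▸ abs_norm_sub_norm_le v' v
    _ ≤ ((7 : ℝ≥0) : ℝ) * ‖v - v'‖ := by
        push_cast
        linarith

theorem exists_reflectDir_eq {c w z : E} {d : ℝ} (hd : 4 * d < ‖c‖) (hw : w ∈ closedBall c d)
    (hz : z ∈ closedBall c d) : ∃ v ∈ closedBall c (5 * d), reflectDir w v = z := by
  rw [mem_closedBall, dist_eq_norm] at hw hz
  have hd0 : 0 ≤ d := (norm_nonneg _).trans hw
  have ne_zero {a : E} (ha : ‖a - c‖ ≤ d) : a ≠ 0 := by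
    rintro rfl
    rw [zero_sub, norm_neg] at ha
    linarith
  have hm := norm_mul_norm_normalize_add_sub_le w z c
  set w' := normalize w
  set z' := normalize z
  have hw' : ‖w'‖ = 1 := NormedSpace.norm_normalize_eq_one_iff.2 (ne_zero hw)
  have hz' : ‖z'‖ = 1 := NormedSpace.norm_normalize_eq_one_iff.2 (ne_zero hz)
  have hm0 : w' + z' ≠ 0 := by
    intro h
    rw [h, NormedSpace.normalize_zero_eq_zero, zero_sub, norm_neg, ← norm_norm c, ← norm_smul,
      NormedSpace.norm_smul_normalize] at hm
    linarith
  have hnorm : ‖‖z‖ • normalize (w' + z')‖ = ‖z‖ := by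
    rw [norm_smul, NormedSpace.norm_normalize_eq_one_iff.2 hm0, norm_norm, mul_one]
  refine ⟨‖z‖ • normalize (w' + z'), ?_, ?_⟩
  · have split : ‖z‖ • normalize (w' + z') - c =
        (‖z‖ - ‖c‖) • normalize (w' + z') + ‖c‖ • (normalize (w' + z') - normalize c) := by
      rw [sub_smul, smul_sub, NormedSpace.norm_smul_normalize]
      abel
    rw [mem_closedBall, dist_eq_norm, split]
    refine (norm_add_le _ _).trans ?_
    rw [norm_smul, norm_smul, norm_norm, NormedSpace.norm_normalize_eq_one_iff.2 hm0, mul_one,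
      Real.norm_eq_abs]
    linarith [abs_norm_sub_norm_le z c]
  · rw [reflectDir, hnorm, reflection_span_singleton_eq,
      NormedSpace.normalize_smul_of_pos (norm_pos_iff.2 (ne_zero hz)),
      NormedSpace.normalize_normalize, ← reflection_span_singleton_eq,
      reflection_span_add (hw'.trans hz'.symm), NormedSpace.norm_smul_normalize]

end Reflection

section Oscillation

open NormedSpace (normalize)

theorem isRotation_reflection_trans {n : ℕ} {v c : Rn n} (hv : v ≠ 0) (hc : c ≠ 0) :
    IsRotation ((ℝ ∙ c).reflection.trans (ℝ ∙ v).reflection) := by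
  have det_reflection {u : Rn n} (hu : u ≠ 0) :
      LinearMap.det ((ℝ ∙ u).reflection.toLinearEquiv : Rn n →ₗ[ℝ] Rn n) = (-1) ^ (n - 1) := by
    have hfinrank : Module.finrank ℝ (ℝ ∙ u)ᗮ = n - 1 := by
      have := Submodule.finrank_add_finrank_orthogonal (ℝ ∙ u)
      rw [finrank_span_singleton hu, finrank_euclideanSpace_fin] at this
      omega
    exact hfinrank ▸ Submodule.det_reflection (ℝ ∙ u)
  have hcomp : (((ℝ ∙ c).reflection.trans (ℝ ∙ v).reflection).toLinearEquiv : Rn n →ₗ[ℝ] Rn n) =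
      ((ℝ ∙ v).reflection.toLinearEquiv : Rn n →ₗ[ℝ] Rn n) ∘ₗ
        ((ℝ ∙ c).reflection.toLinearEquiv : Rn n →ₗ[ℝ] Rn n) := rfl
  rw [IsRotation, hcomp, LinearMap.det_comp, det_reflection hv, det_reflection hc, ← mul_pow]
  simp

theorem rotationSize_reflection_trans_le {n : ℕ} (v c : Rn n) :
    rotationSize ((ℝ ∙ c).reflection.trans (ℝ ∙ v).reflection) ≤
      ENNReal.ofReal (4 * ‖normalize v - normalize c‖) := by
  refine iSup_le fun z => ?_
  have hnorm : ‖(ℝ ∙ c).reflection (z : Rn n)‖ = 1 := by simp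
  have h := norm_reflection_sub_reflection_le v c ((ℝ ∙ c).reflection (z : Rn n))
  rw [Submodule.reflection_reflection, hnorm, mul_one] at h
  rw [LinearIsometryEquiv.trans_apply, ← ofReal_norm]
  exact ENNReal.ofReal_le_ofReal h

theorem volume_image_le_of_lipschitzWith {n : ℕ} {K : ℝ≥0} {Φ : Rn n → Rn n}
    (hΦ : LipschitzWith K Φ) (A : Set (Rn n)) :
    volume (Φ '' A) ≤ (K : ℝ≥0∞) ^ n * volume A := by
  have h := hΦ.hausdorffMeasure_image_le (d := Module.finrank ℝ (Rn n)) (by positivity) A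
  rw [ENNReal.rpow_natCast] at h
  have hK : (K : ℝ≥0∞) ^ n = (K : ℝ≥0∞) ^ Module.finrank ℝ (Rn n) := by
    rw [finrank_euclideanSpace_fin]
  rw [hK, Measure.isAddLeftInvariant_eq_smul (volume : Measure (Rn n))
    (μH[Module.finrank ℝ (Rn n)]), Measure.smul_apply, Measure.smul_apply, mul_smul_comm]
  gcongr

theorem setLIntegral_le_of_subset_image {n : ℕ} {K : ℝ≥0} {Φ : Rn n → Rn n}
    (hΦ : LipschitzWith K Φ) {E V : Set (Rn n)} (hEV : E ⊆ Φ '' V) {g : Rn n → ℝ≥0∞}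
    (hg : Measurable g) :
    ∫⁻ z in E, g z ≤ (K : ℝ≥0∞) ^ n * ∫⁻ v in V, g (Φ v) := by
  have hΦm : Measurable Φ := hΦ.continuous.measurable
  have hmap : volume.restrict E ≤ (K : ℝ≥0∞) ^ n • (volume.restrict V).map Φ := by
    refine Measure.le_iff.2 fun A hA => ?_
    rw [Measure.restrict_apply hA, Measure.smul_apply, Measure.map_apply hΦm hA,
      Measure.restrict_apply (hΦm hA), smul_eq_mul]
    refine (measure_mono ?_).trans (volume_image_le_of_lipschitzWith hΦ _)
    rintro z ⟨hzA, hzE⟩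
    obtain ⟨v, hv, rfl⟩ := hEV hzE
    exact ⟨v, ⟨hzA, hv⟩, rfl⟩
  refine (lintegral_mono' hmap le_rfl).trans_eq ?_
  rw [lintegral_smul_measure, smul_eq_mul, lintegral_map hg hΦm]

theorem measurable_reflectDir_comp {n : ℕ} (ρ : Rn n ≃ₗᵢ[ℝ] Rn n) :
    Measurable fun w : Rn n × Rn n => reflectDir (ρ w.1) w.2 := by
  have : Measurable fun w : Rn n × Rn n => ρ w.1 := ρ.continuous.measurable.comp measurable_fst
  simp only [reflectDir_eq, NormedSpace.normalize]
  fun_prop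

theorem ne_zero_of_mem_closedBall {E : Type*} [NormedAddCommGroup E] {c v : E} {d : ℝ}
    (hd : d < ‖c‖) (hv : v ∈ closedBall c d) : v ≠ 0 := by
  rintro rfl
  rw [mem_closedBall, dist_comm, dist_zero_right] at hv
  exact hv.not_gt hd

theorem reflection_mem_closedBall {E : Type*} [NormedAddCommGroup E] [InnerProductSpace ℝ E]
    {c z : E} {d : ℝ} (hz : z ∈ closedBall c d) : (ℝ ∙ c).reflection z ∈ closedBall c d := by
  have hc : (ℝ ∙ c).reflection c = c :=
    Submodule.reflection_mem_subspace_eq_self (Submodule.mem_span_singleton_self c)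
  rw [mem_closedBall] at hz ⊢
  calc dist ((ℝ ∙ c).reflection z) c
      = dist ((ℝ ∙ c).reflection z) ((ℝ ∙ c).reflection c) := by rw [hc]
    _ ≤ d := by rwa [LinearIsometryEquiv.dist_map]

theorem apply_reflectDir_reflection {n : ℕ} {G : Rn n → ℂ}
    (hom : ∀ (z : Rn n) (t : ℝ), 0 < t → G (t • z) = G z) {v c z : Rn n} (hv : v ≠ 0)
    (hz : z ≠ 0) :
    G (reflectDir ((ℝ ∙ c).reflection z) v) =
      G ((ℝ ∙ c).reflection.trans (ℝ ∙ v).reflection z) := by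
  rw [reflectDir, NormedSpace.normalize, map_smul, smul_smul, LinearIsometryEquiv.norm_map,
    hom _ _ (by positivity)]
  rfl

theorem exists_setLIntegral_sub_reflectDir_le {n : ℕ} [NeZero n] (r : ℝ) :
    ∃ C : ℝ≥0∞, C ≠ ∞ ∧ ∀ G : Rn n → ℂ, Measurable G →
      (∀ (z : Rn n) (t : ℝ), 0 < t → G (t • z) = G z) →
      ∀ (c : Rn n) (d : ℝ), 0 < d → 5 * d < ‖c‖ → ∀ M : ℝ≥0∞,
      (∀ ρ : Rn n ≃ₗᵢ[ℝ] Rn n, IsRotation ρ → rotationSize ρ < ENNReal.ofReal (50 * d / ‖c‖) →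
        ∫⁻ z : Sph n, ‖G (ρ z) - G z‖ₑ ^ r ∂sphereMeasure n ≤ M) →
      ∀ v ∈ closedBall c (5 * d),
        ∫⁻ z in closedBall c d, ‖G z - G (reflectDir ((ℝ ∙ c).reflection z) v)‖ₑ ^ r ≤
          C * ‖c‖ₑ ^ (n : ℝ) * M := by
  obtain ⟨C, hC, H⟩ := exists_setLIntegral_ball_norm_rpow_mul_le (n := n) (s := 0)
    (by exact_mod_cast NeZero.pos n)
  refine ⟨C * 2 ^ (n : ℝ), by finiteness, fun G hG hom c d hd hcd M hM v hv => ?_⟩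
  have hc : 0 < ‖c‖ := by linarith
  have hv0 : v ≠ 0 := ne_zero_of_mem_closedBall hcd hv
  set ρ := (ℝ ∙ c).reflection.trans (ℝ ∙ v).reflection
  have hsize : rotationSize ρ < ENNReal.ofReal (50 * d / ‖c‖) := by
    refine (rotationSize_reflection_trans_le v c).trans_lt ?_
    rw [ENNReal.ofReal_lt_ofReal_iff (by positivity), lt_div_iff₀ hc]
    rw [mem_closedBall, dist_eq_norm] at hv
    linarith [norm_mul_norm_normalize_sub_le v c]
  have hGρ : Measurable fun z => ‖G (ρ z) - G z‖ₑ ^ r :=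
    ((hG.comp ρ.continuous.measurable).sub hG).enorm.pow_const r
  have hball := H (2 * ‖c‖) (by positivity) (fun z => ‖G (ρ z) - G z‖ₑ ^ r) hGρ
    fun z t ht => by rw [map_smul, hom _ _ ht, hom _ _ ht]
  simp only [neg_zero, ENNReal.rpow_zero, one_mul, sub_zero] at hball
  calc ∫⁻ z in closedBall c d, ‖G z - G (reflectDir ((ℝ ∙ c).reflection z) v)‖ₑ ^ r
      = ∫⁻ z in closedBall c d, ‖G (ρ z) - G z‖ₑ ^ r := by
        refine setLIntegral_congr_fun measurableSet_closedBall fun z hz => ?_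
        have hz0 : z ≠ 0 := ne_zero_of_mem_closedBall (by linarith) hz
        simp only [apply_reflectDir_reflection hom hv0 hz0, enorm_sub_rev (G z), ρ]
    _ ≤ ∫⁻ z in ball 0 (2 * ‖c‖), ‖G (ρ z) - G z‖ₑ ^ r := by
        refine lintegral_mono_set fun z hz => ?_
        rw [mem_closedBall, dist_eq_norm] at hz
        rw [mem_ball_zero_iff]
        linarith [norm_le_norm_add_norm_sub' z c]
    _ ≤ C * ENNReal.ofReal (2 * ‖c‖) ^ (n : ℝ) * M :=
        hball.trans (mul_le_mul_right
          (hM ρ (isRotation_reflection_trans hv0 (norm_pos_iff.1 hc)) hsize) _)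
    _ = C * 2 ^ (n : ℝ) * ‖c‖ₑ ^ (n : ℝ) * M := by
        rw [ENNReal.ofReal_mul (by norm_num), ofReal_norm,
          ENNReal.mul_rpow_of_nonneg _ _ (by positivity), ENNReal.ofReal_ofNat]
        simp only [mul_assoc]

theorem lintegral_lintegral_sub_rpow_le {n : ℕ} {r : ℝ} {G : Rn n → ℂ} (hG : Measurable G)
    {c : Rn n} {d : ℝ} (hd : 0 < d) (hcd : 4 * d < ‖c‖) {K : ℝ≥0∞}
    (hK : ∀ v ∈ closedBall c (5 * d),
      ∫⁻ z in closedBall c d, ‖G z - G (reflectDir ((ℝ ∙ c).reflection z) v)‖ₑ ^ r ≤ K) :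
    ∫⁻ z' in closedBall c d, ∫⁻ z in closedBall c d, ‖G z - G z'‖ₑ ^ r ≤
      35 ^ n * K * volume (closedBall c d) := by
  have hvol : volume (closedBall c (5 * d)) = 5 ^ n * volume (closedBall c d) := by
    rw [Measure.addHaar_closedBall _ _ (by positivity), Measure.addHaar_closedBall _ _ hd.le,
      finrank_euclideanSpace_fin, mul_pow, ENNReal.ofReal_mul (by positivity), mul_assoc,
      ENNReal.ofReal_pow (by norm_num), ENNReal.ofReal_ofNat]
  have hΦ : Measurable fun w : Rn n × Rn n =>
      ‖G w.1 - G (reflectDir ((ℝ ∙ c).reflection w.1) w.2)‖ₑ ^ r :=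
    ((hG.comp measurable_fst).sub
      (hG.comp (measurable_reflectDir_comp _))).enorm.pow_const r
  calc ∫⁻ z' in closedBall c d, ∫⁻ z in closedBall c d, ‖G z - G z'‖ₑ ^ r
      = ∫⁻ z in closedBall c d, ∫⁻ z' in closedBall c d, ‖G z - G z'‖ₑ ^ r :=
        lintegral_lintegral_swap (f := fun z' z => ‖G z - G z'‖ₑ ^ r)
          (Measurable.aemeasurable (by fun_prop))
    _ ≤ ∫⁻ z in closedBall c d, 7 ^ n * ∫⁻ v in closedBall c (5 * d),
          ‖G z - G (reflectDir ((ℝ ∙ c).reflection z) v)‖ₑ ^ r := by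
        refine setLIntegral_mono' measurableSet_closedBall fun z hz => ?_
        simpa only [ENNReal.coe_ofNat] using
          setLIntegral_le_of_subset_image (lipschitzWith_reflectDir ((ℝ ∙ c).reflection z))
            (fun z' hz' => exists_reflectDir_eq hcd (reflection_mem_closedBall hz) hz')
            (g := fun z' => ‖G z - G z'‖ₑ ^ r) (by fun_prop)
    _ = 7 ^ n * ∫⁻ v in closedBall c (5 * d), ∫⁻ z in closedBall c d,
          ‖G z - G (reflectDir ((ℝ ∙ c).reflection z) v)‖ₑ ^ r := by
        rw [lintegral_const_mul' _ _ (by simp), lintegral_lintegral_swap hΦ.aemeasurable]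
    _ ≤ 7 ^ n * ∫⁻ _ in closedBall c (5 * d), K := by
        gcongr 7 ^ n * ?_
        exact setLIntegral_mono' measurableSet_closedBall hK
    _ = 35 ^ n * K * volume (closedBall c d) := by
        rw [setLIntegral_const, hvol, show (35 : ℝ≥0∞) = 7 * 5 by norm_num, mul_pow]
        ring

theorem exists_eLpNorm_sub_apply_le {n : ℕ} [NeZero n] {r : ℝ} (hr : 0 < r) :
    ∃ C : ℝ≥0∞, C ≠ ∞ ∧ ∀ G : Rn n → ℂ, Measurable G →
      (∀ (z : Rn n) (t : ℝ), 0 < t → G (t • z) = G z) →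
      ∀ (c : Rn n) (d : ℝ), 0 < d → 5 * d < ‖c‖ → ∀ M : ℝ≥0∞,
      (∀ ρ : Rn n ≃ₗᵢ[ℝ] Rn n, IsRotation ρ → rotationSize ρ < ENNReal.ofReal (50 * d / ‖c‖) →
        eLpNorm (fun z : Sph n => G (ρ z) - G z) (ENNReal.ofReal r) (sphereMeasure n) ≤ M) →
      ∃ z₀ ∈ closedBall c d,
        eLpNorm (fun z => G z - G z₀) (ENNReal.ofReal r) (volume.restrict (closedBall c d)) ≤
          C * ‖c‖ₑ ^ ((n : ℝ) / r) * M := by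
  obtain ⟨C, hC, H⟩ := exists_setLIntegral_sub_reflectDir_le (n := n) r
  refine ⟨(35 ^ n * C) ^ r⁻¹, by finiteness, fun G hG hom c d hd hcd M hM => ?_⟩
  have hdouble := lintegral_lintegral_sub_rpow_le hG hd (by linarith)
    (H G hG hom c d hd hcd (M ^ r) fun ρ hρ hsize =>
      (eLpNorm_ofReal_le_iff hr).1 (hM ρ hρ hsize))
  obtain ⟨z₀, hz₀, h⟩ := exists_le_setLAverage (μ := volume) (s := closedBall c d)
    (f := fun z' => ∫⁻ z in closedBall c d, ‖G z - G z'‖ₑ ^ r)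
    (measure_closedBall_pos _ _ hd).ne' measure_closedBall_lt_top.ne
    (Measurable.lintegral_prod_right' (f := fun w : Rn n × Rn n => ‖G w.2 - G w.1‖ₑ ^ r)
      (by fun_prop)).aemeasurable
  refine ⟨z₀, hz₀, (eLpNorm_ofReal_le_iff hr).2 (h.trans ?_)⟩
  rw [setLAverage_eq]
  refine ENNReal.div_le_of_le_mul (hdouble.trans_eq ?_)
  rw [ENNReal.mul_rpow_of_nonneg _ _ hr.le, ENNReal.mul_rpow_of_nonneg _ _ hr.le,
    ← ENNReal.rpow_mul, ← ENNReal.rpow_mul, inv_mul_cancel₀ hr.ne', div_mul_cancel₀ _ hr.ne',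
    ENNReal.rpow_one]
  ring

end Oscillation

section ModulusAndLipschitz

theorem modulus_mono {n : ℕ} (r : ℝ) (Ω : Rn n → Rn n → ℂ) : Monotone (modulus r Ω) := by
  intro δ δ' h
  refine iSup_mono fun x => iSup_mono fun ρ => iSup_mono fun _ => ?_
  exact iSup_mono' fun hs => ⟨hs.trans_le (ENNReal.ofReal_le_ofReal h), le_rfl⟩

theorem eLpNorm_rotation_sub_le_modulus {n : ℕ} {r : ℝ} (hr : 0 < r) (Ω : Rn n → Rn n → ℂ)
    (x : Rn n) {ρ : Rn n ≃ₗᵢ[ℝ] Rn n} (hρ : IsRotation ρ) {δ : ℝ}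
    (hδ : rotationSize ρ < ENNReal.ofReal δ) :
    eLpNorm (fun z : Sph n => Ω x (ρ z) - Ω x z) (ENNReal.ofReal r) (sphereMeasure n) ≤
      modulus r Ω δ := by
  rw [eLpNorm_eq_lintegral_rpow_enorm_toReal (by simpa using hr) ENNReal.ofReal_ne_top,
    ENNReal.toReal_ofReal hr.le]
  exact le_iSup_of_le x (le_iSup_of_le ρ (le_iSup_of_le hρ (le_iSup_of_le hδ le_rfl)))

theorem exists_modulus_le {n : ℕ} {r β : ℝ} (hβ : 0 < β) {Ω : Rn n → Rn n → ℂ}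
    (h : DiniCondition r β Ω) :
    ∃ C : ℝ≥0∞, C ≠ ∞ ∧ ∀ δ : ℝ, 0 < δ → δ ≤ 1 / 2 →
      modulus r Ω δ ≤ C * ENNReal.ofReal δ ^ β := by
  refine ⟨(∫⁻ δ in Ioo (0 : ℝ) 1, modulus r Ω δ / ENNReal.ofReal (δ ^ (1 + β))) * 2 ^ (1 + β),
    ENNReal.mul_ne_top h.ne (by finiteness), fun δ hδ hδ2 => ?_⟩
  set D := ∫⁻ δ in Ioo (0 : ℝ) 1, modulus r Ω δ / ENNReal.ofReal (δ ^ (1 + β))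
  have hD : modulus r Ω δ / ENNReal.ofReal ((2 * δ) ^ (1 + β)) * ENNReal.ofReal δ ≤ D := by
    calc modulus r Ω δ / ENNReal.ofReal ((2 * δ) ^ (1 + β)) * ENNReal.ofReal δ
        = ∫⁻ _ in Ioo δ (2 * δ), modulus r Ω δ / ENNReal.ofReal ((2 * δ) ^ (1 + β)) := by
          rw [setLIntegral_const, Real.volume_Ioo]
          congr 2
          ring
      _ ≤ ∫⁻ t in Ioo δ (2 * δ), modulus r Ω t / ENNReal.ofReal (t ^ (1 + β)) := by
          refine setLIntegral_mono' measurableSet_Ioo fun t ht => ?_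
          refine ENNReal.div_le_div (modulus_mono r Ω ht.1.le) (ENNReal.ofReal_le_ofReal ?_)
          exact Real.rpow_le_rpow (hδ.trans ht.1).le ht.2.le (by positivity)
      _ ≤ D := lintegral_mono_set (Ioo_subset_Ioo hδ.le (by linarith))
  have hδ0 : ENNReal.ofReal δ ≠ 0 := by simpa using hδ
  have hpow : ENNReal.ofReal ((2 * δ) ^ (1 + β)) =
      2 ^ (1 + β) * (ENNReal.ofReal δ * ENNReal.ofReal δ ^ β) := by
    rw [← ENNReal.ofReal_rpow_of_pos (by positivity), ENNReal.ofReal_mul zero_le_two,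
      ENNReal.mul_rpow_of_nonneg _ _ (by positivity), ENNReal.ofReal_ofNat,
      ENNReal.rpow_add 1 β hδ0 ENNReal.ofReal_ne_top, ENNReal.rpow_one]
  have hpow0 : ENNReal.ofReal ((2 * δ) ^ (1 + β)) ≠ 0 := by
    simp only [ne_eq, ENNReal.ofReal_eq_zero, not_le]
    positivity
  refine (ENNReal.mul_le_mul_iff_left hδ0 ENNReal.ofReal_ne_top).1 ?_
  calc modulus r Ω δ * ENNReal.ofReal δ
      = (modulus r Ω δ / ENNReal.ofReal ((2 * δ) ^ (1 + β)) * ENNReal.ofReal δ) *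
          ENNReal.ofReal ((2 * δ) ^ (1 + β)) := by
        rw [mul_right_comm, ENNReal.div_mul_cancel hpow0 ENNReal.ofReal_ne_top]
    _ ≤ D * ENNReal.ofReal ((2 * δ) ^ (1 + β)) := by gcongr
    _ = D * 2 ^ (1 + β) * ENNReal.ofReal δ ^ β * ENNReal.ofReal δ := by
        rw [hpow]
        ring

variable {n : ℕ} {Ω : Rn n → Rn n → ℂ} {α β : ℝ} {b : Rn n → ℂ}

theorem enorm_sub_le_lipNorm (β : ℝ) (b : Rn n → ℂ) (x y : Rn n) :
    ‖b x - b y‖ₑ ≤ lipNorm β b * ‖x - y‖ₑ ^ β := by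
  rcases eq_or_ne x y with rfl | hxy
  · simp
  have h0 : ‖x - y‖ₑ ≠ 0 := enorm_ne_zero.2 (sub_ne_zero.2 hxy)
  have h : ‖b x - b y‖ₑ / ENNReal.ofReal (‖x - y‖ ^ β) ≤ lipNorm β b :=
    le_iSup_of_le x (le_iSup_of_le y (le_iSup_of_le hxy le_rfl))
  rw [← ENNReal.ofReal_rpow_of_pos (norm_pos_iff.2 (sub_ne_zero.2 hxy)), ofReal_norm] at h
  refine (ENNReal.div_le_iff_le_mul (Or.inl ?_) (Or.inl ?_)).1 h
  · simp [ENNReal.rpow_eq_zero_iff, h0]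
  · exact ENNReal.rpow_ne_top_of_ne_zero h0 (by simp)

theorem norm_sub_le_lipNorm (hβ : 0 ≤ β) (hb : lipNorm β b < ∞) (x y : Rn n) :
    ‖b x - b y‖ ≤ (lipNorm β b).toReal * ‖x - y‖ ^ β := by
  have h := ENNReal.toReal_mono (by finiteness) (enorm_sub_le_lipNorm β b x y)
  simpa [ENNReal.toReal_mul, ← ENNReal.toReal_rpow] using h

theorem continuous_of_lipNorm_lt_top (hβ : 0 < β) (hb : lipNorm β b < ∞) : Continuous b := by
  refine continuous_iff_continuousAt.2 fun x => tendsto_iff_norm_sub_tendsto_zero.2 ?_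
  have hlim : Tendsto (fun y => (lipNorm β b).toReal * ‖y - x‖ ^ β) (𝓝 x) (𝓝 0) := by
    have : Tendsto (fun y : Rn n => ‖y - x‖) (𝓝 x) (𝓝 0) :=
      tendsto_iff_norm_sub_tendsto_zero.1 tendsto_id
    simpa [Real.zero_rpow hβ.ne'] using
      (this.rpow_const (p := β) (Or.inr hβ.le)).const_mul (lipNorm β b).toReal
  exact squeeze_zero (fun y => norm_nonneg _) (fun y => norm_sub_le_lipNorm hβ.le hb y x) hlim

theorem commutatorIntegrand_eq (Ω : Rn n → Rn n → ℂ) (α : ℝ) (b f : Rn n → ℂ) (x y : Rn n) :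
    commutatorIntegrand Ω α b f x y =
      Ω x (x - y) * ((‖x - y‖ ^ (α - n) : ℝ) : ℂ) * (b x - b y) * f y := by
  rw [commutatorIntegrand, div_eq_mul_inv, ← neg_sub (n : ℝ) α, Real.rpow_neg (norm_nonneg _)]
  push_cast
  rfl

theorem enorm_commutatorIntegrand_le (Ω : Rn n → Rn n → ℂ) (α β : ℝ) (b f : Rn n → ℂ)
    (x y : Rn n) :
    ‖commutatorIntegrand Ω α b f x y‖ₑ ≤
      lipNorm β b * (‖x - y‖ₑ ^ (-(n - α - β)) * ‖Ω x (x - y)‖ₑ * ‖f y‖ₑ) := by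
  rcases eq_or_ne x y with rfl | hxy
  · simp [commutatorIntegrand]
  have hpos : 0 < ‖x - y‖ := norm_pos_iff.2 (sub_ne_zero.2 hxy)
  have h0 : ‖x - y‖ₑ ≠ 0 := enorm_ne_zero.2 (sub_ne_zero.2 hxy)
  have hsplit : ‖x - y‖ₑ ^ (-(n - α - β)) = ‖x - y‖ₑ ^ (α - n) * ‖x - y‖ₑ ^ β := by
    rw [← ENNReal.rpow_add _ _ h0 (by simp)]
    congr 1
    ring
  have hnorm : ‖((‖x - y‖ ^ (α - n) : ℝ) : ℂ)‖ₑ = ‖x - y‖ₑ ^ (α - n) := by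
    rw [← ofReal_norm, Complex.norm_real, Real.norm_of_nonneg (by positivity),
      ← ENNReal.ofReal_rpow_of_pos hpos, ofReal_norm]
  rw [commutatorIntegrand_eq, enorm_mul, enorm_mul, enorm_mul, hnorm, hsplit]
  calc _ ≤ ‖Ω x (x - y)‖ₑ * ‖x - y‖ₑ ^ (α - n) * (lipNorm β b * ‖x - y‖ₑ ^ β) * ‖f y‖ₑ := by
        gcongr
        exact enorm_sub_le_lipNorm β b x y
    _ = _ := by ring

theorem enorm_commutator_le (Ω : Rn n → Rn n → ℂ) (α : ℝ) (hb : lipNorm β b < ∞) (f : Rn n → ℂ)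
    (x : Rn n) :
    ‖commutator Ω α b f x‖ₑ ≤ lipNorm β b * absOp Ω (n - α - β) f x := by
  refine (enorm_integral_le_lintegral_enorm _).trans ?_
  rw [absOp, ← lintegral_const_mul' _ _ hb.ne]
  exact lintegral_mono fun y => enorm_commutatorIntegrand_le Ω α β b f x y

end ModulusAndLipschitz

/-! ### Decay of the commutator away from the support -/

section FarEstimate

theorem exists_abs_rpow_sub_one_le (e : ℝ) : ∃ K : ℝ, 0 ≤ K ∧ ∀ τ ∈ Icc (1 / 2 : ℝ) 2,
    |τ ^ e - 1| ≤ K * |τ - 1| := by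
  have hpos {τ : ℝ} (hτ : τ ∈ Icc (1 / 2 : ℝ) 2) : τ ≠ 0 := by linarith [hτ.1]
  have hcont : ContinuousOn (fun τ : ℝ => e * τ ^ (e - 1)) (Icc (1 / 2 : ℝ) 2) := fun τ hτ =>
    ((Real.continuousAt_rpow_const τ (e - 1) (Or.inl (hpos hτ))).const_mul e).continuousWithinAt
  obtain ⟨K, hK⟩ := isCompact_Icc.exists_bound_of_continuousOn hcont
  refine ⟨K, (norm_nonneg _).trans (hK 1 (by norm_num)), fun τ hτ => ?_⟩
  simpa using (convex_Icc (1 / 2 : ℝ) 2).norm_image_sub_le_of_norm_hasDerivWithin_le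
    (fun t ht => (Real.hasDerivAt_rpow_const (p := e) (Or.inl (hpos ht))).hasDerivWithinAt) hK
    (by norm_num : (1 : ℝ) ∈ _) hτ

theorem exists_abs_rpow_sub_rpow_le (e : ℝ) : ∃ K : ℝ, 0 ≤ K ∧ ∀ d R τ : ℝ, 0 < R → 2 * d ≤ R →
    |τ - R| ≤ d → |τ ^ e - R ^ e| ≤ K * (d / R) * R ^ e := by
  obtain ⟨K, hK0, hK⟩ := exists_abs_rpow_sub_one_le e
  refine ⟨K, hK0, fun d R τ hR hdR hτ => ?_⟩
  have hquot : |τ / R - 1| ≤ d / R := by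
    rw [div_sub_one hR.ne', abs_div, abs_of_pos hR]
    gcongr
  have hd2 : d / R ≤ 1 / 2 := by
    rw [div_le_iff₀ hR]
    linarith
  have hmem : τ / R ∈ Icc (1 / 2 : ℝ) 2 := by
    have := abs_le.1 (hquot.trans hd2)
    constructor <;> linarith [this.1, this.2]
  have hτ0 : 0 ≤ τ / R := by linarith [hmem.1]
  have hpow : τ ^ e - R ^ e = ((τ / R) ^ e - 1) * R ^ e := by
    rw [sub_mul, one_mul, ← Real.mul_rpow hτ0 hR.le, div_mul_cancel₀ _ hR.ne']
  rw [hpow, abs_mul, abs_of_pos (Real.rpow_pos_of_pos hR e)]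
  gcongr
  exact (hK _ hmem).trans (by gcongr)

theorem div_mul_rpow_le {β d R : ℝ} (hβ : β ≤ 1) (hd : 0 < d) (hdR : d ≤ R) :
    d / R * R ^ β ≤ d ^ β := by
  have hR : 0 < R := hd.trans_le hdR
  calc d / R * R ^ β ≤ (d / R) ^ β * R ^ β := by
        gcongr
        exact Real.self_le_rpow_of_le_one (by positivity) ((div_le_one hR).2 hdR) hβ
    _ = d ^ β := by rw [Real.div_rpow hd.le hR.le, div_mul_cancel₀ _ (by positivity)]

theorem exists_norm_kernel_sub_le (e : ℝ) : ∃ K : ℝ, 0 ≤ K ∧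
    ∀ (β L d R τ : ℝ) (g g₀ B₁ B₂ : ℂ), β ≤ 1 → 0 ≤ L → 0 < d → 2 * d ≤ R →
      |τ - R| ≤ d → ‖B₁‖ ≤ L * R ^ β → ‖B₂‖ ≤ L * d ^ β →
      ‖g * ((τ ^ e : ℝ) : ℂ) * (B₁ + B₂) - g₀ * ((R ^ e : ℝ) : ℂ) * B₁‖ ≤
        K * L * R ^ e * (d ^ β * ‖g‖ + R ^ β * ‖g - g₀‖) := by
  obtain ⟨K, hK0, hK⟩ := exists_abs_rpow_sub_rpow_le e
  refine ⟨1 + 2 * K, by positivity, ?_⟩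
  intro β L d R τ g g₀ B₁ B₂ hβ hL hd hdR hτ hB₁ hB₂
  have hR : 0 < R := by linarith
  have hτ0 : 0 < τ := by linarith [(abs_le.1 hτ).1]
  have hRe : 0 < R ^ e := by positivity
  have hdiff := hK d R τ hR hdR hτ
  have hτe : τ ^ e ≤ (1 + K) * R ^ e := by
    have : K * (d / R) * R ^ e ≤ K * R ^ e := by
      gcongr
      exact mul_le_of_le_one_right hK0 ((div_le_one hR).2 (by linarith))
    linarith [(abs_le.1 hdiff).2]
  have hsplit : g * ((τ ^ e : ℝ) : ℂ) * (B₁ + B₂) - g₀ * ((R ^ e : ℝ) : ℂ) * B₁ =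
      g * ((τ ^ e : ℝ) : ℂ) * B₂ + g * ((τ ^ e - R ^ e : ℝ) : ℂ) * B₁ +
        (g - g₀) * ((R ^ e : ℝ) : ℂ) * B₁ := by
    push_cast
    ring
  rw [hsplit]
  calc _ ≤ ‖g * ((τ ^ e : ℝ) : ℂ) * B₂‖ + ‖g * ((τ ^ e - R ^ e : ℝ) : ℂ) * B₁‖ +
        ‖(g - g₀) * ((R ^ e : ℝ) : ℂ) * B₁‖ := norm_add₃_le
    _ = ‖g‖ * τ ^ e * ‖B₂‖ + ‖g‖ * |τ ^ e - R ^ e| * ‖B₁‖ + ‖g - g₀‖ * R ^ e * ‖B₁‖ := by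
        simp only [norm_mul, Complex.norm_real, Real.norm_eq_abs,
          abs_of_pos (Real.rpow_pos_of_pos hτ0 e), abs_of_pos hRe]
    _ ≤ ‖g‖ * ((1 + K) * R ^ e) * (L * d ^ β) + ‖g‖ * (K * (d / R) * R ^ e) * (L * R ^ β) +
        ‖g - g₀‖ * R ^ e * (L * R ^ β) := by gcongr
    _ = L * R ^ e *
        (((1 + K) * d ^ β + K * (d / R * R ^ β)) * ‖g‖ + 1 * (R ^ β * ‖g - g₀‖)) := by ring
    _ ≤ L * R ^ e *
        (((1 + K) * d ^ β + K * d ^ β) * ‖g‖ + (1 + 2 * K) * (R ^ β * ‖g - g₀‖)) := by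
        gcongr
        · exact div_mul_rpow_le hβ hd (by linarith)
        · linarith
    _ = _ := by ring

variable {n : ℕ}

theorem exists_enorm_commutatorIntegrand_sub_le (n : ℕ) (α : ℝ) {β : ℝ} (hβ : 0 ≤ β) (hβ1 : β ≤ 1) :
    ∃ K : ℝ≥0∞, K ≠ ∞ ∧ ∀ (Ω : Rn n → Rn n → ℂ) (b a : Rn n → ℂ), lipNorm β b < ∞ →
      ∀ (x x₀ : Rn n) (d : ℝ) (g₀ : ℂ), 0 < d → 2 * d ≤ ‖x - x₀‖ → ∀ y ∈ closedBall x₀ d,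
      ‖commutatorIntegrand Ω α b a x y -
          g₀ * ((‖x - x₀‖ ^ (α - n) : ℝ) : ℂ) * (b x - b x₀) * a y‖ₑ ≤
        K * lipNorm β b * ‖x - x₀‖ₑ ^ (α - n) *
          (ENNReal.ofReal d ^ β * (‖Ω x (x - y)‖ₑ * ‖a y‖ₑ) +
            ‖x - x₀‖ₑ ^ β * (‖Ω x (x - y) - g₀‖ₑ * ‖a y‖ₑ)) := by
  obtain ⟨K, hK0, hK⟩ := exists_norm_kernel_sub_le (α - n)
  refine ⟨ENNReal.ofReal K, ENNReal.ofReal_ne_top, fun Ω b a hb x x₀ d g₀ hd hdR y hy => ?_⟩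
  have hR : 0 < ‖x - x₀‖ := by linarith
  rw [mem_closedBall, dist_eq_norm] at hy
  have hτ : |‖x - y‖ - ‖x - x₀‖| ≤ d := by
    refine (abs_norm_sub_norm_le _ _).trans ?_
    rwa [sub_sub_sub_cancel_left, norm_sub_rev]
  have hB₂ : ‖b x₀ - b y‖ ≤ (lipNorm β b).toReal * d ^ β := by
    refine (norm_sub_le_lipNorm hβ hb x₀ y).trans ?_
    gcongr
    rwa [norm_sub_rev]
  have h := ENNReal.ofReal_le_ofReal <| hK β (lipNorm β b).toReal d ‖x - x₀‖ ‖x - y‖ (Ω x (x - y))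
    g₀ (b x - b x₀) (b x₀ - b y) hβ1 ENNReal.toReal_nonneg hd hdR hτ
    (norm_sub_le_lipNorm hβ hb x x₀) hB₂
  rw [sub_add_sub_cancel, ofReal_norm, ENNReal.ofReal_mul (by positivity),
    ENNReal.ofReal_mul (by positivity), ENNReal.ofReal_mul hK0,
    ENNReal.ofReal_add (by positivity) (by positivity), ENNReal.ofReal_mul (by positivity),
    ENNReal.ofReal_mul (by positivity), ← ENNReal.ofReal_rpow_of_pos hR,
    ← ENNReal.ofReal_rpow_of_pos hd, ← ENNReal.ofReal_rpow_of_pos hR,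
    ENNReal.ofReal_toReal hb.ne, ofReal_norm, ofReal_norm, ofReal_norm] at h
  rw [commutatorIntegrand_eq, ← sub_mul, enorm_mul]
  refine (mul_le_mul_left h _).trans_eq ?_
  ring

theorem enorm_integral_le_setLIntegral_sub_const_mul {X : Type*} [MeasurableSpace X]
    {μ : Measure X} {B : Set X} {f a : X → ℂ}
    (hf : Function.support f ⊆ B) (ha : Function.support a ⊆ B) (hai : Integrable a μ)
    (ha0 : ∫ y, a y ∂μ = 0) (κ : ℂ) :
    ‖∫ y, f y ∂μ‖ₑ ≤ ∫⁻ y in B, ‖f y - κ * a y‖ₑ ∂μ := by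
  by_cases hfi : Integrable f μ
  · have hsub : ∫ y, f y ∂μ = ∫ y, (f y - κ * a y) ∂μ := by
      rw [integral_sub hfi (hai.const_mul κ), integral_const_mul, ha0, mul_zero, sub_zero]
    have hsupp : Function.support (fun y => f y - κ * a y) ⊆ B := fun y hy => by
      by_contra hyB
      simp [Function.notMem_support.1 fun h => hyB (hf h),
        Function.notMem_support.1 fun h => hyB (ha h)] at hy
    rw [hsub, ← setIntegral_eq_integral_of_forall_compl_eq_zero (s := B)
      fun y hy => Function.notMem_support.1 fun h => hy (hsupp h)]
    exact enorm_integral_le_lintegral_enorm _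
  · rw [integral_undef hfi]
    simp

theorem setLIntegral_closedBall_comp_sub (x x₀ : Rn n) (d : ℝ) (g : Rn n → ℝ≥0∞) :
    ∫⁻ y in closedBall x₀ d, g (x - y) = ∫⁻ z in closedBall (x - x₀) d, g z := by
  have hpre : (x - ·) ⁻¹' closedBall (x - x₀) d = closedBall x₀ d := by
    ext y
    rw [mem_preimage, mem_closedBall, mem_closedBall, dist_sub_left]
  rw [← hpre]
  exact ((Measure.measurePreserving_sub_left volume x).setLIntegral_comp_preimage_emb
    (Homeomorph.subLeft x).measurableEmbedding g _)

theorem setLIntegral_closedBall_comp_sub_mul_le {r t : ℝ} (hrt : r.HolderConjugate t)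
    {g a : Rn n → ℂ} (hg : Measurable g) (ha : AEStronglyMeasurable a volume) (x x₀ : Rn n)
    (d : ℝ) :
    ∫⁻ y in closedBall x₀ d, ‖g (x - y)‖ₑ * ‖a y‖ₑ ≤
      eLpNorm g (ENNReal.ofReal r) (volume.restrict (closedBall (x - x₀) d)) *
        eLpNorm a (ENNReal.ofReal t) volume := by
  have hgx : Measurable fun y => g (x - y) := hg.comp (measurable_const.sub measurable_id)
  have hgnorm : eLpNorm (fun y => g (x - y)) (ENNReal.ofReal r)
      (volume.restrict (closedBall x₀ d)) ≤
        eLpNorm g (ENNReal.ofReal r) (volume.restrict (closedBall (x - x₀) d)) := by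
    rw [eLpNorm_ofReal_le_iff hrt.pos, eLpNorm_ofReal_rpow hrt.pos,
      setLIntegral_closedBall_comp_sub x x₀ d fun z => ‖g z‖ₑ ^ r]
  calc ∫⁻ y in closedBall x₀ d, ‖g (x - y)‖ₑ * ‖a y‖ₑ
      ≤ eLpNorm (fun y => ‖g (x - y)‖ₑ) (ENNReal.ofReal r) (volume.restrict (closedBall x₀ d)) *
          eLpNorm (fun y => ‖a y‖ₑ) (ENNReal.ofReal t) (volume.restrict (closedBall x₀ d)) :=
        lintegral_mul_le_eLpNorm_mul_eLpNorm hrt hgx.enorm.aemeasurable ha.enorm.restrict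
    _ ≤ _ := by
        rw [eLpNorm_enorm, eLpNorm_enorm]
        gcongr
        exact Measure.restrict_le_self

variable {r β : ℝ} {Ω : Rn n → Rn n → ℂ}

theorem IsKernel.exists_eLpNorm_closedBall_le [NeZero n] (hΩ : IsKernel r Ω) (hr : 0 < r) :
    ∃ C : ℝ≥0∞, C ≠ ∞ ∧ ∀ (x c : Rn n) (d : ℝ), 0 < d → d < ‖c‖ →
      eLpNorm (Ω x) (ENNReal.ofReal r) (volume.restrict (closedBall c d)) ≤
        C * ‖c‖ₑ ^ (n / r) := by
  obtain ⟨C, hC, H⟩ := hΩ.exists_setLIntegral_ball_le (s := 0)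
    (by exact_mod_cast NeZero.pos n) hr le_rfl
  refine ⟨(C * 2 ^ (n - 0 * r)) ^ r⁻¹, by finiteness, fun x c d hd hdc => ?_⟩
  have hpow := mul_ofReal_two_mul_rpow_rpow_inv (n := n) (e := 0) hr (by simp) C ‖c‖
  have hball := H (2 * ‖c‖) (by linarith) x
  simp only [neg_zero, ENNReal.rpow_zero, one_mul, sub_zero] at hball
  rw [sub_zero, ofReal_norm] at hpow
  rw [← hpow, eLpNorm_ofReal_le_iff hr, ← ENNReal.rpow_mul, inv_mul_cancel₀ hr.ne',
    ENNReal.rpow_one, zero_mul, sub_zero]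
  refine (lintegral_mono_set fun z hz => ?_).trans hball
  rw [mem_closedBall, dist_eq_norm] at hz
  rw [mem_ball_zero_iff]
  linarith [norm_le_norm_add_norm_sub' z c]

theorem IsKernel.exists_eLpNorm_sub_const_le [NeZero n] (hΩ : IsKernel r Ω) (hr : 0 < r)
    (hβ : 0 < β) (hDini : DiniCondition r β Ω) :
    ∃ C : ℝ≥0∞, C ≠ ∞ ∧ ∀ (x c : Rn n) (d : ℝ), 0 < d → 100 * d ≤ ‖c‖ → ∃ g₀ : ℂ,
      ‖c‖ₑ ^ β * eLpNorm (fun z => Ω x z - g₀) (ENNReal.ofReal r)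
          (volume.restrict (closedBall c d)) ≤
        C * ENNReal.ofReal d ^ β * ‖c‖ₑ ^ (n / r) := by
  obtain ⟨C, hC, H⟩ := exists_eLpNorm_sub_apply_le (n := n) hr
  obtain ⟨C', hC', H'⟩ := exists_modulus_le hβ hDini
  refine ⟨C * C' * 50 ^ β, by finiteness, fun x c d hd hdc => ?_⟩
  have hc : 0 < ‖c‖ := by linarith
  obtain ⟨z₀, -, hz₀⟩ := H (Ω x) (hΩ.measurable_right x) (hΩ.homogeneous x) c d hd (by linarith)
    (modulus r Ω (50 * d / ‖c‖)) fun ρ hρ hsize =>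
      eLpNorm_rotation_sub_le_modulus hr Ω x hρ hsize
  have hmod := H' (50 * d / ‖c‖) (by positivity) (by rw [div_le_iff₀ hc]; linarith)
  have hpow : ‖c‖ₑ ^ β * ENNReal.ofReal (50 * d / ‖c‖) ^ β = 50 ^ β * ENNReal.ofReal d ^ β := by
    rw [← ENNReal.mul_rpow_of_nonneg _ _ hβ.le, ← ENNReal.mul_rpow_of_nonneg _ _ hβ.le,
      ← ofReal_norm, ← ENNReal.ofReal_mul hc.le, mul_div_cancel₀ _ hc.ne',
      ENNReal.ofReal_mul (by norm_num), ENNReal.ofReal_ofNat]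
  refine ⟨Ω x z₀, ?_⟩
  calc _ ≤ ‖c‖ₑ ^ β * (C * ‖c‖ₑ ^ (n / r) * (C' * ENNReal.ofReal (50 * d / ‖c‖) ^ β)) := by
        gcongr
        exact hz₀.trans (by gcongr)
    _ = C * ‖c‖ₑ ^ (n / r) * C' * (‖c‖ₑ ^ β * ENNReal.ofReal (50 * d / ‖c‖) ^ β) := by ring
    _ = _ := by
        rw [hpow]
        ring

theorem IsKernel.exists_enorm_commutator_le_setLIntegral_add (hΩ : IsKernel r Ω) (α : ℝ)
    (hβ : 0 ≤ β) (hβ1 : β ≤ 1) :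
    ∃ K : ℝ≥0∞, K ≠ ∞ ∧ ∀ b : Rn n → ℂ, lipNorm β b < ∞ → ∀ (x₀ : Rn n) (d : ℝ) (a : Rn n → ℂ),
      0 < d → Integrable a → Function.support a ⊆ closedBall x₀ d → ∫ y, a y = 0 →
      ∀ x, 100 * d < ‖x - x₀‖ → ∀ g₀ : ℂ,
      ‖commutator Ω α b a x‖ₑ ≤ K * lipNorm β b * ‖x - x₀‖ₑ ^ (α - n) *
        (ENNReal.ofReal d ^ β * (∫⁻ y in closedBall x₀ d, ‖Ω x (x - y)‖ₑ * ‖a y‖ₑ) +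
          ‖x - x₀‖ₑ ^ β * ∫⁻ y in closedBall x₀ d, ‖Ω x (x - y) - g₀‖ₑ * ‖a y‖ₑ) := by
  obtain ⟨K, hK, pointwise⟩ := exists_enorm_commutatorIntegrand_sub_le n α hβ hβ1
  refine ⟨K, hK, fun b hb x₀ d a hd ha hsupp ha0 x hx g₀ => ?_⟩
  have hm : AEMeasurable (fun y => ‖Ω x (x - y)‖ₑ * ‖a y‖ₑ) (volume.restrict (closedBall x₀ d)) :=
    (((hΩ.measurable_right x).comp (measurable_const.sub measurable_id)).enorm.aemeasurable.mul
      ha.1.enorm).restrict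
  have hsupp' : Function.support (commutatorIntegrand Ω α b a x) ⊆ closedBall x₀ d :=
    (Function.support_mul_subset_right _ _).trans hsupp
  have hR0 : ‖x - x₀‖ₑ ≠ 0 := by
    rw [← ofReal_norm, ENNReal.ofReal_ne_zero_iff]
    linarith
  have hRtop : ‖x - x₀‖ₑ ^ (α - n) ≠ ∞ := ENNReal.rpow_ne_top_of_ne_zero hR0 (by simp)
  calc ‖commutator Ω α b a x‖ₑ
      ≤ ∫⁻ y in closedBall x₀ d, K * lipNorm β b * ‖x - x₀‖ₑ ^ (α - n) *
          (ENNReal.ofReal d ^ β * (‖Ω x (x - y)‖ₑ * ‖a y‖ₑ) +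
            ‖x - x₀‖ₑ ^ β * (‖Ω x (x - y) - g₀‖ₑ * ‖a y‖ₑ)) :=
        (enorm_integral_le_setLIntegral_sub_const_mul hsupp' hsupp ha ha0 _).trans
          (setLIntegral_mono' measurableSet_closedBall
            (pointwise Ω b a hb x x₀ d g₀ hd (by linarith)))
    _ = _ := by
        rw [lintegral_const_mul' _ _ (by finiteness), lintegral_add_left' (hm.const_mul _),
          lintegral_const_mul' _ _ (by finiteness), lintegral_const_mul' _ _ (by finiteness)]

theorem IsKernel.exists_enorm_commutator_le [NeZero n] (hΩ : IsKernel r Ω) {t : ℝ} (α : ℝ)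
    (hrt : r.HolderConjugate t) (hβ : 0 < β) (hβ1 : β ≤ 1) (hDini : DiniCondition r β Ω) :
    ∃ C : ℝ≥0∞, C ≠ ∞ ∧ ∀ b : Rn n → ℂ, lipNorm β b < ∞ → ∀ (x₀ : Rn n) (d : ℝ) (a : Rn n → ℂ),
      0 < d → Integrable a → Function.support a ⊆ closedBall x₀ d → ∫ y, a y = 0 →
      ∀ x, 100 * d < ‖x - x₀‖ →
      ‖commutator Ω α b a x‖ₑ ≤ C * lipNorm β b * ENNReal.ofReal d ^ β *
        ‖x - x₀‖ₑ ^ (α - n + n / r) * eLpNorm a (ENNReal.ofReal t) volume := by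
  obtain ⟨K, hK, split⟩ := hΩ.exists_enorm_commutator_le_setLIntegral_add α hβ.le hβ1
  obtain ⟨C₁, hC₁, H₁⟩ := hΩ.exists_eLpNorm_closedBall_le hrt.pos
  obtain ⟨C₂, hC₂, H₂⟩ := hΩ.exists_eLpNorm_sub_const_le hrt.pos hβ hDini
  refine ⟨K * (C₁ + C₂), by finiteness, fun b hb x₀ d a hd ha hsupp ha0 x hx => ?_⟩
  obtain ⟨g₀, hg₀⟩ := H₂ x (x - x₀) d hd hx.le
  have hΩx := hΩ.measurable_right x
  have hR0 : ‖x - x₀‖ₑ ≠ 0 := by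
    rw [← ofReal_norm, ENNReal.ofReal_ne_zero_iff]
    linarith
  set N := eLpNorm a (ENNReal.ofReal t) volume
  have size : ∫⁻ y in closedBall x₀ d, ‖Ω x (x - y)‖ₑ * ‖a y‖ₑ ≤ C₁ * ‖x - x₀‖ₑ ^ (n / r) * N :=
    (setLIntegral_closedBall_comp_sub_mul_le hrt hΩx ha.1 x x₀ d).trans
      (mul_le_mul_left (H₁ x (x - x₀) d hd (by linarith)) N)
  have oscillation :
      ‖x - x₀‖ₑ ^ β * ∫⁻ y in closedBall x₀ d, ‖Ω x (x - y) - g₀‖ₑ * ‖a y‖ₑ ≤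
        C₂ * ENNReal.ofReal d ^ β * ‖x - x₀‖ₑ ^ (n / r) * N := by
    refine (mul_le_mul_right (setLIntegral_closedBall_comp_sub_mul_le (g := fun z => Ω x z - g₀)
      hrt (hΩx.sub measurable_const) ha.1 x x₀ d) _).trans ?_
    rw [← mul_assoc]
    exact mul_le_mul_left hg₀ N
  calc ‖commutator Ω α b a x‖ₑ
      ≤ K * lipNorm β b * ‖x - x₀‖ₑ ^ (α - n) *
          (ENNReal.ofReal d ^ β * (∫⁻ y in closedBall x₀ d, ‖Ω x (x - y)‖ₑ * ‖a y‖ₑ) +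
            ‖x - x₀‖ₑ ^ β * ∫⁻ y in closedBall x₀ d, ‖Ω x (x - y) - g₀‖ₑ * ‖a y‖ₑ) :=
        split b hb x₀ d a hd ha hsupp ha0 x hx g₀
    _ ≤ K * lipNorm β b * ‖x - x₀‖ₑ ^ (α - n) *
          (ENNReal.ofReal d ^ β * (C₁ * ‖x - x₀‖ₑ ^ (n / r) * N) +
            C₂ * ENNReal.ofReal d ^ β * ‖x - x₀‖ₑ ^ (n / r) * N) := by
        exact mul_le_mul_right (add_le_add (mul_le_mul_right size _) oscillation) _
    _ = _ := by
        rw [ENNReal.rpow_add (α - n) _ hR0 (by simp)]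
        ring

end FarEstimate

/-! ### The estimate on atoms -/

/-- The relations between the exponents that the proof uses: `t` is conjugate to `r`, and `Q` is an
auxiliary exponent through which the estimate of the commutator near an atom factors. -/
structure Exponents (n : ℕ) (α β p q r t Q : ℝ) : Prop where
  conj : r.HolderConjugate t
  β_pos : 0 < β
  β_le : β ≤ 1
  p_pos : 0 < p
  p_le_one : p ≤ 1
  q_pos : 0 < q
  p_le_q : p ≤ q
  q_le : q ≤ Q
  t_le : t ≤ Q
  t_lt_two : t < 2
  order_lt : n - α - β < n / r + n / Q
  rel : n / q = n / p - α - β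
  decay : n < (n - α - n / r) * q
  smooth : n / p < n + 1

section Atoms

variable {n : ℕ}

/-- `a` is `A` times a `(p,2)`-atom on the ball of centre `x₀` and radius `d`, of which only the
mean is required to vanish. The size is measured by the radius instead of the volume. -/
structure IsAtomOn (p : ℝ) (A : ℝ≥0∞) (x₀ : Rn n) (d : ℝ) (a : Rn n → ℂ) : Prop where
  radius_pos : 0 < d
  memLp : MemLp a 2 volume
  support_subset : Function.support a ⊆ closedBall x₀ d
  norm_le : eLpNorm a 2 volume ≤ A * ENNReal.ofReal d ^ ((n : ℝ) / 2 - n / p)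
  integral_eq_zero : ∫ x, a x = 0

theorem volume_closedBall_rpow (x₀ : Rn n) {d : ℝ} (hd : 0 < d) (e : ℝ) :
    volume (closedBall x₀ d) ^ e =
      volume (closedBall (0 : Rn n) 1) ^ e * ENNReal.ofReal d ^ (n * e) := by
  rw [Measure.addHaar_closedBall' _ _ hd.le, finrank_euclideanSpace_fin,
    ENNReal.mul_rpow_of_ne_top (by simp) measure_closedBall_lt_top.ne, mul_comm,
    ENNReal.ofReal_pow hd.le, ← ENNReal.rpow_natCast, ← ENNReal.rpow_mul]

theorem IsAtom.exists_isAtomOn {p : ℝ} (hp : 0 < p) (hp1 : p ≤ 1) {a : Rn n → ℂ}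
    (ha : IsAtom p 2 a) :
    ∃ (x₀ : Rn n) (d : ℝ),
      IsAtomOn p (volume (closedBall (0 : Rn n) 1) ^ (1 / 2 - 1 / p)) x₀ d a := by
  obtain ⟨hm, x₀, d, hd, hsupp, hnorm, hmom⟩ := ha
  rw [ENNReal.ofReal_ofNat] at hm hnorm
  refine ⟨x₀, d, hd, hm, hsupp, hnorm.trans_eq ?_, ?_⟩
  · rw [volume_closedBall_rpow x₀ hd]
    ring_nf
  · have hfloor : 0 ≤ ⌊(n : ℝ) * (1 / p - 1)⌋ := Int.floor_nonneg.2 <|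
      mul_nonneg n.cast_nonneg (sub_nonneg.2 ((one_le_div hp).2 hp1))
    simpa using hmom 0 (by simpa using hfloor)

namespace IsAtomOn

variable {p d : ℝ} {A : ℝ≥0∞} {x₀ : Rn n} {a : Rn n → ℂ}

theorem eLpNorm_le (ha : IsAtomOn p A x₀ d a) {t : ℝ} (ht : 0 < t) (ht2 : t ≤ 2) :
    eLpNorm a (ENNReal.ofReal t) volume ≤
      volume (closedBall (0 : Rn n) 1) ^ (1 / t - 1 / 2) * A *
        ENNReal.ofReal d ^ (n / t - n / p : ℝ) := by
  have hd : ENNReal.ofReal d ≠ 0 := ENNReal.ofReal_ne_zero_iff.2 ha.radius_pos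
  have hHolder := eLpNorm_le_eLpNorm_mul_rpow_measure_univ (ENNReal.ofReal_le_ofReal ht2)
    (ha.memLp.1.restrict (s := closedBall x₀ d))
  rw [eLpNorm_restrict_eq_of_support_subset ha.support_subset,
    eLpNorm_restrict_eq_of_support_subset ha.support_subset, Measure.restrict_apply_univ,
    ENNReal.toReal_ofReal ht.le, ENNReal.toReal_ofReal zero_le_two, ENNReal.ofReal_ofNat,
    volume_closedBall_rpow x₀ ha.radius_pos] at hHolder
  calc _ ≤ A * ENNReal.ofReal d ^ ((n : ℝ) / 2 - n / p) * (volume (closedBall (0 : Rn n) 1) ^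
        (1 / t - 1 / 2) * ENNReal.ofReal d ^ (n * (1 / t - 1 / 2))) :=
        hHolder.trans (mul_le_mul_left ha.norm_le _)
    _ = volume (closedBall (0 : Rn n) 1) ^ (1 / t - 1 / 2) * A *
        (ENNReal.ofReal d ^ ((n : ℝ) / 2 - n / p) * ENNReal.ofReal d ^ (n * (1 / t - 1 / 2))) := by
        ring
    _ = _ := by
        rw [← ENNReal.rpow_add _ _ hd ENNReal.ofReal_ne_top]
        ring_nf

theorem memLp_of_le_two (ha : IsAtomOn p A x₀ d a) {s : ℝ≥0∞} (hs : s ≤ 2) : MemLp a s volume :=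
  ha.memLp.mono_exponent_of_measure_support_ne_top
    (fun _ hx => Function.notMem_support.1 fun h => hx (ha.support_subset h))
    measure_closedBall_lt_top.ne hs

theorem integrable (ha : IsAtomOn p A x₀ d a) : Integrable a :=
  memLp_one_iff_integrable.1 (ha.memLp_of_le_two one_le_two)

end IsAtomOn

theorem setLIntegral_compl_closedBall_comp_sub (x₀ : Rn n) (ρ : ℝ) (g : Rn n → ℝ≥0∞) :
    ∫⁻ x in (closedBall x₀ ρ)ᶜ, g (x - x₀) = ∫⁻ z in (closedBall 0 ρ)ᶜ, g z := by
  have hpre : (· - x₀) ⁻¹' (closedBall 0 ρ)ᶜ = (closedBall x₀ ρ)ᶜ := by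
    ext x
    simp [dist_eq_norm]
  rw [← hpre]
  exact (measurePreserving_sub_right volume x₀).setLIntegral_comp_preimage_emb
    (Homeomorph.subRight x₀).measurableEmbedding g _

theorem exists_eLpNorm_norm_sub_rpow_compl_le [NeZero n] {s q : ℝ} (hq : 0 < q) (hs : n < s * q) :
    ∃ C : ℝ≥0∞, C ≠ ∞ ∧ ∀ (x₀ : Rn n) (ρ : ℝ), 0 < ρ →
      eLpNorm (fun x => ‖x - x₀‖ₑ ^ (-s)) (ENNReal.ofReal q)
          (volume.restrict (closedBall x₀ ρ)ᶜ) ≤ C * ENNReal.ofReal ρ ^ (n / q - s) := by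
  obtain ⟨C, hC, H⟩ := exists_setLIntegral_compl_norm_rpow_le hs
  refine ⟨C ^ q⁻¹, by finiteness, fun x₀ ρ hρ => ?_⟩
  rw [eLpNorm_ofReal_le_iff hq, ENNReal.mul_rpow_of_nonneg _ _ hq.le,
    ENNReal.rpow_inv_rpow hq.ne', ← ENNReal.rpow_mul, sub_mul, div_mul_cancel₀ _ hq.ne']
  simp only [enorm_eq_self, ← ENNReal.rpow_mul, neg_mul]
  rw [setLIntegral_compl_closedBall_comp_sub x₀ ρ fun z => ‖z‖ₑ ^ (-(s * q))]
  exact H ρ hρ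

theorem eLpNorm_le_of_restrict_le_of_restrict_compl_le {X E : Type*} [MeasurableSpace X]
    {μ : Measure X} [NormedAddCommGroup E] {f : X → E} {S : Set X} (hS : MeasurableSet S) {q : ℝ}
    (hq : 0 < q) {A B M : ℝ≥0∞} (hA : eLpNorm f (ENNReal.ofReal q) (μ.restrict S) ≤ A * M)
    (hB : eLpNorm f (ENNReal.ofReal q) (μ.restrict Sᶜ) ≤ B * M) :
    eLpNorm f (ENNReal.ofReal q) μ ≤ (A ^ q + B ^ q) ^ q⁻¹ * M := by
  rw [eLpNorm_ofReal_le_iff hq] at hA hB ⊢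
  rw [← lintegral_add_compl _ hS]
  refine (add_le_add hA hB).trans_eq ?_
  rw [ENNReal.mul_rpow_of_nonneg _ _ hq.le, ENNReal.mul_rpow_of_nonneg _ _ hq.le,
    ENNReal.mul_rpow_of_nonneg _ _ hq.le, ENNReal.rpow_inv_rpow hq.ne', add_mul]

variable {α β p q r t Q : ℝ} {Ω : Rn n → Rn n → ℂ}

theorem Exponents.div_add_div (h : Exponents n α β p q r t Q) : (n / r + n / t : ℝ) = n := by
  rw [div_eq_mul_inv, div_eq_mul_inv, ← mul_add, h.conj.inv_add_inv_eq_one, mul_one]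

theorem Exponents.exists_eLpNorm_commutator_ball_le [NeZero n] (h : Exponents n α β p q r t Q)
    (hΩ : IsKernel r Ω) :
    ∃ C : ℝ≥0∞, C ≠ ∞ ∧ ∀ b : Rn n → ℂ, lipNorm β b < ∞ →
      ∀ (A : ℝ≥0∞) (x₀ : Rn n) (d : ℝ) (a : Rn n → ℂ), IsAtomOn p A x₀ d a →
      eLpNorm (commutator Ω α b a) (ENNReal.ofReal q) (volume.restrict (ball x₀ (101 * d))) ≤
        C * (lipNorm β b * A) := by
  have ht := h.conj.symm.pos
  have ht2 : 0 ≤ 1 / t - 1 / 2 := sub_nonneg.2 (one_div_le_one_div_of_le ht h.t_lt_two.le)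
  obtain ⟨C, hC, H⟩ :=
    hΩ.exists_eLpNorm_absOp_ball_le_of_le h.conj h.q_pos h.q_le h.t_le h.order_lt
  set e : ℝ := n / r - (n - α - β) + n / q with he
  have hW : volume (closedBall (0 : Rn n) 1) ^ (1 / t - 1 / 2) ≠ ∞ :=
    ENNReal.rpow_ne_top_of_nonneg ht2 measure_closedBall_lt_top.ne
  set W := volume (closedBall (0 : Rn n) 1) ^ (1 / t - 1 / 2)
  refine ⟨C * 101 ^ e * W, by finiteness, fun b hb A x₀ d a ha => ?_⟩
  have hd := ha.radius_pos
  have hd0 : ENNReal.ofReal d ≠ 0 := ENNReal.ofReal_ne_zero_iff.2 hd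
  have hsupp : Function.support a ⊆ ball x₀ (101 * d) :=
    ha.support_subset.trans (closedBall_subset_ball (by linarith))
  have cancel : e + (n / t - n / p) = 0 := by
    rw [he, h.rel]
    linarith [h.div_add_div]
  have habs : AEStronglyMeasurable (absOp Ω (n - α - β) a) (volume.restrict (ball x₀ (101 * d))) :=
    (aemeasurable_absOp hΩ _ ha.memLp.1).aestronglyMeasurable.restrict
  calc eLpNorm (commutator Ω α b a) (ENNReal.ofReal q) (volume.restrict (ball x₀ (101 * d)))
      ≤ lipNorm β b * eLpNorm (absOp Ω (n - α - β) a) (ENNReal.ofReal q)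
          (volume.restrict (ball x₀ (101 * d))) :=
        eLpNorm_le_mul_eLpNorm_of_ae_le_mul'' _ habs
          (.of_forall fun x => enorm_commutator_le Ω α hb a x)
    _ ≤ lipNorm β b * (C * ENNReal.ofReal (101 * d) ^ e *
          (W * A * ENNReal.ofReal d ^ (n / t - n / p : ℝ))) := by
        gcongr
        refine (H x₀ (101 * d) (by positivity) a ha.memLp.1 hsupp).trans ?_
        gcongr
        exact ha.eLpNorm_le ht h.t_lt_two.le
    _ = C * 101 ^ e * W * (lipNorm β b * A) *
          (ENNReal.ofReal d ^ e * ENNReal.ofReal d ^ (n / t - n / p : ℝ)) := by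
        rw [ENNReal.ofReal_mul (by norm_num), ENNReal.mul_rpow_of_ne_zero (by simp) hd0,
          ENNReal.ofReal_ofNat]
        ring
    _ = C * 101 ^ e * W * (lipNorm β b * A) := by
        rw [← ENNReal.rpow_add _ _ hd0 ENNReal.ofReal_ne_top, cancel, ENNReal.rpow_zero, mul_one]

theorem Exponents.exists_eLpNorm_commutator_compl_le [NeZero n] (h : Exponents n α β p q r t Q)
    (hΩ : IsKernel r Ω) (hDini : DiniCondition r β Ω) :
    ∃ C : ℝ≥0∞, C ≠ ∞ ∧ ∀ b : Rn n → ℂ, lipNorm β b < ∞ →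
      ∀ (A : ℝ≥0∞) (x₀ : Rn n) (d : ℝ) (a : Rn n → ℂ), IsAtomOn p A x₀ d a →
      eLpNorm (commutator Ω α b a) (ENNReal.ofReal q)
          (volume.restrict (closedBall x₀ (100 * d))ᶜ) ≤ C * (lipNorm β b * A) := by
  have ht := h.conj.symm.pos
  have ht2 : 0 ≤ 1 / t - 1 / 2 := sub_nonneg.2 (one_div_le_one_div_of_le ht h.t_lt_two.le)
  obtain ⟨C₁, hC₁, H₁⟩ := hΩ.exists_enorm_commutator_le α h.conj h.β_pos h.β_le hDini
  obtain ⟨C₂, hC₂, H₂⟩ := exists_eLpNorm_norm_sub_rpow_compl_le h.q_pos h.decay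
  set e : ℝ := n / q - (n - α - n / r) with he
  have hW : volume (closedBall (0 : Rn n) 1) ^ (1 / t - 1 / 2) ≠ ∞ :=
    ENNReal.rpow_ne_top_of_nonneg ht2 measure_closedBall_lt_top.ne
  set W := volume (closedBall (0 : Rn n) 1) ^ (1 / t - 1 / 2)
  refine ⟨C₁ * W * C₂ * 100 ^ e, by finiteness, fun b hb A x₀ d a ha => ?_⟩
  have hd := ha.radius_pos
  have hd0 : ENNReal.ofReal d ≠ 0 := ENNReal.ofReal_ne_zero_iff.2 hd
  have cancel : β + (n / t - n / p) + e = 0 := by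
    rw [he, h.rel]
    linarith [h.div_add_div]
  have pointwise : ∀ x ∈ (closedBall x₀ (100 * d))ᶜ, ‖commutator Ω α b a x‖ₑ ≤
      C₁ * lipNorm β b * ENNReal.ofReal d ^ β *
        (W * A * ENNReal.ofReal d ^ (n / t - n / p : ℝ)) * ‖‖x - x₀‖ₑ ^ (-(n - α - n / r))‖ₑ := by
    intro x hx
    rw [mem_compl_iff, mem_closedBall, dist_eq_norm, not_le] at hx
    refine (H₁ b hb x₀ d a hd ha.integrable ha.support_subset ha.integral_eq_zero x hx).trans ?_
    rw [enorm_eq_self, mul_right_comm, show α - n + n / r = -(n - α - n / r) by ring]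
    gcongr
    exact ha.eLpNorm_le ht h.t_lt_two.le
  calc eLpNorm (commutator Ω α b a) (ENNReal.ofReal q)
        (volume.restrict (closedBall x₀ (100 * d))ᶜ)
      ≤ C₁ * lipNorm β b * ENNReal.ofReal d ^ β *
          (W * A * ENNReal.ofReal d ^ (n / t - n / p : ℝ)) *
            (C₂ * ENNReal.ofReal (100 * d) ^ e) :=
        (eLpNorm_le_mul_eLpNorm_of_ae_le_mul'' _ (by fun_prop)
          (ae_restrict_of_forall_mem measurableSet_closedBall.compl pointwise)).trans
            (mul_le_mul_right (H₂ x₀ (100 * d) (by positivity)) _)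
    _ = C₁ * W * C₂ * 100 ^ e * (lipNorm β b * A) * (ENNReal.ofReal d ^ β *
          ENNReal.ofReal d ^ (n / t - n / p : ℝ) * ENNReal.ofReal d ^ e) := by
        rw [ENNReal.ofReal_mul (by norm_num), ENNReal.mul_rpow_of_ne_zero (by simp) hd0,
          ENNReal.ofReal_ofNat]
        ring
    _ = C₁ * W * C₂ * 100 ^ e * (lipNorm β b * A) := by
        rw [← ENNReal.rpow_add _ _ hd0 ENNReal.ofReal_ne_top,
          ← ENNReal.rpow_add _ _ hd0 ENNReal.ofReal_ne_top, cancel, ENNReal.rpow_zero, mul_one]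

theorem Exponents.exists_eLpNorm_commutator_le [NeZero n] (h : Exponents n α β p q r t Q)
    (hΩ : IsKernel r Ω) (hDini : DiniCondition r β Ω) :
    ∃ C : ℝ≥0∞, C ≠ ∞ ∧ ∀ b : Rn n → ℂ, lipNorm β b < ∞ →
      ∀ (A : ℝ≥0∞) (x₀ : Rn n) (d : ℝ) (a : Rn n → ℂ), IsAtomOn p A x₀ d a →
      eLpNorm (commutator Ω α b a) (ENNReal.ofReal q) volume ≤ C * (lipNorm β b * A) := by
  have := h.q_pos
  obtain ⟨C₁, hC₁, near⟩ := h.exists_eLpNorm_commutator_ball_le hΩ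
  obtain ⟨C₂, hC₂, far⟩ := h.exists_eLpNorm_commutator_compl_le hΩ hDini
  refine ⟨(C₁ ^ q + C₂ ^ q) ^ q⁻¹, by finiteness, fun b hb A x₀ d a ha => ?_⟩
  have hsub : closedBall x₀ (100 * d) ⊆ ball x₀ (101 * d) :=
    closedBall_subset_ball (by linarith [ha.radius_pos])
  exact eLpNorm_le_of_restrict_le_of_restrict_compl_le measurableSet_closedBall h.q_pos
    ((eLpNorm_mono_measure _ (Measure.restrict_mono hsub le_rfl)).trans (near b hb A x₀ d a ha))
    (far b hb A x₀ d a ha)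

end Atoms

/-! ### Series in `L^q` -/

section Series

variable {X : Type*} [MeasurableSpace X] {μ : Measure X}

theorem rpow_tsum_le_tsum_rpow {ι : Type*} (g : ι → ℝ≥0∞) {p : ℝ} (hp : 0 < p) (hp1 : p ≤ 1) :
    (∑' i, g i) ^ p ≤ ∑' i, g i ^ p := by
  have finite_sum (s : Finset ι) : (∑ i ∈ s, g i) ^ p ≤ ∑' i, g i ^ p :=
    (Finset.le_sum_of_subadditive (· ^ p) (ENNReal.zero_rpow_of_pos hp).le
      (fun a b => ENNReal.rpow_add_le_add_rpow a b hp.le hp1) s g).trans (ENNReal.sum_le_tsum s)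
  exact le_of_tendsto'
    ((ENNReal.continuous_rpow_const.tendsto _).comp ENNReal.summable.hasSum) finite_sum

theorem eLpNorm_tsum_le {g : ℕ → X → ℝ≥0∞} (hg : ∀ j, AEMeasurable (g j) μ) {m : ℝ}
    (hm : 1 ≤ m) :
    eLpNorm (fun x => ∑' j, g j x) (ENNReal.ofReal m) μ ≤
      ∑' j, eLpNorm (g j) (ENNReal.ofReal m) μ := by
  have hm0 : 0 < m := zero_lt_one.trans_le hm
  have partial_sum (N : ℕ) : ∫⁻ x, (∑ j ∈ Finset.range N, g j x) ^ m ∂μ ≤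
      (∑' j, eLpNorm (g j) (ENNReal.ofReal m) μ) ^ m := by
    have minkowski := (eLpNorm_sum_le (s := Finset.range N)
      (fun j _ => (hg j).aestronglyMeasurable) (ENNReal.one_le_ofReal.2 hm)).trans
      (ENNReal.sum_le_tsum (Finset.range N))
    simpa only [enorm_eq_self, Finset.sum_apply] using (eLpNorm_ofReal_le_iff hm0).1 minkowski
  have lim : Tendsto (fun N => ∫⁻ x, (∑ j ∈ Finset.range N, g j x) ^ m ∂μ) atTop
      (𝓝 (∫⁻ x, (∑' j, g j x) ^ m ∂μ)) := by
    refine lintegral_tendsto_of_tendsto_of_monotone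
      (fun N => (Finset.aemeasurable_fun_sum _ fun j _ => hg j).pow_const m)
      (Eventually.of_forall fun x N N' h => ?_) (Eventually.of_forall fun x => ?_)
    · exact ENNReal.rpow_le_rpow (Finset.sum_le_sum_of_subset (Finset.range_mono h)) hm0.le
    · exact (ENNReal.continuous_rpow_const.tendsto _).comp (ENNReal.tendsto_nat_tsum _)
  simpa only [eLpNorm_ofReal_le_iff hm0, enorm_eq_self] using le_of_tendsto' lim partial_sum

variable {p q : ℝ}

theorem eLpNorm_tsum_rpow_le {g : ℕ → X → ℝ≥0∞} (hg : ∀ j, AEMeasurable (g j) μ) (hp : 0 < p)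
    (hp1 : p ≤ 1) (hpq : p ≤ q) :
    eLpNorm (fun x => ∑' j, g j x) (ENNReal.ofReal q) μ ^ p ≤
      ∑' j, eLpNorm (g j) (ENNReal.ofReal q) μ ^ p := by
  have eLpNorm_rpow (u : X → ℝ≥0∞) : eLpNorm u (ENNReal.ofReal q) μ ^ p =
      eLpNorm (fun x => u x ^ p) (ENNReal.ofReal (q / p)) μ := by
    simpa only [enorm_eq_self, ← ENNReal.ofReal_mul' hp.le, div_mul_cancel₀ _ hp.ne'] using
      (eLpNorm_enorm_rpow (p := ENNReal.ofReal (q / p)) (μ := μ) u hp).symm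
  simp only [eLpNorm_rpow]
  refine le_trans ?_ (eLpNorm_tsum_le (fun j => (hg j).pow_const p) ((one_le_div hp).2 hpq))
  exact eLpNorm_mono_enorm fun x => rpow_tsum_le_tsum_rpow _ hp hp1

theorem eLpNorm_rpow_le_tsum {E : Type*} [NormedAddCommGroup E] {u : ℕ → X → E}
    (hu : ∀ j, AEStronglyMeasurable (u j) μ) {S : X → E} (hp : 0 < p) (hp1 : p ≤ 1)
    (hpq : p ≤ q) (hS : ∀ᵐ x ∂μ, ‖S x‖ₑ ≤ ∑' j, ‖u j x‖ₑ) :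
    eLpNorm S (ENNReal.ofReal q) μ ^ p ≤ ∑' j, eLpNorm (u j) (ENNReal.ofReal q) μ ^ p := by
  have h := eLpNorm_tsum_rpow_le (fun j => (hu j).enorm) hp hp1 hpq
  simp only [eLpNorm_enorm] at h
  exact (ENNReal.rpow_le_rpow (eLpNorm_mono_enorm_ae hS) hp.le).trans h

theorem ae_tsum_lt_top {g : ℕ → X → ℝ≥0∞} (hg : ∀ j, AEMeasurable (g j) μ) (hp : 0 < p)
    (hp1 : p ≤ 1) (hpq : p ≤ q) (h : ∑' j, eLpNorm (g j) (ENNReal.ofReal q) μ ^ p < ∞) :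
    ∀ᵐ x ∂μ, ∑' j, g j x < ∞ := by
  have hq : 0 < q := hp.trans_le hpq
  have norm_lt_top : eLpNorm (fun x => ∑' j, g j x) (ENNReal.ofReal q) μ < ∞ :=
    (ENNReal.rpow_lt_top_iff_of_pos hp).1 ((eLpNorm_tsum_rpow_le hg hp hp1 hpq).trans_lt h)
  rw [← ENNReal.rpow_lt_top_iff_of_pos hq, eLpNorm_ofReal_rpow hq] at norm_lt_top
  filter_upwards [ae_lt_top' ((AEMeasurable.tsum hg).pow_const q) norm_lt_top.ne] with x hx
  exact (ENNReal.rpow_lt_top_iff_of_pos hq).1 hx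

variable {𝕜 : Type*} [NormedField 𝕜] {c : ℕ → 𝕜} {D : ℝ≥0∞}

theorem eLpNorm_const_mul_rpow (c : 𝕜) (u : X → 𝕜) (hp : 0 ≤ p) (q : ℝ≥0∞) :
    eLpNorm (fun x => c * u x) q μ ^ p = ‖c‖ₑ ^ p * eLpNorm u q μ ^ p := by
  rw [← ENNReal.mul_rpow_of_nonneg _ _ hp]
  exact congrArg (· ^ p) (eLpNorm_const_smul c u q μ)

theorem eLpNorm_rpow_le_tsum_of_ae_hasSum {u : ℕ → X → 𝕜} {g : X → 𝕜}
    (hu : ∀ j, AEStronglyMeasurable (u j) μ) (hp : 0 < p) (hp1 : p ≤ 1) (hpq : p ≤ q)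
    (hg : ∀ᵐ x ∂μ, HasSum (fun j => c j * u j x) (g x)) :
    eLpNorm g (ENNReal.ofReal q) μ ^ p ≤
      ∑' j, ‖c j‖ₑ ^ p * eLpNorm (u j) (ENNReal.ofReal q) μ ^ p := by
  simp only [← eLpNorm_const_mul_rpow _ _ hp.le]
  refine eLpNorm_rpow_le_tsum (fun j => (hu j).const_mul (c j)) hp hp1 hpq ?_
  filter_upwards [hg] with x hx
  exact hx.tsum_eq ▸ enorm_tsum_le_tsum_enorm

theorem eLpNorm_le_of_ae_hasSum {u : ℕ → X → 𝕜} {g : X → 𝕜}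
    (hu : ∀ j, AEStronglyMeasurable (u j) μ) (hp : 0 < p) (hp1 : p ≤ 1) (hpq : p ≤ q)
    (hD : ∀ j, eLpNorm (u j) (ENNReal.ofReal q) μ ≤ D)
    (hg : ∀ᵐ x ∂μ, HasSum (fun j => c j * u j x) (g x)) :
    eLpNorm g (ENNReal.ofReal q) μ ≤ D * (∑' j, ‖c j‖ₑ ^ p) ^ (1 / p) := by
  refine (ENNReal.rpow_le_rpow_iff hp).1 ?_
  calc eLpNorm g (ENNReal.ofReal q) μ ^ p
      ≤ ∑' j, ‖c j‖ₑ ^ p * eLpNorm (u j) (ENNReal.ofReal q) μ ^ p :=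
        eLpNorm_rpow_le_tsum_of_ae_hasSum hu hp hp1 hpq hg
    _ ≤ ∑' j, ‖c j‖ₑ ^ p * D ^ p := by gcongr with j; exact hD j
    _ = (D * (∑' j, ‖c j‖ₑ ^ p) ^ (1 / p)) ^ p := by
        rw [ENNReal.tsum_mul_right, ENNReal.mul_rpow_of_nonneg _ _ hp.le, ← ENNReal.rpow_mul,
          one_div_mul_cancel hp.ne', ENNReal.rpow_one, mul_comm]

theorem exists_memLp_ae_hasSum [CompleteSpace 𝕜] {u : ℕ → X → 𝕜}
    (hu : ∀ j, AEStronglyMeasurable (u j) μ) (hp : 0 < p) (hp1 : p ≤ 1) (hpq : p ≤ q)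
    (hc : ∑' j, ‖c j‖ₑ ^ p < ∞) (hD : D ≠ ∞)
    (huD : ∀ j, eLpNorm (u j) (ENNReal.ofReal q) μ ≤ D) :
    ∃ g : X → 𝕜, MemLp g (ENNReal.ofReal q) μ ∧
      ∀ᵐ x ∂μ, HasSum (fun j => c j * u j x) (g x) := by
  have terms_meas (j : ℕ) : AEStronglyMeasurable (fun x => c j * u j x) μ := (hu j).const_mul _
  have cost_lt_top : ∑' j, eLpNorm (fun x => ‖c j * u j x‖ₑ) (ENNReal.ofReal q) μ ^ p < ∞ := by
    simp only [eLpNorm_enorm, eLpNorm_const_mul_rpow _ _ hp.le]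
    calc ∑' j, ‖c j‖ₑ ^ p * eLpNorm (u j) (ENNReal.ofReal q) μ ^ p
        ≤ ∑' j, ‖c j‖ₑ ^ p * D ^ p := by gcongr with j; exact huD j
      _ < ∞ := by
        rw [ENNReal.tsum_mul_right]
        exact ENNReal.mul_lt_top hc (ENNReal.rpow_lt_top_of_nonneg hp.le hD)
  have hasSum : ∀ᵐ x ∂μ, HasSum (fun j => c j * u j x) (∑' j, c j * u j x) := by
    filter_upwards [ae_tsum_lt_top (fun j => (terms_meas j).enorm) hp hp1 hpq cost_lt_top]
      with x hx
    refine (Summable.of_norm ?_).hasSum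
    simpa only [toReal_enorm] using ENNReal.summable_toReal hx.ne
  have meas : AEStronglyMeasurable (fun x => ∑' j, c j * u j x) μ :=
    aestronglyMeasurable_of_tendsto_ae atTop
      (fun N => Finset.aestronglyMeasurable_fun_sum (Finset.range N) fun j _ => terms_meas j)
      (hasSum.mono fun x hx => hx.tendsto_sum_nat)
  refine ⟨_, ⟨meas, (eLpNorm_le_of_ae_hasSum hu hp hp1 hpq huD hasSum).trans_lt ?_⟩, hasSum⟩
  exact ENNReal.mul_lt_top hD.lt_top
    (ENNReal.rpow_lt_top_of_nonneg (one_div_nonneg.2 hp.le) hc.ne)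

theorem tendsto_tsum_zero_of_dominated {F : ℕ → ℕ → ℝ≥0∞} {B : ℕ → ℝ≥0∞}
    (hB : ∑' j, B j ≠ ∞) (hF : ∀ k j, F k j ≤ B j)
    (h : ∀ j, Tendsto (fun k => F k j) atTop (𝓝 0)) :
    Tendsto (fun k => ∑' j, F k j) atTop (𝓝 0) := by
  have := tendsto_lintegral_of_dominated_convergence (μ := Measure.count) (F := F) (f := 0) B
    (fun k => measurable_of_countable _) (fun k => Eventually.of_forall (hF k))
    (by rwa [lintegral_count]) (Eventually.of_forall h)
  simpa [lintegral_count] using this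

theorem tendsto_eLpNorm_sub_of_ae_hasSum {u : ℕ → ℕ → X → 𝕜} {v : ℕ → X → 𝕜} {U : ℕ → X → 𝕜}
    {V : X → 𝕜} (hu : ∀ k j, AEStronglyMeasurable (u k j) μ)
    (hv : ∀ j, AEStronglyMeasurable (v j) μ) (hp : 0 < p) (hp1 : p ≤ 1) (hpq : p ≤ q)
    (hc : ∑' j, ‖c j‖ₑ ^ p < ∞) (hD : D ≠ ∞)
    (huD : ∀ k j, eLpNorm (u k j) (ENNReal.ofReal q) μ ≤ D)
    (hvD : ∀ j, eLpNorm (v j) (ENNReal.ofReal q) μ ≤ D)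
    (huv : ∀ j, Tendsto (fun k => eLpNorm (u k j - v j) (ENNReal.ofReal q) μ) atTop (𝓝 0))
    (hU : ∀ k, ∀ᵐ x ∂μ, HasSum (fun j => c j * u k j x) (U k x))
    (hV : ∀ᵐ x ∂μ, HasSum (fun j => c j * v j x) (V x)) :
    Tendsto (fun k => eLpNorm (U k - V) (ENNReal.ofReal q) μ) atTop (𝓝 0) := by
  set K : ℝ≥0∞ := (ENNReal.ofReal q).LpAddConst
  have hK : K ≠ ∞ := (ENNReal.LpAddConst_lt_top _).ne
  have sub_le (k j : ℕ) : eLpNorm (u k j - v j) (ENNReal.ofReal q) μ ≤ K * (D + D) :=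
    (eLpNorm_sub_le' (hu k j) (hv j) _).trans (by gcongr; exacts [huD k j, hvD j])
  have tsum_tendsto : Tendsto (fun k => ∑' j,
      ‖c j‖ₑ ^ p * eLpNorm (u k j - v j) (ENNReal.ofReal q) μ ^ p) atTop (𝓝 0) := by
    refine tendsto_tsum_zero_of_dominated (B := fun j => ‖c j‖ₑ ^ p * (K * (D + D)) ^ p) ?_
      (fun k j => by gcongr; exact sub_le k j) fun j => ?_
    · rw [ENNReal.tsum_mul_right]
      finiteness
    · have := ENNReal.Tendsto.const_mul (a := ‖c j‖ₑ ^ p) ((huv j).ennrpow_const p)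
        (Or.inr (by finiteness))
      rwa [ENNReal.zero_rpow_of_pos hp, mul_zero] at this
  have rpow_tendsto : Tendsto (fun k => eLpNorm (U k - V) (ENNReal.ofReal q) μ ^ p)
      atTop (𝓝 0) := by
    refine tendsto_of_tendsto_of_tendsto_of_le_of_le tendsto_const_nhds tsum_tendsto
      (fun _ => zero_le) fun k => ?_
    refine eLpNorm_rpow_le_tsum_of_ae_hasSum (fun j => (hu k j).sub (hv j)) hp hp1 hpq ?_
    filter_upwards [hU k, hV] with x hUx hVx
    simpa only [Pi.sub_apply, mul_sub] using hUx.sub hVx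
  simpa only [← ENNReal.rpow_mul, mul_one_div_cancel hp.ne', ENNReal.rpow_one,
    ENNReal.zero_rpow_of_pos (one_div_pos.2 hp)] using rpow_tendsto.ennrpow_const (1 / p)

end Series

/-! ### Mollification -/

section Mollification

variable {n : ℕ} {ε : ℝ}

/-- A smooth probability density supported in the unit ball. -/
noncomputable def unitBump (n : ℕ) : Rn n → ℝ :=
  (⟨1 / 2, 1, by norm_num, by norm_num⟩ : ContDiffBump (0 : Rn n)).normed volume

theorem contDiff_unitBump (n : ℕ) {k : ℕ∞} : ContDiff ℝ k (unitBump n) :=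
  ContDiffBump.contDiff_normed _

theorem hasCompactSupport_unitBump (n : ℕ) : HasCompactSupport (unitBump n) :=
  ContDiffBump.hasCompactSupport_normed _

theorem unitBump_eq_zero {x : Rn n} (hx : 1 ≤ ‖x‖) : unitBump n x = 0 := by
  rw [← Function.notMem_support, unitBump, ContDiffBump.support_normed_eq]
  simpa using hx

/-- The dilates `ε⁻ⁿ φ(·/ε)` of the density `φ = unitBump n`, an approximate identity. -/
noncomputable def mollifier (n : ℕ) (ε : ℝ) (x : Rn n) : ℝ := (ε ^ n)⁻¹ * unitBump n (ε⁻¹ • x)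

theorem mollifier_nonneg (hε : 0 < ε) (x : Rn n) : 0 ≤ mollifier n ε x :=
  mul_nonneg (by positivity) (ContDiffBump.nonneg_normed _ _)

theorem contDiff_mollifier (n : ℕ) (ε : ℝ) {k : ℕ∞} : ContDiff ℝ k (mollifier n ε) :=
  contDiff_const.mul ((contDiff_unitBump n).comp (contDiff_const_smul _))

theorem continuous_mollifier (n : ℕ) (ε : ℝ) : Continuous (mollifier n ε) :=
  (contDiff_mollifier n ε (k := 0)).continuous

theorem mollifier_eq_zero (hε : 0 < ε) {x : Rn n} (hx : ε ≤ ‖x‖) : mollifier n ε x = 0 := by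
  rw [mollifier, unitBump_eq_zero, mul_zero]
  rwa [norm_smul, norm_inv, Real.norm_of_nonneg hε.le, inv_mul_eq_div, one_le_div hε]

theorem support_mollifier_subset (hε : 0 < ε) :
    Function.support (mollifier n ε) ⊆ closedBall 0 ε := fun x hx => by
  by_contra h
  rw [mem_closedBall_zero_iff, not_le] at h
  exact hx (mollifier_eq_zero hε h.le)

theorem hasCompactSupport_mollifier (hε : 0 < ε) : HasCompactSupport (mollifier n ε) :=
  HasCompactSupport.of_support_subset_isCompact (isCompact_closedBall 0 ε)
    (support_mollifier_subset hε)

theorem integral_mollifier (hε : 0 < ε) : ∫ x, mollifier n ε x = 1 := by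
  simp only [mollifier]
  rw [integral_const_mul, Measure.integral_comp_inv_smul_of_nonneg _ _ hε.le, unitBump,
    ContDiffBump.integral_normed, finrank_euclideanSpace_fin, smul_eq_mul, mul_one,
    inv_mul_cancel₀ (by positivity)]

theorem integrable_mollifier (hε : 0 < ε) : Integrable (mollifier n ε) :=
  (continuous_mollifier n ε).integrable_of_hasCompactSupport (hasCompactSupport_mollifier hε)

theorem lintegral_mollifier (hε : 0 < ε) : ∫⁻ x, ENNReal.ofReal (mollifier n ε x) = 1 := by
  rw [← ofReal_integral_eq_lintegral_ofReal (integrable_mollifier hε)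
    (Eventually.of_forall (mollifier_nonneg hε)), integral_mollifier hε, ENNReal.ofReal_one]

theorem exists_abs_mollifier_sub_le (n : ℕ) : ∃ K : ℝ, 0 ≤ K ∧ ∀ ε : ℝ, 0 < ε → ∀ x y : Rn n,
    |mollifier n ε x - mollifier n ε y| ≤ K * ε ^ (-(n : ℝ) - 1) * ‖x - y‖ := by
  obtain ⟨K, hK⟩ := (contDiff_unitBump n (k := 1)).lipschitzWith_of_hasCompactSupport
    (hasCompactSupport_unitBump n) (by simp)
  refine ⟨K, K.2, fun ε hε x y => ?_⟩
  have lip := hK.dist_le_mul (ε⁻¹ • x) (ε⁻¹ • y)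
  rw [Real.dist_eq, dist_eq_norm, ← smul_sub, norm_smul, norm_inv, Real.norm_of_nonneg hε.le]
    at lip
  rw [mollifier, mollifier, ← mul_sub, abs_mul, abs_of_pos (by positivity : 0 < (ε ^ n)⁻¹)]
  calc (ε ^ n)⁻¹ * |unitBump n (ε⁻¹ • x) - unitBump n (ε⁻¹ • y)|
      ≤ (ε ^ n)⁻¹ * (K * (ε⁻¹ * ‖x - y‖)) := by gcongr
    _ = K * ε ^ (-(n : ℝ) - 1) * ‖x - y‖ := by
        rw [Real.rpow_sub_one hε.ne', Real.rpow_neg hε.le, Real.rpow_natCast]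
        ring

/-- The mollification of `f` at scale `ε`, that is, its convolution with `mollifier n ε`. -/
noncomputable def mollify (ε : ℝ) (f : Rn n → ℂ) : Rn n → ℂ :=
  convolution (mollifier n ε) f (ContinuousLinearMap.lsmul ℝ ℝ) volume

theorem mollify_apply (ε : ℝ) (f : Rn n → ℂ) (y : Rn n) :
    mollify ε f y = ∫ z, mollifier n ε z • f (y - z) := rfl

theorem mollify_apply_swap (ε : ℝ) (f : Rn n → ℂ) (y : Rn n) :
    mollify ε f y = ∫ z, mollifier n ε (y - z) • f z := by
  rw [mollify_apply, ← integral_sub_left_eq_self _ volume y]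
  simp only [sub_sub_cancel]

theorem continuous_mollify (hε : 0 < ε) {f : Rn n → ℂ} (hf : LocallyIntegrable f) :
    Continuous (mollify ε f) :=
  (hasCompactSupport_mollifier hε).continuous_convolution_left _ (continuous_mollifier n ε) hf

theorem integrable_mollifier_smul (hε : 0 < ε) {f : Rn n → ℂ} (hf : LocallyIntegrable f)
    (y : Rn n) : Integrable fun z => mollifier n ε z • f (y - z) :=
  (hasCompactSupport_mollifier hε).convolutionExists_left
    (ContinuousLinearMap.lsmul ℝ ℝ) (continuous_mollifier n ε) hf y

theorem eLpNorm_integral_mollifier_smul_le (hε : 0 < ε) {ℓ : ℝ} (hℓ : 1 ≤ ℓ)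
    {G : Rn n → Rn n → ℂ}
    (hG : AEStronglyMeasurable (Function.uncurry G) (volume.prod volume)) {η : ℝ≥0∞}
    (hη : ∀ z, ‖z‖ ≤ ε → eLpNorm (G · z) (ENNReal.ofReal ℓ) volume ≤ η) :
    eLpNorm (fun y => ∫ z, mollifier n ε z • G y z) (ENNReal.ofReal ℓ) volume ≤ η := by
  have hℓ0 : 0 < ℓ := zero_lt_one.trans_le hℓ
  have hG' : AEMeasurable (Function.uncurry fun y z => ‖G y z‖ₑ)
      (volume.prod (volume.restrict (closedBall 0 ε))) :=
    hG.enorm.mono_measure (Measure.prod_mono le_rfl Measure.restrict_le_self)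
  have pointwise (y : Rn n) : ‖∫ z, mollifier n ε z • G y z‖ₑ ≤
      ∫⁻ z in closedBall 0 ε, ‖G y z‖ₑ * ENNReal.ofReal (mollifier n ε z) := by
    rw [← setIntegral_eq_integral_of_forall_compl_eq_zero (s := closedBall 0 ε) fun z hz => by
      rw [Function.notMem_support.1 fun h => hz (support_mollifier_subset hε h), zero_smul]]
    refine (enorm_integral_le_lintegral_enorm _).trans_eq (lintegral_congr fun z => ?_)
    rw [enorm_smul, mul_comm, Real.enorm_eq_ofReal (mollifier_nonneg hε z)]
  rw [eLpNorm_ofReal_le_iff hℓ0]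
  calc _ ≤ ∫⁻ y, (∫⁻ z in closedBall 0 ε, ‖G y z‖ₑ * ENNReal.ofReal (mollifier n ε z)) ^ ℓ :=
        lintegral_mono fun y => ENNReal.rpow_le_rpow (pointwise y) hℓ0.le
    _ ≤ η ^ ℓ * (∫⁻ z in closedBall 0 ε, ENNReal.ofReal (mollifier n ε z)) ^ ℓ :=
        lintegral_rpow_lintegral_mul_le hG'
          (continuous_mollifier n ε).measurable.ennreal_ofReal.aemeasurable hℓ
          (ae_restrict_of_forall_mem measurableSet_closedBall fun z hz =>
            (eLpNorm_ofReal_le_iff hℓ0).1 (hη z (mem_closedBall_zero_iff.1 hz)))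
    _ ≤ η ^ ℓ * 1 ^ ℓ := by
        gcongr
        exact (setLIntegral_le_lintegral _ _).trans_eq (lintegral_mollifier hε)
    _ = η ^ ℓ := by rw [ENNReal.one_rpow, mul_one]

theorem aestronglyMeasurable_comp_sub_prod {f : Rn n → ℂ} (hf : AEStronglyMeasurable f volume) :
    AEStronglyMeasurable (fun w : Rn n × Rn n => f (w.1 - w.2)) (volume.prod volume) :=
  hf.comp_quasiMeasurePreserving (quasiMeasurePreserving_sub_of_right_invariant volume volume)

theorem eLpNorm_mollify_le (hε : 0 < ε) {ℓ : ℝ} (hℓ : 1 ≤ ℓ) {f : Rn n → ℂ}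
    (hf : AEStronglyMeasurable f volume) :
    eLpNorm (mollify ε f) (ENNReal.ofReal ℓ) volume ≤ eLpNorm f (ENNReal.ofReal ℓ) volume :=
  eLpNorm_integral_mollifier_smul_le hε hℓ (aestronglyMeasurable_comp_sub_prod hf) fun z _ =>
    (eLpNorm_comp_measurePreserving hf (measurePreserving_sub_right volume z)).le

theorem memLp_mollify (hε : 0 < ε) {ℓ : ℝ} (hℓ : 1 ≤ ℓ) {f : Rn n → ℂ}
    (hf : MemLp f (ENNReal.ofReal ℓ) volume) : MemLp (mollify ε f) (ENNReal.ofReal ℓ) volume :=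
  ⟨(continuous_mollify hε
      (hf.locallyIntegrable (ENNReal.one_le_ofReal.2 hℓ))).aestronglyMeasurable,
    (eLpNorm_mollify_le hε hℓ hf.1).trans_lt hf.2⟩

theorem eLpNorm_mollify_sub_le (hε : 0 < ε) {ℓ : ℝ} (hℓ : 1 ≤ ℓ) {f : Rn n → ℂ}
    (hf : LocallyIntegrable f) {η : ℝ≥0∞}
    (hη : ∀ z, ‖z‖ ≤ ε → eLpNorm (fun y => f (y - z) - f y) (ENNReal.ofReal ℓ) volume ≤ η) :
    eLpNorm (mollify ε f - f) (ENNReal.ofReal ℓ) volume ≤ η := by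
  have hfm := hf.aestronglyMeasurable
  have mollify_sub : mollify ε f - f = fun y => ∫ z, mollifier n ε z • (f (y - z) - f y) := by
    ext y
    simp only [smul_sub]
    rw [integral_sub (integrable_mollifier_smul hε hf y) ((integrable_mollifier hε).smul_const _),
      integral_smul_const, integral_mollifier hε, one_smul, Pi.sub_apply, mollify_apply]
  rw [mollify_sub]
  exact eLpNorm_integral_mollifier_smul_le hε hℓ
    ((aestronglyMeasurable_comp_sub_prod hfm).sub hfm.comp_fst) hη

theorem tendsto_eLpNorm_comp_sub_right_sub {p : ℝ≥0∞} [Fact (1 ≤ p)] [Fact (p ≠ ∞)]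
    {f : Rn n → ℂ} (hf : MemLp f p volume) :
    Tendsto (fun z : Rn n => eLpNorm (fun y => f (y - z) - f y) p volume) (𝓝 0) (𝓝 0) := by
  have translate_continuous : Continuous fun z : Rn n => DomAddAct.mk (-z) +ᵥ hf.toLp f :=
    (DomAddAct.continuous_mk.comp continuous_neg).vadd continuous_const
  have lim := (translate_continuous.edist (continuous_const (y := hf.toLp f))).tendsto (0 : Rn n)
  simp only [neg_zero, DomAddAct.mk_zero, zero_vadd, edist_self] at lim
  refine lim.congr fun z => ?_
  rw [DomAddAct.mk_vadd_toLp, Lp.edist_toLp_toLp]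
  simp only [vadd_eq_add, neg_add_eq_sub]
  rfl

theorem tendsto_eLpNorm_mollify_sub {ℓ : ℝ} (hℓ : 1 ≤ ℓ) {f : Rn n → ℂ}
    (hf : MemLp f (ENNReal.ofReal ℓ) volume) {ε : ℕ → ℝ} (hε : ∀ k, 0 < ε k)
    (hε0 : Tendsto ε atTop (𝓝 0)) :
    Tendsto (fun k => eLpNorm (mollify (ε k) f - f) (ENNReal.ofReal ℓ) volume) atTop (𝓝 0) := by
  have : Fact (1 ≤ ENNReal.ofReal ℓ) := ⟨ENNReal.one_le_ofReal.2 hℓ⟩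
  have : Fact (ENNReal.ofReal ℓ ≠ ∞) := ⟨ENNReal.ofReal_ne_top⟩
  refine ENNReal.tendsto_nhds_zero.2 fun η hη => ?_
  obtain ⟨δ, hδ, small⟩ := Metric.eventually_nhds_iff.1
    (ENNReal.tendsto_nhds_zero.1 (tendsto_eLpNorm_comp_sub_right_sub hf) η hη)
  filter_upwards [hε0.eventually (gt_mem_nhds hδ)] with k hk
  exact eLpNorm_mollify_sub_le (hε k) hℓ (hf.locallyIntegrable (ENNReal.one_le_ofReal.2 hℓ))
    fun z hz => small (by rw [dist_zero_right]; exact hz.trans_lt hk)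

end Mollification

section MollifiedAtoms

open scoped Pointwise

variable {n : ℕ} {p d ε : ℝ} {A : ℝ≥0∞} {x₀ : Rn n} {a : Rn n → ℂ}

theorem volume_closedBall_rpow_ne_top (n : ℕ) (e : ℝ) : volume (closedBall (0 : Rn n) 1) ^ e ≠ ∞ :=
  ENNReal.rpow_ne_top_of_ne_zero (measure_closedBall_pos _ _ one_pos).ne'
    measure_closedBall_lt_top.ne

namespace IsAtomOn

theorem support_mollify_subset (ha : IsAtomOn p A x₀ d a) (hε : 0 < ε) :
    Function.support (mollify ε a) ⊆ closedBall x₀ (2 * max d ε) := by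
  have hsub : Function.support (mollify ε a) ⊆ closedBall (0 : Rn n) ε + closedBall x₀ d :=
    (support_convolution_subset _).trans
      (Set.add_subset_add (support_mollifier_subset hε) ha.support_subset)
  rw [closedBall_add_closedBall hε.le ha.radius_pos.le, zero_add] at hsub
  refine hsub.trans (closedBall_subset_closedBall ?_)
  linarith [le_max_left d ε, le_max_right d ε]

theorem mollify_eq_integral_sub (ha : IsAtomOn p A x₀ d a) (hε : 0 < ε) (y : Rn n) :
    mollify ε a y = ∫ z, (mollifier n ε (y - z) - mollifier n ε (y - x₀)) • a z := by
  have hi : Integrable fun z => mollifier n ε (y - z) • a z := by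
    simpa using (integrable_mollifier_smul hε ha.integrable.locallyIntegrable y).comp_sub_left y
  have hi' : Integrable fun z => mollifier n ε (y - x₀) • a z :=
    ha.integrable.fun_smul _
  simp only [sub_smul]
  rw [integral_sub hi hi', integral_smul,
    ha.integral_eq_zero, smul_zero, sub_zero, mollify_apply_swap]

end IsAtomOn

theorem exists_enorm_mollify_atom_le (n : ℕ) : ∃ K : ℝ≥0∞, K ≠ ∞ ∧
    ∀ (p : ℝ) (A : ℝ≥0∞) (x₀ : Rn n) (d : ℝ) (a : Rn n → ℂ), IsAtomOn p A x₀ d a →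
      ∀ ε : ℝ, 0 < ε → ∀ y, ‖mollify ε a y‖ₑ ≤
        K * A * ENNReal.ofReal ε ^ (-(n : ℝ) - 1) * ENNReal.ofReal d ^ (1 + n - n / p : ℝ) := by
  obtain ⟨K, hK0, hK⟩ := exists_abs_mollifier_sub_le n
  have hW := volume_closedBall_rpow_ne_top n (1 - 2⁻¹)
  set W : ℝ≥0∞ := volume (closedBall (0 : Rn n) 1) ^ (1 - 2⁻¹ : ℝ) with W_def
  refine ⟨ENNReal.ofReal K * W, by finiteness, fun p A x₀ d a ha ε hε y => ?_⟩
  have lintegral_atom_le : ∫⁻ z, ‖a z‖ₑ ≤ W * A * ENNReal.ofReal d ^ (n - n / p : ℝ) := by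
    simpa [W_def, eLpNorm_one_eq_lintegral_enorm] using ha.eLpNorm_le one_pos one_le_two
  have kernel_le (z : Rn n) (hz : z ∈ closedBall x₀ d) :
      ‖mollifier n ε (y - z) - mollifier n ε (y - x₀)‖ₑ ≤
        ENNReal.ofReal (K * ε ^ (-(n : ℝ) - 1) * d) := by
    rw [← ofReal_norm, Real.norm_eq_abs]
    refine ENNReal.ofReal_le_ofReal ((hK ε hε _ _).trans ?_)
    rw [sub_sub_sub_cancel_left, norm_sub_rev, ← dist_eq_norm]
    gcongr
    exact hz
  calc ‖mollify ε a y‖ₑ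
      ≤ ∫⁻ z, ‖(mollifier n ε (y - z) - mollifier n ε (y - x₀)) • a z‖ₑ := by
        rw [ha.mollify_eq_integral_sub hε]
        exact enorm_integral_le_lintegral_enorm _
    _ ≤ ∫⁻ z, ENNReal.ofReal (K * ε ^ (-(n : ℝ) - 1) * d) * ‖a z‖ₑ := by
        refine lintegral_mono fun z => ?_
        by_cases hz : a z = 0
        · simp [hz]
        · rw [enorm_smul]
          gcongr
          exact kernel_le z (ha.support_subset hz)
    _ ≤ ENNReal.ofReal (K * ε ^ (-(n : ℝ) - 1) * d) *
          (W * A * ENNReal.ofReal d ^ (n - n / p : ℝ)) := by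
        rw [lintegral_const_mul' _ _ ENNReal.ofReal_ne_top]
        gcongr
    _ = ENNReal.ofReal K * W * A * ENNReal.ofReal ε ^ (-(n : ℝ) - 1) *
          (ENNReal.ofReal d ^ (1 : ℝ) * ENNReal.ofReal d ^ (n - n / p : ℝ)) := by
        rw [ENNReal.ofReal_mul (by positivity), ENNReal.ofReal_mul hK0,
          ENNReal.ofReal_rpow_of_pos hε, ENNReal.rpow_one]
        ring
    _ = _ := by
        rw [← ENNReal.rpow_add _ _ (ENNReal.ofReal_ne_zero_iff.2 ha.radius_pos)
          ENNReal.ofReal_ne_top, add_sub_assoc]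

theorem exists_eLpNorm_mollify_atom_le_of_lt (hsm : (n : ℝ) / p < n + 1) :
    ∃ C : ℝ≥0∞, C ≠ ∞ ∧ ∀ (A : ℝ≥0∞) (x₀ : Rn n) (d : ℝ) (a : Rn n → ℂ), IsAtomOn p A x₀ d a →
      ∀ ε : ℝ, d < ε → eLpNorm (mollify ε a) 2 volume ≤
        C * A * ENNReal.ofReal (2 * ε) ^ ((n : ℝ) / 2 - n / p) := by
  obtain ⟨K, hK, H⟩ := exists_enorm_mollify_atom_le n
  have hV := volume_closedBall_rpow_ne_top n (1 / 2)
  set V : ℝ≥0∞ := volume (closedBall (0 : Rn n) 1) ^ (1 / 2 : ℝ) with V_def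
  refine ⟨K * V * 2 ^ (n / p : ℝ), by finiteness, fun A x₀ d a ha ε hdε => ?_⟩
  have hε : 0 < ε := ha.radius_pos.trans hdε
  have hε0 : ENNReal.ofReal ε ≠ 0 := ENNReal.ofReal_ne_zero_iff.2 hε
  have hsupp := ha.support_mollify_subset hε
  rw [max_eq_right hdε.le] at hsupp
  have pointwise (y : Rn n) :
      ‖mollify ε a y‖ₑ ≤ K * A * ENNReal.ofReal ε ^ (-(n / p) : ℝ) := by
    calc ‖mollify ε a y‖ₑ ≤ K * A * ENNReal.ofReal ε ^ (-(n : ℝ) - 1) *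
          ENNReal.ofReal ε ^ (1 + n - n / p : ℝ) := by
          refine (H p A x₀ d a ha ε hε y).trans ?_
          gcongr
          linarith
      _ = _ := by
          rw [mul_assoc, ← ENNReal.rpow_add _ _ hε0 ENNReal.ofReal_ne_top]
          ring_nf
  have scale : ENNReal.ofReal ε ^ (-(n / p) : ℝ) =
      2 ^ (n / p : ℝ) * ENNReal.ofReal (2 * ε) ^ (-(n / p) : ℝ) := by
    rw [ENNReal.ofReal_mul zero_le_two, ENNReal.ofReal_ofNat,
      ENNReal.mul_rpow_of_ne_zero two_ne_zero hε0, ← mul_assoc,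
      ← ENNReal.rpow_add _ _ two_ne_zero ENNReal.ofNat_ne_top, add_neg_cancel,
      ENNReal.rpow_zero, one_mul]
  rw [← eLpNorm_restrict_eq_of_support_subset hsupp]
  calc _ ≤ K * A * ENNReal.ofReal ε ^ (-(n / p) : ℝ) *
        volume (closedBall x₀ (2 * ε)) ^ (1 / 2 : ℝ) := by
        simpa using eLpNorm_le_of_ae_enorm_bound (p := 2)
          (μ := volume.restrict (closedBall x₀ (2 * ε))) (Eventually.of_forall pointwise)
    _ = K * V * 2 ^ (n / p : ℝ) * A * (ENNReal.ofReal (2 * ε) ^ (n * (1 / 2) : ℝ) *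
          ENNReal.ofReal (2 * ε) ^ (-(n / p) : ℝ)) := by
        rw [volume_closedBall_rpow x₀ (by positivity), scale, V_def]
        ring
    _ = _ := by
        rw [← ENNReal.rpow_add _ _ (ENNReal.ofReal_ne_zero_iff.2 (by positivity))
          ENNReal.ofReal_ne_top]
        ring_nf

theorem IsAtomOn.eLpNorm_mollify_le_of_le (ha : IsAtomOn p A x₀ d a) (hε : 0 < ε) :
    eLpNorm (mollify ε a) 2 volume ≤
      2 ^ (n / p - n / 2 : ℝ) * A * ENNReal.ofReal (2 * d) ^ ((n : ℝ) / 2 - n / p) := by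
  have contraction := eLpNorm_mollify_le hε one_le_two ha.memLp.1
  rw [ENNReal.ofReal_ofNat] at contraction
  calc eLpNorm (mollify ε a) 2 volume
      ≤ A * ENNReal.ofReal d ^ ((n : ℝ) / 2 - n / p) := contraction.trans ha.norm_le
    _ = (2 ^ (n / p - n / 2 : ℝ) * 2 ^ ((n : ℝ) / 2 - n / p)) * A *
          ENNReal.ofReal d ^ ((n : ℝ) / 2 - n / p) := by
        rw [← ENNReal.rpow_add _ _ two_ne_zero ENNReal.ofNat_ne_top, sub_add_sub_cancel, sub_self,
          ENNReal.rpow_zero, one_mul]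
    _ = _ := by
        rw [ENNReal.ofReal_mul zero_le_two, ENNReal.ofReal_ofNat,
          ENNReal.mul_rpow_of_ne_zero two_ne_zero (ENNReal.ofReal_ne_zero_iff.2 ha.radius_pos)]
        ring

theorem exists_isAtomOn_mollify (hsm : (n : ℝ) / p < n + 1) :
    ∃ C : ℝ≥0∞, C ≠ ∞ ∧ ∀ (A : ℝ≥0∞) (x₀ : Rn n) (d : ℝ) (a : Rn n → ℂ), IsAtomOn p A x₀ d a →
      ∀ ε : ℝ, 0 < ε → IsAtomOn p (C * A) x₀ (2 * max d ε) (mollify ε a) := by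
  obtain ⟨C, hC, H⟩ := exists_eLpNorm_mollify_atom_le_of_lt hsm
  refine ⟨2 ^ (n / p - n / 2 : ℝ) + C, by finiteness, fun A x₀ d a ha ε hε => ?_⟩
  have hd := ha.radius_pos
  have mean_zero : ∫ x, mollify ε a x = 0 := by
    have := integral_convolution (ContinuousLinearMap.lsmul ℝ ℝ) (integrable_mollifier (n := n) hε)
      ha.integrable
    rwa [ha.integral_eq_zero, map_zero] at this
  have hmem : MemLp (mollify ε a) 2 volume := by
    simpa using memLp_mollify hε one_le_two (by simpa using ha.memLp)
  refine ⟨by positivity, hmem, ha.support_mollify_subset hε, ?_, mean_zero⟩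
  rcases le_or_gt ε d with hεd | hdε
  · rw [max_eq_left hεd]
    refine (ha.eLpNorm_mollify_le_of_le hε).trans ?_
    gcongr
    exact le_self_add
  · rw [max_eq_right hdε.le]
    refine (H A x₀ d a ha ε hdε).trans ?_
    gcongr
    exact le_add_self

theorem exists_schwartz_mollifier (hε : 0 < ε) (y : Rn n) :
    ∃ φ : 𝓢(Rn n, ℂ), ∀ f : Rn n → ℂ, ∫ x, f x * φ x = mollify ε f y := by
  have hc : HasCompactSupport fun z : Rn n => ((mollifier n ε (y - z) : ℝ) : ℂ) := by
    refine HasCompactSupport.intro (isCompact_closedBall y ε) fun z hz => ?_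
    rw [mem_closedBall', dist_eq_norm, not_le] at hz
    rw [mollifier_eq_zero hε hz.le, Complex.ofReal_zero]
  have hs : ContDiff ℝ ((⊤ : ℕ∞) : WithTop ℕ∞)
      fun z : Rn n => ((mollifier n ε (y - z) : ℝ) : ℂ) :=
    Complex.ofRealCLM.contDiff.comp
      ((contDiff_mollifier n ε).comp (contDiff_const.sub contDiff_id))
  refine ⟨hc.toSchwartzMap hs, fun f => ?_⟩
  rw [mollify_apply_swap]
  exact integral_congr_ae (Eventually.of_forall fun z => by simp [mul_comm])

end MollifiedAtoms

/-! ### The commutator on `L^ℓ` -/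

section CommutatorLp

variable {n : ℕ} {α β p q r t Q ℓ : ℝ} {Ω : Rn n → Rn n → ℂ} {b : Rn n → ℂ}

/-- The exponents `ℓ` for which `f ↦ absOp Ω s f` is locally bounded on `L^ℓ`; the last condition
makes the tail `‖z‖ ^ (-s)` of the kernel an `L^ℓ'` function, `ℓ'` the conjugate exponent. -/
structure Admissible (n : ℕ) (t s ℓ : ℝ) : Prop where
  one_lt : 1 < ℓ
  le : t ≤ ℓ
  lt : n < s * ℓ.conjExponent

theorem ae_of_forall_ball {P : Rn n → Prop}
    (h : ∀ R : ℝ, 0 < R → ∀ᵐ x ∂volume.restrict (ball (0 : Rn n) R), P x) : ∀ᵐ x, P x := by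
  have := (ae_restrict_iUnion_iff (μ := (volume : Measure (Rn n)))
    (fun k : ℕ => ball (0 : Rn n) (k + 1)) P).2 fun k => h _ (by positivity)
  rwa [iUnion_ball_nat_succ, Measure.restrict_univ] at this

section Measurability

variable (hΩ : IsKernel r Ω) (hβ : 0 < β) (hb : lipNorm β b < ∞) {f : Rn n → ℂ}
include hΩ hβ hb

theorem measurable_commutatorKernel (α : ℝ) : Measurable fun w : Rn n × Rn n =>
    Ω w.1 (w.1 - w.2) / ((‖w.1 - w.2‖ ^ ((n : ℝ) - α) : ℝ) : ℂ) * (b w.1 - b w.2) := by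
  have hb' := (continuous_of_lipNorm_lt_top hβ hb).measurable
  exact (hΩ.measurable_sub.div (Complex.measurable_ofReal.comp (by fun_prop))).mul
    ((hb'.comp measurable_fst).sub (hb'.comp measurable_snd))

theorem aestronglyMeasurable_commutator (α : ℝ) (hf : AEStronglyMeasurable f volume) :
    AEStronglyMeasurable (commutator Ω α b f) volume :=
  ((measurable_commutatorKernel hΩ hβ hb α).aestronglyMeasurable.mul
    hf.comp_snd).integral_prod_right'

theorem integrable_commutatorIntegrand (hf : AEStronglyMeasurable f volume) {x : Rn n}
    (hx : absOp Ω (n - α - β) f x < ∞) : Integrable (commutatorIntegrand Ω α b f x) := by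
  have hK : Measurable fun y => Ω x (x - y) / ((‖x - y‖ ^ ((n : ℝ) - α) : ℝ) : ℂ) * (b x - b y) :=
    (measurable_commutatorKernel hΩ hβ hb α).comp measurable_prodMk_left
  refine ⟨hK.aestronglyMeasurable.mul hf, ?_⟩
  refine (lintegral_mono fun y => enorm_commutatorIntegrand_le Ω α β b f x y).trans_lt ?_
  rw [lintegral_const_mul' _ _ hb.ne]
  exact ENNReal.mul_lt_top hb hx

end Measurability

theorem commutator_sub {f g : Rn n → ℂ} {x : Rn n} (hf : Integrable (commutatorIntegrand Ω α b f x))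
    (hg : Integrable (commutatorIntegrand Ω α b g x)) :
    commutator Ω α b (f - g) x = commutator Ω α b f x - commutator Ω α b g x := by
  rw [commutator, commutator, commutator, ← integral_sub hf hg]
  simp only [commutatorIntegrand, Pi.sub_apply, mul_sub]

theorem hasSum_commutator {c : ℕ → ℂ} {g : ℕ → Rn n → ℂ} {f : Rn n → ℂ} {x : Rn n}
    (hb : lipNorm β b < ∞) (hg : ∀ j, Integrable (commutatorIntegrand Ω α b (g j) x))
    (hsum : ∑' j, ‖c j‖ₑ * absOp Ω (n - α - β) (g j) x < ∞)
    (hf : ∀ y, HasSum (fun j => c j * g j y) (f y)) :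
    HasSum (fun j => c j * commutator Ω α b (g j) x) (commutator Ω α b f x) := by
  have lintegral_ne_top : ∑' j, ∫⁻ y, ‖c j * commutatorIntegrand Ω α b (g j) x y‖ₑ ≠ ∞ := by
    refine ne_top_of_le_ne_top (ENNReal.mul_ne_top hb.ne hsum.ne) ?_
    rw [← ENNReal.tsum_mul_left]
    refine ENNReal.tsum_le_tsum fun j => ?_
    simp only [enorm_mul]
    rw [lintegral_const_mul' _ _ enorm_ne_top, mul_left_comm]
    gcongr
    rw [absOp, ← lintegral_const_mul' _ _ hb.ne]
    exact lintegral_mono fun y => enorm_commutatorIntegrand_le Ω α β b _ x y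
  have integrable (j : ℕ) : Integrable fun y => c j * commutatorIntegrand Ω α b (g j) x y :=
    (hg j).const_mul _
  have summable : Summable fun j => ∫ y, ‖c j * commutatorIntegrand Ω α b (g j) x y‖ :=
    (ENNReal.summable_toReal lintegral_ne_top).congr fun j =>
      (integral_norm_eq_lintegral_enorm (integrable j).1).symm
  have pointwise (y : Rn n) : ∑' j, c j * commutatorIntegrand Ω α b (g j) x y =
      commutatorIntegrand Ω α b f x y := by
    simp only [commutatorIntegrand]
    rw [← ((hf y).mul_left _).tsum_eq]
    exact tsum_congr fun j => by ring
  have hasSum_integral := hasSum_integral_of_summable_integral_norm integrable summable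
  simp only [pointwise, integral_const_mul] at hasSum_integral
  exact hasSum_integral

namespace Exponents

variable [NeZero n] (h : Exponents n α β p q r t Q) (hΩ : IsKernel r Ω)
  (hℓ : Admissible n t (n - α - β) ℓ)
include h hΩ hℓ

theorem exists_eLpNorm_absOp_ball_le {R : ℝ} (hR : 0 < R) :
    ∃ C : ℝ≥0∞, C ≠ ∞ ∧ ∀ f : Rn n → ℂ, AEStronglyMeasurable f volume →
      eLpNorm (absOp Ω (n - α - β) f) (ENNReal.ofReal q) (volume.restrict (ball 0 R)) ≤
        C * eLpNorm f (ENNReal.ofReal ℓ) volume :=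
  hΩ.exists_eLpNorm_absOp_ball_zero_le h.conj h.q_pos h.q_le h.t_le h.order_lt
    (Real.HolderConjugate.conjExponent hℓ.one_lt).symm hℓ.le hℓ.lt hR

theorem ae_tsum_absOp_lt_top {c : ℕ → ℂ} (hc : ∑' j, ‖c j‖ₑ ^ p < ∞) {g : ℕ → Rn n → ℂ}
    {M : ℝ≥0∞} (hM : M ≠ ∞) (hg : ∀ j, AEStronglyMeasurable (g j) volume)
    (hgM : ∀ j, eLpNorm (g j) (ENNReal.ofReal ℓ) volume ≤ M) :
    ∀ᵐ x, ∑' j, ‖c j‖ₑ * absOp Ω (n - α - β) (g j) x < ∞ := by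
  refine ae_of_forall_ball fun R hR => ?_
  obtain ⟨C, hC, H⟩ := h.exists_eLpNorm_absOp_ball_le hΩ hℓ hR
  refine ae_tsum_lt_top (fun j => (aemeasurable_absOp hΩ _ (hg j)).restrict.const_mul _)
    h.p_pos h.p_le_one h.p_le_q ?_
  calc _ ≤ ∑' j, ‖c j‖ₑ ^ p * (C * M) ^ p := by
        refine ENNReal.tsum_le_tsum fun j => ?_
        rw [← ENNReal.mul_rpow_of_nonneg _ _ h.p_pos.le]
        refine ENNReal.rpow_le_rpow ?_ h.p_pos.le
        refine (eLpNorm_le_mul_eLpNorm_of_ae_le_mul'' _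
          (aemeasurable_absOp hΩ _ (hg j)).restrict.aestronglyMeasurable
          (Eventually.of_forall fun _ => le_rfl)).trans ?_
        gcongr
        exact (H _ (hg j)).trans (by gcongr; exact hgM j)
    _ = (∑' j, ‖c j‖ₑ ^ p) * (C * M) ^ p := ENNReal.tsum_mul_right
    _ < ∞ := ENNReal.mul_lt_top hc (ENNReal.rpow_lt_top_of_nonneg h.p_pos.le
        (ENNReal.mul_ne_top hC hM))

theorem ae_absOp_lt_top {f : Rn n → ℂ} (hf : MemLp f (ENNReal.ofReal ℓ) volume) :
    ∀ᵐ x, absOp Ω (n - α - β) f x < ∞ := by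
  refine ae_of_forall_ball fun R hR => ?_
  obtain ⟨C, hC, H⟩ := h.exists_eLpNorm_absOp_ball_le hΩ hℓ hR
  have hlt := (H f hf.1).trans_lt (ENNReal.mul_lt_top hC.lt_top hf.2)
  have hfin := lintegral_rpow_enorm_lt_top_of_eLpNorm_lt_top (by simpa using h.q_pos)
    ENNReal.ofReal_ne_top hlt
  rw [ENNReal.toReal_ofReal h.q_pos.le] at hfin
  filter_upwards [ae_lt_top' ((aemeasurable_absOp hΩ _ hf.1).restrict.pow_const q) hfin.ne]
    with x hx
  exact (ENNReal.rpow_lt_top_iff_of_pos h.q_pos).1 hx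

variable (hb : lipNorm β b < ∞)
include hb

theorem ae_integrable_commutatorIntegrand {f : Rn n → ℂ}
    (hf : MemLp f (ENNReal.ofReal ℓ) volume) :
    ∀ᵐ x, Integrable (commutatorIntegrand Ω α b f x) := by
  filter_upwards [h.ae_absOp_lt_top hΩ hℓ hf] with x hx
  exact integrable_commutatorIntegrand hΩ h.β_pos hb hf.1 hx

theorem exists_eLpNorm_commutator_sub_le {R : ℝ} (hR : 0 < R) :
    ∃ C : ℝ≥0∞, C ≠ ∞ ∧ ∀ f g : Rn n → ℂ, MemLp f (ENNReal.ofReal ℓ) volume →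
      MemLp g (ENNReal.ofReal ℓ) volume →
      eLpNorm (commutator Ω α b f - commutator Ω α b g) (ENNReal.ofReal q)
        (volume.restrict (ball 0 R)) ≤ C * eLpNorm (f - g) (ENNReal.ofReal ℓ) volume := by
  obtain ⟨C, hC, H⟩ := h.exists_eLpNorm_absOp_ball_le hΩ hℓ hR
  refine ⟨lipNorm β b * C, ENNReal.mul_ne_top hb.ne hC, fun f g hf hg => ?_⟩
  have hmeas := (aemeasurable_absOp hΩ (n - α - β) (hf.1.sub hg.1)).restrict (s := ball 0 R)
  rw [mul_assoc]
  refine le_trans (eLpNorm_le_mul_eLpNorm_of_ae_le_mul'' _ hmeas.aestronglyMeasurable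
    (ae_restrict_of_ae ?_)) (mul_le_mul_right (H _ (hf.1.sub hg.1)) _)
  filter_upwards [h.ae_integrable_commutatorIntegrand hΩ hℓ hb hf,
    h.ae_integrable_commutatorIntegrand hΩ hℓ hb hg] with x hfx hgx
  rw [Pi.sub_apply, ← commutator_sub hfx hgx, enorm_eq_self]
  exact enorm_commutator_le Ω α hb _ x

theorem tendsto_commutator_mollify {R : ℝ} (hR : 0 < R) {f : Rn n → ℂ}
    (hf : MemLp f (ENNReal.ofReal ℓ) volume) {ε : ℕ → ℝ} (hε : ∀ k, 0 < ε k)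
    (hε0 : Tendsto ε atTop (𝓝 0)) :
    Tendsto (fun k => eLpNorm (commutator Ω α b (mollify (ε k) f) - commutator Ω α b f)
      (ENNReal.ofReal q) (volume.restrict (ball 0 R))) atTop (𝓝 0) := by
  obtain ⟨C, hC, H⟩ := h.exists_eLpNorm_commutator_sub_le hΩ hℓ hb hR
  have hℓ1 := hℓ.one_lt.le
  have hlim := ENNReal.Tendsto.const_mul (tendsto_eLpNorm_mollify_sub hℓ1 hf hε hε0)
    (Or.inr hC)
  rw [mul_zero] at hlim
  exact tendsto_of_tendsto_of_tendsto_of_le_of_le tendsto_const_nhds hlim (fun _ => zero_le)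
    fun k => H _ _ (memLp_mollify (hε k) hℓ1 hf) hf

theorem ae_hasSum_commutator {c : ℕ → ℂ} (hc : ∑' j, ‖c j‖ₑ ^ p < ∞) {g : ℕ → Rn n → ℂ}
    {f : Rn n → ℂ} {M : ℝ≥0∞} (hM : M ≠ ∞) (hg : ∀ j, AEStronglyMeasurable (g j) volume)
    (hgM : ∀ j, eLpNorm (g j) (ENNReal.ofReal ℓ) volume ≤ M)
    (hf : ∀ y, HasSum (fun j => c j * g j y) (f y)) :
    ∀ᵐ x, HasSum (fun j => c j * commutator Ω α b (g j) x) (commutator Ω α b f x) := by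
  have hint : ∀ᵐ x, ∀ j, Integrable (commutatorIntegrand Ω α b (g j) x) :=
    ae_all_iff.2 fun j =>
      h.ae_integrable_commutatorIntegrand hΩ hℓ hb ⟨hg j, (hgM j).trans_lt hM.lt_top⟩
  filter_upwards [hint, h.ae_tsum_absOp_lt_top hΩ hℓ hc hM hg hgM] with x hx hsum
  exact hasSum_commutator hb hx hsum hf

end Exponents

end CommutatorLp

/-! ### Atomic decompositions of functions -/

section AtomicDecomposition

variable {n : ℕ} {α β p q r t Q ℓ₀ ℓ : ℝ} {Ω : Rn n → Rn n → ℂ} {b f : Rn n → ℂ}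
  {F : 𝓢'(Rn n, ℂ)} {c : ℕ → ℂ} {a : ℕ → Rn n → ℂ}

theorem exists_eLpNorm_mollify_atom_le (hp : 0 < p) (hp1 : p ≤ 1) (hsm : (n : ℝ) / p < n + 1)
    (hℓ : 1 < ℓ) (hℓ2 : ℓ ≤ 2) {ε : ℝ} (hε : 0 < ε) :
    ∃ M : ℝ≥0∞, M ≠ ∞ ∧ ∀ a : Rn n → ℂ, IsAtom p 2 a →
      eLpNorm (mollify ε a) (ENNReal.ofReal ℓ) volume ≤ M := by
  obtain ⟨C, hC, H⟩ := exists_isAtomOn_mollify hsm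
  have hℓ0 : 0 < ℓ := zero_lt_one.trans hℓ
  have := volume_closedBall_rpow_ne_top n (1 / ℓ - 1 / 2)
  have := volume_closedBall_rpow_ne_top n (1 / 2 - 1 / p)
  refine ⟨volume (closedBall (0 : Rn n) 1) ^ (1 / ℓ - 1 / 2) *
    (C * volume (closedBall (0 : Rn n) 1) ^ (1 / 2 - 1 / p)) *
    ENNReal.ofReal ε ^ (n / ℓ - n / p : ℝ), by finiteness [(ENNReal.ofReal_pos.2 hε).ne'], ?_⟩
  intro a ha
  obtain ⟨x₀, d, had⟩ := ha.exists_isAtomOn hp hp1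
  refine ((H _ x₀ d a had ε hε).eLpNorm_le hℓ0 hℓ2).trans (mul_le_mul_right ?_ _)
  have exponent_nonneg : 0 ≤ (n : ℝ) / p - n / ℓ :=
    sub_nonneg.2 (div_le_div_of_nonneg_left n.cast_nonneg hp (hp1.trans hℓ.le))
  rw [← neg_sub, ENNReal.rpow_neg, ENNReal.rpow_neg, ENNReal.inv_le_inv]
  gcongr
  linarith [le_max_right d ε]

theorem IsAtomicDecomposition.hasSum_mollify (hF : IsAtomicDecomposition p F c a)
    (hFf : ∀ φ : 𝓢(Rn n, ℂ), F φ = ∫ x, f x * φ x) {ε : ℝ} (hε : 0 < ε) (y : Rn n) :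
    HasSum (fun j => c j * mollify ε (a j) y) (mollify ε f y) := by
  obtain ⟨φ, hφ⟩ := exists_schwartz_mollifier hε y
  simpa only [hFf, hφ] using hF.hasSum φ

namespace Exponents

variable [NeZero n] (h : Exponents n α β p q r t Q) (hΩ : IsKernel r Ω)
include h hΩ

theorem exists_eLpNorm_commutator_atom_le (hDini : DiniCondition r β Ω) :
    ∃ C : ℝ≥0∞, C ≠ ∞ ∧ ∀ b : Rn n → ℂ, lipNorm β b < ∞ → ∀ a : Rn n → ℂ, IsAtom p 2 a →
      eLpNorm (commutator Ω α b a) (ENNReal.ofReal q) volume ≤ C * lipNorm β b ∧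
      ∀ ε : ℝ, 0 < ε →
        eLpNorm (commutator Ω α b (mollify ε a)) (ENNReal.ofReal q) volume ≤ C * lipNorm β b := by
  obtain ⟨C₁, hC₁, commutator_le⟩ := h.exists_eLpNorm_commutator_le hΩ hDini
  obtain ⟨C₂, hC₂, mollify_atom⟩ := exists_isAtomOn_mollify h.smooth
  have := volume_closedBall_rpow_ne_top n (1 / 2 - 1 / p)
  set A : ℝ≥0∞ := volume (closedBall (0 : Rn n) 1) ^ (1 / 2 - 1 / p)
  refine ⟨C₁ * (A + C₂ * A), by finiteness, fun b hb a ha => ?_⟩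
  obtain ⟨x₀, d, had⟩ := ha.exists_isAtomOn h.p_pos h.p_le_one
  have factor : C₁ * (A + C₂ * A) * lipNorm β b =
      C₁ * (lipNorm β b * A) + C₁ * (lipNorm β b * (C₂ * A)) := by ring
  rw [factor]
  exact ⟨(commutator_le b hb _ _ _ _ had).trans le_self_add, fun ε hε =>
    (commutator_le b hb _ _ _ _ (mollify_atom _ _ _ _ had ε hε)).trans le_add_self⟩

theorem ae_hasSum_commutator_mollify (hℓ₀ : Admissible n t (n - α - β) ℓ₀) (hℓ₀2 : ℓ₀ ≤ 2)
    (hb : lipNorm β b < ∞) (hF : IsAtomicDecomposition p F c a)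
    (hFf : ∀ φ : 𝓢(Rn n, ℂ), F φ = ∫ x, f x * φ x) {ε : ℝ} (hε : 0 < ε) :
    ∀ᵐ x, HasSum (fun j => c j * commutator Ω α b (mollify ε (a j)) x)
      (commutator Ω α b (mollify ε f) x) := by
  obtain ⟨M, hM, mollify_le⟩ :=
    exists_eLpNorm_mollify_atom_le h.p_pos h.p_le_one h.smooth hℓ₀.one_lt hℓ₀2 hε
  refine h.ae_hasSum_commutator hΩ hℓ₀ hb hF.cost_lt_top hM (fun j => ?_)
    (fun j => mollify_le _ (hF.isAtom j)) (hF.hasSum_mollify hFf hε)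
  have aj_memLp : MemLp (a j) (ENNReal.ofReal 2) volume := (hF.isAtom j).1
  exact (memLp_mollify hε one_le_two aj_memLp).1

theorem ae_hasSum_commutator_of_isAtomicDecomposition (hDini : DiniCondition r β Ω)
    (hℓ₀ : Admissible n t (n - α - β) ℓ₀) (hℓ₀2 : ℓ₀ ≤ 2) (hb : lipNorm β b < ∞)
    (hF : IsAtomicDecomposition p F c a) (hℓ : Admissible n t (n - α - β) ℓ)
    (hf : MemLp f (ENNReal.ofReal ℓ) volume) (hFf : ∀ φ : 𝓢(Rn n, ℂ), F φ = ∫ x, f x * φ x) :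
    ∀ᵐ x, HasSum (fun j => c j * commutator Ω α b (a j) x) (commutator Ω α b f x) := by
  obtain ⟨C, hC, atom_le⟩ := h.exists_eLpNorm_commutator_atom_le hΩ hDini
  set T : (Rn n → ℂ) → Rn n → ℂ := commutator Ω α b
  have hD : C * lipNorm β b ≠ ∞ := by finiteness
  have aj_memLp (j : ℕ) : MemLp (a j) (ENNReal.ofReal 2) volume := (hF.isAtom j).1
  have T_meas {g : Rn n → ℂ} {s : ℝ≥0∞} (hg : MemLp g s volume) :
      AEStronglyMeasurable (T g) volume :=
    aestronglyMeasurable_commutator hΩ h.β_pos hb α hg.1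
  obtain ⟨G, hG, hasSum_G⟩ := exists_memLp_ae_hasSum (fun j => T_meas (aj_memLp j)) h.p_pos
    h.p_le_one h.p_le_q hF.cost_lt_top hD fun j => (atom_le b hb _ (hF.isAtom j)).1
  obtain ⟨ε, -, hε, hε0⟩ := exists_seq_strictAnti_tendsto (0 : ℝ)
  have eq_G : T f =ᵐ[volume] G := by
    refine ae_of_forall_ball fun R hR => ?_
    have hq : ENNReal.ofReal q ≠ 0 := (ENNReal.ofReal_pos.2 h.q_pos).ne'
    have tendsto_Tf := h.tendsto_commutator_mollify hΩ hℓ hb hR hf hε hε0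
    have norm_mono (g : Rn n → ℂ) := eLpNorm_mono_measure g (p := ENNReal.ofReal q)
      (Measure.restrict_le_self (μ := volume) (s := ball (0 : Rn n) R))
    have tendsto_G : Tendsto (fun k => eLpNorm (T (mollify (ε k) f) - G) (ENNReal.ofReal q)
        (volume.restrict (ball 0 R))) atTop (𝓝 0) := by
      refine tendsto_eLpNorm_sub_of_ae_hasSum
        (fun k j => (T_meas (memLp_mollify (hε k) one_le_two (aj_memLp j))).restrict)
        (fun j => (T_meas (aj_memLp j)).restrict) h.p_pos h.p_le_one h.p_le_q hF.cost_lt_top hD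
        (fun k j => (norm_mono _).trans ((atom_le b hb _ (hF.isAtom j)).2 _ (hε k)))
        (fun j => (norm_mono _).trans (atom_le b hb _ (hF.isAtom j)).1)
        (fun j => ?_) (fun k => ae_restrict_of_ae
          (h.ae_hasSum_commutator_mollify hΩ hℓ₀ hℓ₀2 hb hF hFf (hε k)))
        (ae_restrict_of_ae hasSum_G)
      obtain ⟨x₀, d, had⟩ := (hF.isAtom j).exists_isAtomOn h.p_pos h.p_le_one
      exact h.tendsto_commutator_mollify hΩ hℓ₀ hb hR
        (had.memLp_of_le_two (by simpa using ENNReal.ofReal_le_ofReal hℓ₀2)) hε hε0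
    have meas (k : ℕ) := (T_meas (memLp_mollify (hε k) hℓ.one_lt.le hf)).restrict (s := ball 0 R)
    exact tendstoInMeasure_ae_unique
      (tendstoInMeasure_of_tendsto_eLpNorm hq meas (T_meas hf).restrict tendsto_Tf)
      (tendstoInMeasure_of_tendsto_eLpNorm hq meas hG.1.restrict tendsto_G)
  filter_upwards [hasSum_G, eq_G] with x hx hGx
  rwa [hGx]

end Exponents

end AtomicDecomposition

/-! ### The Hardy space -/

/-- The sequence that runs through the terms of `u` and of `v` alternately. -/
def interleave {A : Type*} (u v : ℕ → A) : ℕ → A :=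
  Sum.elim u v ∘ Equiv.natSumNatEquivNat.symm

theorem forall_interleave {A : Type*} {P : A → Prop} {u v : ℕ → A} (hu : ∀ j, P (u j))
    (hv : ∀ j, P (v j)) (j : ℕ) : P (interleave u v j) := by
  rcases hj : Equiv.natSumNatEquivNat.symm j with k | k
  · simpa [interleave, hj] using hu k
  · simpa [interleave, hj] using hv k

theorem hasSum_interleave {A B M : Type*} [AddCommMonoid M] [TopologicalSpace M] [ContinuousAdd M]
    {Φ : A → B → M} {u u' : ℕ → A} {v v' : ℕ → B} {x y : M}
    (h : HasSum (fun j => Φ (u j) (v j)) x) (h' : HasSum (fun j => Φ (u' j) (v' j)) y) :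
    HasSum (fun j => Φ (interleave u u' j) (interleave v v' j)) (x + y) :=
  (Equiv.natSumNatEquivNat.symm.hasSum_iff
    (f := fun i => Φ (Sum.elim u u' i) (Sum.elim v v' i))).2 (HasSum.sum h h')

section Hardy

variable {n : ℕ} {p : ℝ} {F G : 𝓢'(Rn n, ℂ)} {c c' : ℕ → ℂ} {a a' : ℕ → Rn n → ℂ}

namespace IsAtomicDecomposition

theorem add (h : IsAtomicDecomposition p F c a) (h' : IsAtomicDecomposition p G c' a') :
    IsAtomicDecomposition p (F + G) (interleave c c') (interleave a a') where
  isAtom := forall_interleave h.isAtom h'.isAtom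
  cost_lt_top := by
    have cost := hasSum_interleave (Φ := fun z (_ : ℂ) => ‖z‖ₑ ^ p) (v := c) (v' := c')
      (ENNReal.summable (f := fun j => ‖c j‖ₑ ^ p)).hasSum
      (ENNReal.summable (f := fun j => ‖c' j‖ₑ ^ p)).hasSum
    rw [cost.tsum_eq]
    exact ENNReal.add_lt_top.2 ⟨h.cost_lt_top, h'.cost_lt_top⟩
  hasSum φ := hasSum_interleave (Φ := fun z (u : Rn n → ℂ) => z * ∫ x, u x * φ x)
    (h.hasSum φ) (h'.hasSum φ)

theorem smul (hp : 0 < p) (h : IsAtomicDecomposition p F c a) (τ : ℂ) :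
    IsAtomicDecomposition p (τ • F) (fun j => τ * c j) a where
  isAtom := h.isAtom
  cost_lt_top := by
    simp only [enorm_mul, ENNReal.mul_rpow_of_nonneg _ _ hp.le, ENNReal.tsum_mul_left]
    exact ENNReal.mul_lt_top (ENNReal.rpow_lt_top_of_nonneg hp.le enorm_ne_top) h.cost_lt_top
  hasSum φ := by simpa [mul_assoc] using (h.hasSum φ).mul_left τ

theorem sub_sum (h : IsAtomicDecomposition p F c a) {A : ℕ → 𝓢'(Rn n, ℂ)}
    (hA : ∀ j (φ : 𝓢(Rn n, ℂ)), A j φ = ∫ x, a j x * φ x) (N : ℕ) :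
    IsAtomicDecomposition p (F - ∑ j ∈ Finset.range N, c j • A j) (fun j => c (j + N))
      (fun j => a (j + N)) where
  isAtom j := h.isAtom (j + N)
  cost_lt_top := (ENNReal.tsum_comp_le_tsum_of_injective (add_left_injective N)
    fun j => ‖c j‖ₑ ^ p).trans_lt h.cost_lt_top
  hasSum φ := by
    have apply_sub : (F - ∑ j ∈ Finset.range N, c j • A j) φ =
        F φ - ∑ j ∈ Finset.range N, c j * ∫ x, a j x * φ x := by
      simp [← hA]
    rw [apply_sub]
    exact (hasSum_nat_add_iff' N).2 (h.hasSum φ)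

theorem hardyNorm_le (h : IsAtomicDecomposition p F c a) :
    hardyNorm p F ≤ (∑' j, ‖c j‖ₑ ^ p) ^ (1 / p) :=
  iInf_le_of_le c (iInf_le_of_le a (iInf_le_of_le h le_rfl))

end IsAtomicDecomposition

theorem le_mul_hardyNorm {hp : 0 < p} (F : Hardy n p hp) {x D : ℝ≥0∞} (hD : D ≠ ∞)
    (h : ∀ c a, IsAtomicDecomposition p (F : 𝓢'(Rn n, ℂ)) c a →
      x ≤ D * (∑' j, ‖c j‖ₑ ^ p) ^ (1 / p)) :
    x ≤ D * hardyNorm p (F : 𝓢'(Rn n, ℂ)) := by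
  rcases eq_or_ne D 0 with rfl | hD0
  · obtain ⟨c, a, hF⟩ := F.2
    simpa using h c a hF
  · simpa only [hardyNorm, ENNReal.mul_iInf_of_ne hD0 hD, le_iInf_iff] using h

theorem IsAtom.exists_hardy (hp : 0 < p) {a : Rn n → ℂ} (ha : IsAtom p 2 a) :
    ∃ A : Hardy n p hp, ∀ φ : 𝓢(Rn n, ℂ), (A : 𝓢'(Rn n, ℂ)) φ = ∫ x, a x * φ x := by
  have a_memLp : MemLp a 2 volume := by simpa using ha.1
  have apply_eq (φ : 𝓢(Rn n, ℂ)) :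
      Lp.toTemperedDistribution (a_memLp.toLp a) φ = ∫ x, a x * φ x := by
    rw [Lp.toTemperedDistribution_apply]
    refine integral_congr_ae ?_
    filter_upwards [a_memLp.coeFn_toLp] with x hx
    rw [hx, smul_eq_mul, mul_comm]
  have decomposition : IsAtomicDecomposition p (Lp.toTemperedDistribution (a_memLp.toLp a))
      (Pi.single 0 1) (fun _ => a) := by
    refine ⟨fun _ => ha, ?_, fun φ => ?_⟩
    · rw [tsum_eq_single 0 fun j hj => by simp [hj, hp]]
      simp
    · rw [apply_eq]
      simpa using hasSum_single (f := fun j => (Pi.single 0 1 : ℕ → ℂ) j * ∫ x, a x * φ x) 0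
        fun j hj => by simp [hj]
  exact ⟨⟨_, _, _, decomposition⟩, apply_eq⟩

theorem eq_zero_of_forall_isAtom {hp : 0 < p} {q : ℝ≥0∞} (hq : q ≠ 0)
    {S : Hardy n p hp →ₗ[ℂ] Lp ℂ q (volume : Measure (Rn n))} {M : ℝ≥0∞} (hM : M ≠ ∞)
    (bound : ∀ F, eLpNorm (S F) q volume ≤ M * hardyNorm p (F : 𝓢'(Rn n, ℂ)))
    (h : ∀ a, IsAtom p 2 a → ∀ A : Hardy n p hp,
      (∀ φ : 𝓢(Rn n, ℂ), (A : 𝓢'(Rn n, ℂ)) φ = ∫ x, a x * φ x) → S A = 0) : S = 0 := by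
  refine LinearMap.ext fun F => ?_
  obtain ⟨c, a, hF⟩ := F.2
  choose A hA using fun j => (hF.isAtom j).exists_hardy hp
  have le_tail (N : ℕ) :
      eLpNorm (S F) q volume ≤ M * (∑' j, ‖c (j + N)‖ₑ ^ p) ^ (1 / p) := by
    have S_tail : S (F - ∑ j ∈ Finset.range N, c j • A j) = S F := by
      simp [h _ (hF.isAtom _) _ (hA _)]
    have tail_decomposition := hF.sub_sum hA N
    rw [← S_tail]
    refine (bound _).trans ?_
    gcongr
    simpa using tail_decomposition.hardyNorm_le
  have tail_tendsto := ENNReal.Tendsto.const_mul (a := M)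
    ((ENNReal.tendsto_sum_nat_add _ hF.cost_lt_top.ne).ennrpow_const (1 / p)) (Or.inr hM)
  rw [ENNReal.zero_rpow_of_pos (one_div_pos.2 hp), mul_zero] at tail_tendsto
  have norm_zero := le_antisymm (ge_of_tendsto' tail_tendsto le_tail) zero_le
  rw [eLpNorm_eq_zero_iff (Lp.aestronglyMeasurable _) hq] at norm_zero
  exact Lp.ext (norm_zero.trans (Lp.coeFn_zero _ _ _).symm)

/-- `g` is what the operator that extends `T` from atoms takes at `F`: the almost everywhere sum of
`∑ j, c j • T (a j)` for every atomic decomposition `∑ j, c j • a j` of `F`. -/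
def IsSeriesValue (p : ℝ) (T : (Rn n → ℂ) → Rn n → ℂ) (F : 𝓢'(Rn n, ℂ)) (g : Rn n → ℂ) : Prop :=
  ∀ c a, IsAtomicDecomposition p F c a → ∀ᵐ x, HasSum (fun j => c j * T (a j) x) (g x)

section ExtensionByAtoms

variable (hp : 0 < p) {q : ℝ≥0∞} {T : (Rn n → ℂ) → Rn n → ℂ}

theorem exists_isSeriesValue
    (h : ∀ c a, IsAtomicDecomposition p F c a →
      ∃ g, MemLp g q volume ∧ ∀ᵐ x, HasSum (fun j => c j * T (a j) x) (g x))
    (h0 : ∀ c a, IsAtomicDecomposition p (0 : 𝓢'(Rn n, ℂ)) c a →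
      ∀ᵐ x, HasSum (fun j => c j * T (a j) x) 0)
    (hF : F ∈ Hardy n p hp) :
    ∃ g : Lp ℂ q (volume : Measure (Rn n)), IsSeriesValue p T F g := by
  obtain ⟨c, a, hca⟩ := hF
  obtain ⟨g, hg, hasSum_g⟩ := h c a hca
  refine ⟨hg.toLp g, fun c' a' hca' => ?_⟩
  obtain ⟨g', -, hasSum_g'⟩ := h c' a' hca'
  have decomposition_zero := hca.add (hca'.smul hp (-1))
  rw [show F + (-1 : ℂ) • F = 0 by ext φ; simp] at decomposition_zero
  filter_upwards [hasSum_g, hasSum_g', h0 _ _ decomposition_zero, hg.coeFn_toLp]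
    with x hx hx' hx0 hgx
  have neg_hasSum : HasSum (fun j => -1 * c' j * T (a' j) x) (-1 * g' x) := by
    simpa only [mul_assoc] using hx'.mul_left (-1)
  have sum_eq_zero : g x + -1 * g' x = 0 :=
    (hasSum_interleave (Φ := fun z u => z * T u x) hx neg_hasSum).unique hx0
  rwa [hgx, show g x = g' x by linear_combination sum_eq_zero]

theorem exists_linearMap_of_isSeriesValue
    (h : ∀ F ∈ Hardy n p hp, ∃ g : Lp ℂ q (volume : Measure (Rn n)), IsSeriesValue p T F g) :
    ∃ S : Hardy n p hp →ₗ[ℂ] Lp ℂ q (volume : Measure (Rn n)),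
      ∀ F : Hardy n p hp, IsSeriesValue p T (F : 𝓢'(Rn n, ℂ)) (S F) := by
  choose S hS using fun F : Hardy n p hp => h F F.2
  refine ⟨⟨⟨S, fun F G => Lp.ext ?_⟩, fun τ F => Lp.ext ?_⟩, hS⟩
  · obtain ⟨c, a, hF⟩ := F.2
    obtain ⟨c', a', hG⟩ := G.2
    filter_upwards [hS F _ _ hF, hS G _ _ hG, hS (F + G) _ _ (hF.add hG),
      Lp.coeFn_add (S F) (S G)] with x hFx hGx hFGx add_apply
    rw [add_apply]
    exact hFGx.unique (hasSum_interleave (Φ := fun z u => z * T u x) hFx hGx)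
  · obtain ⟨c, a, hF⟩ := F.2
    filter_upwards [hS F _ _ hF, hS (τ • F) _ _ (hF.smul hp τ), Lp.coeFn_smul τ (S F)]
      with x hFx hτx smul_apply
    rw [RingHom.id_apply, smul_apply]
    refine hτx.unique ?_
    simpa only [mul_assoc, Pi.smul_apply, smul_eq_mul] using hFx.mul_left τ

end ExtensionByAtoms

end Hardy

/-! ### The commutator on `H^p` -/

theorem IsCommutatorExtension.unique {n : ℕ} {p : ℝ} {hp : 0 < p} (hp1 : p ≤ 1)
    {q r α β ℓ : ℝ} (hq : 0 < q) (hℓ2 : ℓ ≤ 2) (hrℓ : r / (r - 1) < ℓ) (hℓ : ℓ < n / (α + β))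
    {Ω : Rn n → Rn n → ℂ} {b : Rn n → ℂ}
    {S S' : Hardy n p hp →ₗ[ℂ] Lp ℂ (ENNReal.ofReal q) (volume : Measure (Rn n))}
    (h : IsCommutatorExtension hp q r α β Ω b S) (h' : IsCommutatorExtension hp q r α β Ω b S') :
    S = S' := by
  obtain ⟨M, hM⟩ := h.bounded
  obtain ⟨M', hM'⟩ := h'.bounded
  have hK := (ENNReal.LpAddConst_lt_top (ENNReal.ofReal q)).ne
  refine sub_eq_zero.1 (eq_zero_of_forall_isAtom (ENNReal.ofReal_pos.2 hq).ne'
    (M := (ENNReal.ofReal q).LpAddConst * (M + M')) (by finiteness) (fun F => ?_)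
    fun a ha A hA => ?_)
  · rw [LinearMap.sub_apply, eLpNorm_congr_ae (Lp.coeFn_sub _ _), mul_assoc, add_mul]
    refine (eLpNorm_sub_le' (Lp.aestronglyMeasurable _) (Lp.aestronglyMeasurable _) _).trans ?_
    gcongr
    exacts [hM F, hM' F]
  · obtain ⟨x₀, d, had⟩ := ha.exists_isAtomOn hp hp1
    have a_memLp : MemLp a (ENNReal.ofReal ℓ) volume :=
      had.memLp_of_le_two (by simpa using ENNReal.ofReal_le_ofReal hℓ2)
    exact sub_eq_zero.2 (Lp.ext ((h.agrees A ℓ a hrℓ hℓ a_memLp hA).2.trans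
      (h'.agrees A ℓ a hrℓ hℓ a_memLp hA).2.symm))

theorem admissible_of_lt {n : ℕ} {α β r ℓ : ℝ} (hr : 1 < r) (hαβ : 0 < α + β)
    (hrℓ : r / (r - 1) < ℓ) (hℓ : ℓ < n / (α + β)) :
    Admissible n (r / (r - 1)) (n - α - β) ℓ := by
  have hr1 : 0 < r - 1 := sub_pos.2 hr
  have hℓ1 : 1 < ℓ := lt_trans (by rw [lt_div_iff₀ hr1]; linarith) hrℓ
  refine ⟨hℓ1, hrℓ.le, ?_⟩
  rw [lt_div_iff₀ hαβ] at hℓ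
  rw [Real.conjExponent, ← mul_div_assoc, lt_div_iff₀ (sub_pos.2 hℓ1)]
  linarith

namespace Exponents

variable {n : ℕ} [NeZero n] {α β p q r t Q ℓ₀ : ℝ} {Ω : Rn n → Rn n → ℂ}

theorem exists_linearMap (h : Exponents n α β p q r t Q) (hΩ : IsKernel r Ω)
    (hDini : DiniCondition r β Ω) (hℓ₀ : Admissible n t (n - α - β) ℓ₀) (hℓ₀2 : ℓ₀ ≤ 2) :
    ∃ C : ℝ≥0∞, C ≠ ∞ ∧ ∀ b : Rn n → ℂ, lipNorm β b < ∞ →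
      ∃ S : Hardy n p h.p_pos →ₗ[ℂ] Lp ℂ (ENNReal.ofReal q) (volume : Measure (Rn n)),
      (∀ F : Hardy n p h.p_pos, IsSeriesValue p (commutator Ω α b) (F : 𝓢'(Rn n, ℂ)) (S F)) ∧
      ∀ F : Hardy n p h.p_pos, eLpNorm (S F) (ENNReal.ofReal q) volume ≤
        C * lipNorm β b * hardyNorm p (F : 𝓢'(Rn n, ℂ)) := by
  obtain ⟨C, hC, atom_le⟩ := h.exists_eLpNorm_commutator_atom_le hΩ hDini
  refine ⟨C, hC, fun b hb => ?_⟩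
  have hD : C * lipNorm β b ≠ ∞ := by finiteness
  have meas {a : Rn n → ℂ} (ha : IsAtom p 2 a) :
      AEStronglyMeasurable (commutator Ω α b a) volume :=
    aestronglyMeasurable_commutator hΩ h.β_pos hb α ha.1.1
  obtain ⟨S, hS⟩ := exists_linearMap_of_isSeriesValue h.p_pos (q := ENNReal.ofReal q)
    (T := commutator Ω α b) fun F => exists_isSeriesValue h.p_pos
      (fun c a hF => exists_memLp_ae_hasSum (fun j => meas (hF.isAtom j)) h.p_pos h.p_le_one
        h.p_le_q hF.cost_lt_top hD fun j => (atom_le b hb _ (hF.isAtom j)).1)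
      (fun c a hF => by
        simpa [commutator, commutatorIntegrand] using
          h.ae_hasSum_commutator_of_isAtomicDecomposition hΩ hDini hℓ₀ hℓ₀2 hb hF hℓ₀
            (f := 0) MemLp.zero (fun φ => by simp))
  exact ⟨S, hS, fun F => le_mul_hardyNorm F hD fun c a hF =>
    eLpNorm_le_of_ae_hasSum (fun j => meas (hF.isAtom j)) h.p_pos h.p_le_one h.p_le_q
      (fun j => (atom_le b hb _ (hF.isAtom j)).1) (hS F c a hF)⟩

theorem isCommutatorExtension (h : Exponents n α β p q r (r / (r - 1)) Q) (hΩ : IsKernel r Ω)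
    (hDini : DiniCondition r β Ω) (hαβ : 0 < α + β)
    (hℓ₀ : Admissible n (r / (r - 1)) (n - α - β) ℓ₀) (hℓ₀2 : ℓ₀ ≤ 2) {b : Rn n → ℂ}
    (hb : lipNorm β b < ∞) {M : ℝ≥0∞} (hM : M ≠ ∞)
    {S : Hardy n p h.p_pos →ₗ[ℂ] Lp ℂ (ENNReal.ofReal q) (volume : Measure (Rn n))}
    (hS : ∀ F : Hardy n p h.p_pos, IsSeriesValue p (commutator Ω α b) (F : 𝓢'(Rn n, ℂ)) (S F))
    (hSM : ∀ F : Hardy n p h.p_pos,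
      eLpNorm (S F) (ENNReal.ofReal q) volume ≤ M * hardyNorm p (F : 𝓢'(Rn n, ℂ))) :
    IsCommutatorExtension h.p_pos q r α β Ω b S where
  bounded := ⟨M.toNNReal, by rwa [ENNReal.coe_toNNReal hM]⟩
  agrees F ℓ f hrℓ hℓ hf hFf := by
    have hℓ' := admissible_of_lt h.conj.lt hαβ hrℓ hℓ
    refine ⟨h.ae_integrable_commutatorIntegrand hΩ hℓ' hb hf, ?_⟩
    obtain ⟨c, a, hF⟩ := F.2
    filter_upwards [hS F c a hF, h.ae_hasSum_commutator_of_isAtomicDecomposition hΩ hDini hℓ₀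
      hℓ₀2 hb hF hℓ' hf hFf] with x hSx hTx
    exact hSx.unique hTx

end Exponents

theorem exponents_of_max_lt {n : ℕ} {α β p q r : ℝ} (hβ0 : 0 < β) (hβ1 : β ≤ 1)
    (hn : 2 * β ≤ n) (hα0 : -β < α) (hα : α < n - β) (hp0 : 0 < p) (hp : (n : ℝ) / (n + β) < p)
    (hp1 : p ≤ 1) (hq : 1 / q = 1 / p - (α + β) / n)
    (hr : max ((n : ℝ) / (β + n - n / p)) ((n : ℝ) / (n - α - β)) < r) :
    Exponents n α β p q r (r / (r - 1)) (max q (r / (r - 1))) := by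
  have hn0 : (0 : ℝ) < n := by linarith
  have hnp : (n : ℝ) / p < n + β := (div_lt_comm₀ (by positivity) hp0).1 hp
  have hnp1 : (n : ℝ) ≤ n / p := le_div_self hn0.le hp0 hp1
  have hr0 : 0 < r := lt_of_le_of_lt (div_nonneg hn0.le (by linarith)) (max_lt_iff.1 hr).1
  have hnr : (n : ℝ) / r < β + n - n / p :=
    (div_lt_comm₀ (by linarith) hr0).1 (max_lt_iff.1 hr).1
  have hr2 : 2 < r := by
    have : (n : ℝ) < β * r := (div_lt_iff₀ hr0).1 (by linarith)
    nlinarith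
  have hrel : (n : ℝ) / q = n / p - α - β := by
    rw [← mul_one_div, hq]
    field_simp
    ring
  have hq0 : 0 < q := (div_pos_iff_of_pos_left hn0).1 (by linarith : 0 < (n : ℝ) / q)
  have conj : r.HolderConjugate (r / (r - 1)) := .conjExponent (by linarith)
  have hnt : (n : ℝ) / r + n / (r / (r - 1)) = n := by
    field_simp
    ring
  refine ⟨conj, hβ0, hβ1, hp0, hp1, hq0, ?_, le_max_left _ _, le_max_right _ _, ?_, ?_, hrel, ?_,
    by linarith⟩
  · exact (div_le_div_iff_of_pos_left hn0 hq0 hp0).1 (by linarith)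
  · rw [div_lt_iff₀ (by linarith)]
    linarith
  · have : 0 < (n : ℝ) / r := div_pos hn0 hr0
    rcases max_choice q (r / (r - 1)) with hmax | hmax <;> rw [hmax] <;> linarith
  · rw [← div_lt_iff₀ hq0, hrel]
    linarith

theorem div_sub_one_lt_div {s r m : ℝ} (hr : 1 < r) (hs : 0 < s) (hsm : 0 < m - s)
    (h : m / (m - s) < r) : r / (r - 1) < m / s := by
  rw [div_lt_iff₀ hsm] at h
  rw [div_lt_div_iff₀ (by linarith) hs]
  linarith

end VariableKernel

theorem theorem1p2_general (n : ℕ) (α β p q r : ℝ) (hβ0 : 0 < β) (hβ1 : β ≤ 1)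
    (hn : 2 * β ≤ n) (hα0 : -β < α) (hα : α < n - β)
    (hp0 : 0 < p) (hp : (n : ℝ) / (n + β) < p) (hp1 : p ≤ 1)
    (hq : 1 / q = 1 / p - (α + β) / n)
    (hr : max ((n : ℝ) / (β + n - n / p)) ((n : ℝ) / (n - α - β)) < r)
    (Ω : Rn n → Rn n → ℂ) (hΩ : IsKernel r Ω) (hDini : DiniCondition r β Ω) :
    ∃ C : ℝ≥0, 0 < C ∧ ∀ b : Rn n → ℂ, lipNorm β b < ∞ →
      (∃! S, IsCommutatorExtension hp0 q r α β Ω b S) ∧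
      ∀ S, IsCommutatorExtension hp0 q r α β Ω b S → ∀ F : Hardy n p hp0,
        eLpNorm (S F) (ENNReal.ofReal q) volume
          ≤ C * lipNorm β b * hardyNorm p (F : 𝓢'(Rn n, ℂ)) := by
  have : NeZero n := ⟨by rintro rfl; norm_num at hn; linarith⟩
  have h := exponents_of_max_lt hβ0 hβ1 hn hα0 hα hp0 hp hp1 hq hr
  have hαβ : 0 < α + β := by linarith
  have hrn : r / (r - 1) < n / (α + β) := div_sub_one_lt_div h.conj.lt hαβ (by linarith)
    (by simpa only [sub_sub] using (max_lt_iff.1 hr).2)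
  obtain ⟨ℓ, hrℓ, hℓ⟩ := exists_between (lt_min h.t_lt_two hrn)
  obtain ⟨hℓ2, hℓn⟩ := lt_min_iff.1 hℓ
  have hadm := admissible_of_lt h.conj.lt hαβ hrℓ hℓn
  obtain ⟨C, hC, exists_linearMap⟩ := h.exists_linearMap hΩ hDini hadm hℓ2.le
  refine ⟨C.toNNReal + 1, by positivity, fun b hb => ?_⟩
  obtain ⟨S, hS, hSC⟩ := exists_linearMap b hb
  have extension : IsCommutatorExtension hp0 q r α β Ω b S :=
    h.isCommutatorExtension hΩ hDini hαβ hadm hℓ2.le hb (by finiteness) hS hSC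
  have unique (S') (h' : IsCommutatorExtension hp0 q r α β Ω b S') : S' = S :=
    h'.unique hp1 h.q_pos hℓ2.le hrℓ hℓn extension
  refine ⟨⟨S, extension, unique⟩, fun S' h' F => unique S' h' ▸ (hSC F).trans ?_⟩
  gcongr
  simp [hC]

theorem theorem1p2 (n : ℕ) (hn : 2 ≤ n) (α β p q r : ℝ)
    (hβ0 : 0 < β) (hβ1 : β ≤ 1) (hα0 : 0 ≤ α) (hα : α < n - β)
    (hp0 : 0 < p) (hp : (n : ℝ) / (n + β) < p) (hp1 : p < 1)
    (hq : 1 / q = 1 / p - (α + β) / n)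
    (hr : max ((n : ℝ) / (β + n - n / p)) ((n : ℝ) / (n - α - β)) < r)
    (Ω : Rn n → Rn n → ℂ) (hΩ : IsKernel r Ω) (hDini : DiniCondition r β Ω) :
    ∃ C : ℝ≥0, 0 < C ∧ ∀ b : Rn n → ℂ, lipNorm β b < ∞ →
      (∃! S, IsCommutatorExtension hp0 q r α β Ω b S) ∧
      ∀ S, IsCommutatorExtension hp0 q r α β Ω b S → ∀ F : Hardy n p hp0,
        eLpNorm (S F) (ENNReal.ofReal q) volume
          ≤ C * lipNorm β b * hardyNorm p (F : 𝓢'(Rn n, ℂ)) := by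
  have hn' : (2 : ℝ) ≤ n := by exact_mod_cast hn
  exact theorem1p2_general n α β p q r hβ0 hβ1 (by linarith) (by linarith) hα hp0 hp hp1.le hq hr
    Ω hΩ hDini
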